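/- Let $I$ be one of $\mathbb R$, $(0,\infty)$, $(0,b)$ with $b>0$. Let $V$ be a real function on $I$ that is nonnegative, locally integrable on $\overline I$ and, if $I$ is unbounded, satisfies $V(x)/\log|x|\to\infty$ as $|x|\to\infty$ in $I$. Let $\Xi=(\Xi(x))_{x\in\mathbb R}$ be a centered Gaussian process with stationary increments which almost surely satisfies $\Xi(0)=0$ and has continuous sample paths. Write $\langle f,g\rangle=\int_I fg$ and $\|f\|_2=\langle f,f\rangle^{1/2}$ on the real space $L^2=L^2(I)$, and let $\mathrm H^1_V$ be the set of $f:\overline I\to\mathbb R$, locally absolutely continuous on $\overline I$, with $\|f\|_2,\|f'\|_2,\|V^{1/2}f\|_2<\infty$. Fix $\alpha,\beta\in\mathbb R$ and one of the following choices of $D(\mathcal E)\subset\mathrm H^1_V$ and of the forms $$\mathcal E(f,g)=\tfrac12\langle f',g'\rangle+\langle fg,V\rangle+\partial(f,g),\qquad \xi(fg)=-\langle f'g+fg',\Xi\rangle+\partial_\Xi(f,g):$$ * $I=\mathbb R$: $D(\mathcal E)=\mathrm H^1_V$, $\partial=0$; * $I=(0,\infty)$, Dirichlet: $D(\mathcal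 E)=\{f\in\mathrm H^1_V:f(0)=0\}$, $\partial=0$; * $I=(0,\infty)$, Robin: $D(\mathcal E)=\mathrm H^1_V$, $\partial(f,g)=-\frac\alpha2f(0)g(0)$; * $I=(0,b)$, Dirichlet: $D(\mathcal E)=\{f\in\mathrm H^1_V:f(0)=f(b)=0\}$, $\partial=0$; * $I=(0,b)$, Robin: $D(\mathcal E)=\mathrm H^1_V$, $\partial(f,g)=-\frac\alpha2f(0)g(0)-\frac\beta2f(b)g(b)$; * $I=(0,b)$, mixed: $D(\mathcal E)=\{f\in\mathrm H^1_V:f(b)=0\}$, $\partial(f,g)=-\frac\alpha2f(0)g(0)$; where $\partial_\Xi(f,g)=f(b)g(b)\Xi(b)$ in the case $I=(0,b)$, Robin, and $\partial_\Xi=0$ in all the others. The formula for $\xi(fg)$ is used for $f,g\in D(\mathcal E)$ with bounded support, and $\xi(fg)$ denotes its extension by continuity, in the norm $(\|f'\|_2^2+\|V^{1/2}f\|_2^2+\|f\|_2^2)^{1/2}$, to all $f,g\in D(\mathcal E)$. Put $\hat{\mathcal E}(f,g)=\mathcal E(f,g)+\xi(fg)$. Then almost surely this extension exists; there is exactly one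 self-adjoint operator $\hat H$ with dense domain $D(\hat H)\subset L^2$ such that $D(\hat H)\subset D(\mathcal E)$ and $\langle f,\hat Hg\rangle=\hat{\mathcal E}(f,g)$ for all $f\in D(\mathcal E)$ and $g\in D(\hat H)$; this $\hat H$ has compact resolvent; and all its eigenvalues, with multiplicity, can be listed as $\lambda_1\le\lambda_2\le\cdots$. For every such list, with associated eigenfunctions $\psi_1,\psi_2,\ldots$ (for each eigenvalue $\mu$, the $\psi_k$ with $\lambda_k=\mu$ are an orthonormal basis of the eigenspace of $\mu$): 1. $-\infty<\lambda_1\le\lambda_2\le\cdots\nearrow+\infty$; 2. $(\psi_k)_{k\ge1}$ is an orthonormal basis of $L^2$; 3. for every $k\ge1$, $$\lambda_k=\inf\left\{\frac{\hat{\mathcal E}(\psi,\psi)}{\|\psi\|_2^2}:\ \psi\in D(\mathcal E),\ \psi\ne0,\ \psi\perp\psi_1,\ldots,\psi_{k-1}\right\},$$ and $\psi_k$ is, up to sign, the unique minimizer of this infimum with unit $L^2$ norm. -/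

import Mathlib

open MeasureTheory ProbabilityTheory Filter Topology Set

noncomputable section

namespace RandomSchrodinger

/-- The six admissible choices of a domain together with boundary conditions:
the full line, the half line `(0, ∞)` (Dirichlet, or Robin `f'(0) + α f(0) = 0`), and the bounded
interval `(0, b)` (Dirichlet, Robin `f'(0) + α f(0) = -f'(b) + β f(b) = 0`, or mixed
`f'(0) + α f(0) = f(b) = 0`). -/
inductive Problem : Type
  | line
  | halfDirichlet
  | halfRobin (α : ℝ)
  | intervalDirichlet (b : ℝ) (hb : 0 < b)
  | intervalRobin (b : ℝ) (hb : 0 < b) (α β : ℝ)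
  | intervalMixed (b : ℝ) (hb : 0 < b) (α : ℝ)

namespace Problem

/-- The open interval `I`. -/
def dom : Problem → Set ℝ
  | line => univ
  | halfDirichlet => Ioi 0
  | halfRobin _ => Ioi 0
  | intervalDirichlet b _ => Ioo 0 b
  | intervalRobin b _ _ _ => Ioo 0 b
  | intervalMixed b _ _ => Ioo 0 b

/-- The boundary conditions which are imposed on the form domain (the Dirichlet ones). -/
def DirichletCondition (f : ℝ → ℝ) : Problem → Prop
  | line => True
  | halfDirichlet => f 0 = 0
  | halfRobin _ => True
  | intervalDirichlet b _ => f 0 = 0 ∧ f b = 0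
  | intervalRobin _ _ _ _ => True
  | intervalMixed b _ _ => f b = 0

/-- The boundary term of the deterministic form. -/
def boundaryTerm (f g : ℝ → ℝ) : Problem → ℝ
  | line => 0
  | halfDirichlet => 0
  | halfRobin α => -(α / 2) * (f 0 * g 0)
  | intervalDirichlet _ _ => 0
  | intervalRobin b _ α β => -(α / 2) * (f 0 * g 0) - β / 2 * (f b * g b)
  | intervalMixed _ _ α => -(α / 2) * (f 0 * g 0)

/-- The boundary term of the noise form. -/
def noiseBoundaryTerm (w f g : ℝ → ℝ) : Problem → ℝ
  | line => 0
  | halfDirichlet => 0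
  | halfRobin _ => 0
  | intervalDirichlet _ _ => 0
  | intervalRobin b _ _ _ => f b * g b * w b
  | intervalMixed _ _ _ => 0

/-- Lebesgue measure on `I`. -/
def meas (c : Problem) : Measure ℝ := volume.restrict c.dom

/-- The real Hilbert space `L²(I)`. -/
abbrev L2 (c : Problem) : Type := Lp ℝ 2 c.meas

/-- Local absolute continuity on the closure of `I`. -/
def LocallyAC (c : Problem) (f : ℝ → ℝ) : Prop :=
  ∀ x ∈ closure c.dom, ∀ y ∈ closure c.dom, AbsolutelyContinuousOnInterval f x y

/-- The form domain `D(ℰ)`: locally absolutely continuous functions `f` on the closure of `I`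
such that `f`, `f'` and `V^{1/2} f` are square integrable on `I`, with the Dirichlet conditions.
Only the values of `f` on the closure of `I` matter. -/
def formDomain (c : Problem) (V : ℝ → ℝ) : Set (ℝ → ℝ) :=
  {f | c.LocallyAC f ∧ MemLp f 2 c.meas ∧ MemLp (deriv f) 2 c.meas ∧
    MemLp (fun x => √(V x) * f x) 2 c.meas ∧ c.DirichletCondition f}

/-- The deterministic form `ℰ(f, g) = ½⟨f', g'⟩ + ⟨fg, V⟩ + (boundary terms)`. -/
def energy (c : Problem) (V f g : ℝ → ℝ) : ℝ :=
  1 / 2 * (∫ x, deriv f x * deriv g x ∂c.meas) + (∫ x, f x * g x * V x ∂c.meas)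
    + c.boundaryTerm f g

/-- The squared form norm `‖f'‖² + ‖V^{1/2} f‖² + ‖f‖²` on the form domain. -/
def formNormSq (c : Problem) (V f : ℝ → ℝ) : ℝ :=
  ∫ x, (deriv f x ^ 2 + (V x + 1) * f x ^ 2) ∂c.meas

/-- The elements of the form domain with bounded support (all of it if `I` is bounded). -/
def formCore (c : Problem) (V : ℝ → ℝ) : Set (ℝ → ℝ) :=
  {f | f ∈ c.formDomain V ∧ ∃ R : ℝ, ∀ x ∈ c.dom, R < |x| → f x = 0}

/-- The explicit formula `ξ(fg) = -⟨f'g + fg', Ξ⟩ + (boundary terms)` along a path `w` of `Ξ`.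
For continuous `w` the integral converges absolutely for `f`, `g` in the form core, but on an
unbounded `I` not in general for `f`, `g` in the form domain. -/
def noiseFormula (c : Problem) (w f g : ℝ → ℝ) : ℝ :=
  -(∫ x, (deriv f x * g x + f x * deriv g x) * w x ∂c.meas) + c.noiseBoundaryTerm w f g

/-- The filter of pairs of elements of the form core which approach `(f, g)` in the form norm. -/
def coreNhds (c : Problem) (V f g : ℝ → ℝ) : Filter ((ℝ → ℝ) × (ℝ → ℝ)) :=
  comap (fun p => c.formNormSq V (p.1 - f) + c.formNormSq V (p.2 - g)) (𝓝 0)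
    ⊓ 𝓟 (c.formCore V ×ˢ c.formCore V)

/-- The noise form `ξ(fg)` for `f`, `g` in the form domain: the extension by continuity of
`noiseFormula` from the form core. It is meaningful under `NoiseFormWellDefined` below. -/
def noise (c : Problem) (V w f g : ℝ → ℝ) : ℝ :=
  limUnder (c.coreNhds V f g) (fun p => c.noiseFormula w p.1 p.2)

/-- The explicit noise form extends by continuity from the form core to the form domain. -/
def NoiseFormWellDefined (c : Problem) (V w : ℝ → ℝ) : Prop :=
  ∀ f ∈ c.formDomain V, ∀ g ∈ c.formDomain V, (c.coreNhds V f g).NeBot ∧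
    Tendsto (fun p => c.noiseFormula w p.1 p.2) (c.coreNhds V f g) (𝓝 (c.noise V w f g))

/-- The perturbed form `ℰ(f, g) + ξ(fg)`. -/
def form (c : Problem) (V w f g : ℝ → ℝ) : ℝ :=
  c.energy V f g + c.noise V w f g

/-- `A` is a self-adjoint operator with dense domain in `L²(I)` associated with the perturbed form:
`D(A) ⊆ D(ℰ)`, and `⟨f, A u⟩` is the form at `(f, u)` for all `f ∈ D(ℰ)` and `u ∈ D(A)`. -/
structure IsFormOperator (c : Problem) (V w : ℝ → ℝ) (A : c.L2 →ₗ.[ℝ] c.L2) : Prop where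
  dense : Dense (A.domain : Set c.L2)
  selfAdjoint : IsSelfAdjoint A
  domain_le : ∀ u ∈ A.domain, ∃ f ∈ c.formDomain V, f =ᵐ[c.meas] u
  form_eq : ∀ f ∈ c.formDomain V, ∀ g ∈ c.formDomain V, ∀ u : A.domain,
    g =ᵐ[c.meas] (u : c.L2) → c.form V w f g = ∫ x, f x * (A u) x ∂c.meas

/-- `A` has compact resolvent: for some `z`, `A - z` is a bijection from `D(A)` onto `L²(I)` whose
inverse is a compact operator. -/
def HasCompactResolvent (c : Problem) (A : c.L2 →ₗ.[ℝ] c.L2) : Prop :=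
  ∃ (z : ℝ) (R : c.L2 →L[ℝ] c.L2), IsCompactOperator R ∧
    (∀ v : c.L2, ∃ h : R v ∈ A.domain, A ⟨R v, h⟩ - z • R v = v) ∧
    (∀ u : A.domain, R (A u - z • (u : c.L2)) = u)

/-- `ev 0 ≤ ev 1 ≤ ⋯` lists all the eigenvalues of `A` in increasing order with multiplicity,
and the `ψ k` are associated eigenfunctions: for each real `μ`, those `ψ k` with `ev k = μ` form an
orthonormal basis of the eigenspace of `μ`. -/
structure IsEigenEnumeration (c : Problem) (A : c.L2 →ₗ.[ℝ] c.L2) (ev : ℕ → ℝ)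
    (ψ : ℕ → c.L2) : Prop where
  mono : Monotone ev
  eigen : ∀ k, ∃ h : ψ k ∈ A.domain, A ⟨ψ k, h⟩ = ev k • ψ k
  norm_one : ∀ k, ‖ψ k‖ = 1
  orthogonal : ∀ j k, j ≠ k → ev j = ev k → inner ℝ (ψ j) (ψ k) = 0
  exhaust : ∀ (μ : ℝ) (u : A.domain), A u = μ • (u : c.L2) →
    (u : c.L2) ∈ Submodule.span ℝ (ψ '' {k | ev k = μ})

/-- The nonzero elements of the form domain which are orthogonal to `ψ j` for all `j < k`. -/
def trialFunctions (c : Problem) (V : ℝ → ℝ) (ψ : ℕ → c.L2) (k : ℕ) : Set (ℝ → ℝ) :=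
  {f | f ∈ c.formDomain V ∧ (∫ x, f x ^ 2 ∂c.meas) ≠ 0 ∧
    ∀ j < k, ∫ x, f x * ψ j x ∂c.meas = 0}

/-- The quotient of the perturbed form at `(f, f)` by `‖f‖²`. -/
def rayleigh (c : Problem) (V w f : ℝ → ℝ) : ℝ :=
  c.form V w f f / ∫ x, f x ^ 2 ∂c.meas

/-- The conditions on the potential: nonnegative on `I`, locally integrable on the closure of `I`,
and `V(x) / log |x| → ∞` as `|x| → ∞` in `I` (an empty condition if `I` is bounded). -/
structure IsPotential (c : Problem) (V : ℝ → ℝ) : Prop where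
  nonneg : ∀ x ∈ c.dom, 0 ≤ V x
  locallyIntegrable : LocallyIntegrableOn V (closure c.dom)
  growth : Tendsto (fun x => V x / Real.log |x|) (Bornology.cobounded ℝ ⊓ 𝓟 c.dom) atTop

end Problem

/-- The increments of `X` are stationary: for each `a`, the process `x ↦ X (x + a) - X a` has the
same finite-dimensional distributions as `x ↦ X x - X 0`. -/
def HasStationaryIncrements {Ω : Type*} [MeasurableSpace Ω] (P : Measure Ω) (X : ℝ → Ω → ℝ) :
    Prop :=
  ∀ (a : ℝ) (s : Finset ℝ), IdentDistrib (fun ω (x : s) => X ((x : ℝ) + a) ω - X a ω)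
    (fun ω (x : s) => X (x : ℝ) ω - X 0 ω) P P

/-- A centered Gaussian process on `ℝ`, almost surely continuous and zero at the origin, with
stationary increments. -/
structure IsNoisePrimitive {Ω : Type*} [MeasurableSpace Ω] (P : Measure Ω) (X : ℝ → Ω → ℝ) :
    Prop where
  gaussian : IsGaussianProcess X P
  centered : ∀ x, ∫ ω, X x ω ∂P = 0
  zero : ∀ᵐ ω ∂P, X 0 ω = 0
  continuous : ∀ᵐ ω ∂P, Continuous fun x => X x ω
  stationary : HasStationaryIncrements P X

end RandomSchrodinger

end

/-!
The argument separates probability from analysis: almost surely the path of the noise has the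
oscillation bound of `IsNoisePrimitive.ae_path`, and for each path with this bound the perturbed form
is closed, bounded below, compactly embedded and has simple eigenvalues.

*Oscillation.* Fernique's theorem, in a form whose constants do not depend on the dimension, gives
Gaussian tails for the supremum of the increments of the noise over a unit interval. By stationarity
the tails are the same from every starting point, so that the Borel–Cantelli lemma bounds the
increments from `x` over distances at most one by a constant times `√(log (3 + |x|))`.

*Noise as a lower order form.* On an unbounded interval the path is split into its average over unit
intervals and the deviation `r` from that average. Integrating the smooth part by parts turns the noise
form into `-⟨(fg)', r⟩ + ⟨fg, s⟩` with a boundary term, where `s` is the derivative of the average. Both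
`r` and `s` are of order `√log`, so `r²` and `s` are bounded relative to `V` with arbitrarily small
constants, as `V` grows faster than the logarithm (`exists_lowerOrder`). On a bounded interval the path
is bounded, and no splitting is needed. Such a form has relative bound zero with respect to the
principal part `½‖f'‖² + ⟨f², V⟩` (`LowerOrder.IsSmall.abs_lowerForm_le`); the boundary terms do too, by
the trace inequality. Hence the noise form is bounded in the form norm, is the extension by continuity
from the dense form core (`noise_eq`), and the total form is coercive after a shift. The form domain is
a Hilbert space (`completeSpace_formSpace`), compactly embedded into `L²` because `V` tends to infinity
(`isCompactOperator_embed`).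

*Abstract forms.* For a form with these properties (`IsCoerciveForm`) the Lax–Milgram theorem gives a
compact, injective, self-adjoint resolvent, whose inverse is the operator of the form. It is the only
one, as self-adjoint operators are maximal. The spectral theorem for compact operators makes the
eigenvectors an orthonormal basis, and Bessel's inequality for the form together with Parseval's
identity gives the variational principle (`IsCoerciveForm.eigenvalue_mul_le`).

*Simplicity.* That the minimizer is unique up to sign needs each eigenvalue to be simple. By the lemma
of du Bois-Reymond an eigenfunction `h` is continuously differentiable, and `½h' - rh` is a primitive
of a locally integrable function which is linear in `h` and `h'`. So `h` is determined by its value and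
derivative at a point, and the Wronskian of two eigenfunctions with the same eigenvalue vanishes
(`hasSimpleEigenvalues`).
-/

/-! ### Closed forms with compact embedding and their operators -/

set_option linter.unusedSectionVars false

section AbstractForm

variable {H W : Type*} [NormedAddCommGroup H] [InnerProductSpace ℝ H] [CompleteSpace H]
  [NormedAddCommGroup W] [InnerProductSpace ℝ W] [CompleteSpace W]

/-- A closed symmetric form `a`, bounded below and with compact embedding: the form domain is a
Hilbert space `W`, embedded into `H` by the injective compact operator `J` with dense range, and
`a` becomes coercive on `W` after adding `m` times the inner product of `H`. -/
structure IsCoerciveForm (J : W →L[ℝ] H) (a : W →L[ℝ] W →L[ℝ] ℝ) (m : ℝ) : Prop where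
  inj : Function.Injective J
  dense : DenseRange J
  compact : IsCompactOperator J
  symm : ∀ u v, a u v = a v u
  coercive : ∃ δ > 0, ∀ u, δ * ‖u‖ ^ 2 ≤ a u u + m * ‖J u‖ ^ 2

/-- `u` satisfies the weak eigenvalue equation `a(u, ·) = μ ⟨J u, J ·⟩`. -/
def IsWeakEigenvector (J : W →L[ℝ] H) (a : W →L[ℝ] W →L[ℝ] ℝ) (μ : ℝ) (u : W) : Prop :=
  ∀ w, a u w = μ * inner ℝ (J u) (J w)

namespace IsCoerciveForm

variable {J : W →L[ℝ] H} {a : W →L[ℝ] W →L[ℝ] ℝ} {m : ℝ}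

/-- The shifted form is coercive, so the Lax–Milgram theorem inverts it. -/
theorem exists_green (h : IsCoerciveForm J a m) :
    ∃ G : H →L[ℝ] W, ∀ v w, a (G v) w + m * inner ℝ (J (G v)) (J w) = inner ℝ v (J w) := by
  obtain ⟨δ, hδ, hc⟩ := h.coercive
  let b : W →L[ℝ] W →L[ℝ] ℝ := a + m •
    (isBoundedBilinearMap_inner (𝕜 := ℝ) (E := H)).toContinuousLinearMap.bilinearComp J J
  have hb (u v : W) : b u v = a u v + m * inner ℝ (J u) (J v) := by
    simp [b]
  have hco : IsCoercive b := by
    refine ⟨δ, hδ, fun u => ?_⟩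
    rw [hb, real_inner_self_eq_norm_sq]
    simpa [pow_two, mul_assoc] using hc u
  refine ⟨(hco.continuousLinearEquivOfBilin.symm : W →L[ℝ] W) ∘L J.adjoint, fun v w => ?_⟩
  rw [← hb, ← hco.continuousLinearEquivOfBilin_apply]
  simp [ContinuousLinearMap.adjoint_inner_left]

/-- The inverse of the shifted form, as an operator from `H` to the form domain. -/
noncomputable def green (h : IsCoerciveForm J a m) : H →L[ℝ] W := h.exists_green.choose

theorem green_spec (h : IsCoerciveForm J a m) (v : H) (w : W) :
    a (h.green v) w + m * inner ℝ (J (h.green v)) (J w) = inner ℝ v (J w) :=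
  h.exists_green.choose_spec v w

theorem eq_zero_of_shifted (h : IsCoerciveForm J a m) {u : W}
    (hu : a u u + m * ‖J u‖ ^ 2 ≤ 0) : u = 0 := by
  obtain ⟨δ, hδ, hc⟩ := h.coercive
  have := (hc u).trans hu
  have h2 : ‖u‖ ^ 2 ≤ 0 := by
    by_contra hh
    push Not at hh
    nlinarith
  simpa using le_antisymm h2 (by positivity)

theorem eq_green (h : IsCoerciveForm J a m) {u : W} {v : H}
    (hu : ∀ w, a u w + m * inner ℝ (J u) (J w) = inner ℝ v (J w)) : u = h.green v := by
  rw [← sub_eq_zero]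
  apply h.eq_zero_of_shifted
  have h1 := hu (u - h.green v)
  have h2 := h.green_spec v (u - h.green v)
  rw [← real_inner_self_eq_norm_sq]
  set w := u - h.green v with hw
  have e1 : a w w = a u w - a (h.green v) w := by
    conv_lhs => rw [hw]
    simp [hw]
  have e2 : inner ℝ (J w) (J w) = inner ℝ (J u) (J w) - inner ℝ (J (h.green v)) (J w) := by
    rw [← inner_sub_left, ← map_sub]
  rw [e1, e2]
  linarith

/-- The resolvent `J ∘ green` of the operator of the form, at the point `-m`. -/
noncomputable def resolvent (h : IsCoerciveForm J a m) : H →L[ℝ] H := J ∘L h.green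

theorem resolvent_apply (h : IsCoerciveForm J a m) (v : H) : h.resolvent v = J (h.green v) := rfl

theorem isCompactOperator_resolvent (h : IsCoerciveForm J a m) : IsCompactOperator h.resolvent :=
  h.compact.comp_clm h.green

theorem inner_resolvent (h : IsCoerciveForm J a m) (v w : H) :
    inner ℝ (h.resolvent v) w = inner ℝ v (h.resolvent w) := by
  have h1 := h.green_spec v (h.green w)
  have h2 := h.green_spec w (h.green v)
  rw [h.symm, real_inner_comm] at h2
  rw [real_inner_comm, resolvent_apply, resolvent_apply, ← h1, ← h2]

theorem isSymmetric_resolvent (h : IsCoerciveForm J a m) :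
    (h.resolvent : H →ₗ[ℝ] H).IsSymmetric := fun v w => h.inner_resolvent v w

theorem eq_zero_of_inner_range (h : IsCoerciveForm J a m) {v : H}
    (hv : ∀ w, inner ℝ v (J w) = 0) : v = 0 :=
  h.dense.eq_zero_of_inner_left ℝ hv

theorem resolvent_injective (h : IsCoerciveForm J a m) : Function.Injective h.resolvent := by
  rw [injective_iff_map_eq_zero]
  intro v hv
  have hg : h.green v = 0 := h.inj (by simpa [resolvent_apply] using hv)
  apply h.eq_zero_of_inner_range
  intro w
  rw [← h.green_spec v w, hg]
  simp

/-- The operator associated with the form: the inverse of the resolvent, shifted back by `m`. -/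
noncomputable def operator (h : IsCoerciveForm J a m) : H →ₗ.[ℝ] H where
  domain := LinearMap.range (h.resolvent : H →ₗ[ℝ] H)
  toFun := (LinearEquiv.ofInjective (h.resolvent : H →ₗ[ℝ] H) h.resolvent_injective).symm.toLinearMap
    - m • (LinearMap.range (h.resolvent : H →ₗ[ℝ] H)).subtype

theorem resolvent_mem (h : IsCoerciveForm J a m) (v : H) : h.resolvent v ∈ h.operator.domain :=
  ⟨v, rfl⟩

theorem operator_resolvent (h : IsCoerciveForm J a m) (v : H) (hv) :
    h.operator ⟨h.resolvent v, hv⟩ = v - m • h.resolvent v := by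
  have : (LinearEquiv.ofInjective (h.resolvent : H →ₗ[ℝ] H) h.resolvent_injective).symm
      ⟨h.resolvent v, hv⟩ = v := by
    rw [LinearEquiv.symm_apply_eq]
    rfl
  change (LinearEquiv.ofInjective (h.resolvent : H →ₗ[ℝ] H) h.resolvent_injective).symm
      ⟨h.resolvent v, hv⟩ - m • h.resolvent v = _
  rw [this]

theorem exists_eq_resolvent (h : IsCoerciveForm J a m) (x : h.operator.domain) :
    ∃ v hv, x = ⟨h.resolvent v, hv⟩ ∧ h.operator x = v - m • h.resolvent v := by
  obtain ⟨x, v, rfl⟩ := x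
  exact ⟨v, h.resolvent_mem v, rfl, h.operator_resolvent v _⟩

theorem dense_operator_domain (h : IsCoerciveForm J a m) : Dense (h.operator.domain : Set H) := by
  rw [Submodule.dense_iff_topologicalClosure_eq_top, Submodule.topologicalClosure_eq_top_iff,
    Submodule.eq_bot_iff]
  intro v hv
  have h0 (w : H) : inner ℝ w (h.resolvent v) = 0 := by
    rw [← h.inner_resolvent]
    exact hv _ (h.resolvent_mem w)
  exact h.resolvent_injective (by simpa using h0 (h.resolvent v))

/-- The form is represented by the operator on the operator domain. -/
theorem form_eq_inner_operator (h : IsCoerciveForm J a m) (w u : W) (x : h.operator.domain)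
    (hx : J u = x) : a w u = inner ℝ (J w) (h.operator x) := by
  obtain ⟨v, hv, rfl, hA⟩ := h.exists_eq_resolvent x
  have hu : u = h.green v := h.inj hx
  have := h.green_spec v w
  rw [hA, inner_sub_right, inner_smul_right, resolvent_apply, hu, h.symm,
    real_inner_comm v, ← this, real_inner_comm (J w)]
  ring

/-- The operator is symmetric, and its shift by `m` is onto, so its adjoint has no larger domain. -/
theorem isSelfAdjoint_operator (h : IsCoerciveForm J a m) : IsSelfAdjoint h.operator := by
  rw [LinearPMap.isSelfAdjoint_def]
  have hd := h.dense_operator_domain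
  have hle : h.operator ≤ h.operator.adjoint := by
    apply LinearPMap.IsFormalAdjoint.le_adjoint hd
    intro x y
    obtain ⟨v, hv, rfl, hA⟩ := h.exists_eq_resolvent x
    obtain ⟨w, hw, rfl, hB⟩ := h.exists_eq_resolvent y
    rw [hA, hB, inner_sub_left, inner_sub_right, inner_smul_left, inner_smul_right]
    simp [h.inner_resolvent]
  refine (LinearPMap.eq_of_le_of_domain_eq hle (le_antisymm hle.1 fun y hy => ?_)).symm
  -- An element `y` of the adjoint domain with image `z` is the resolvent of `z + m y`.
  have hadj := fun v : H => LinearPMap.adjoint_isFormalAdjoint hd ⟨y, hy⟩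
    ⟨h.resolvent v, h.resolvent_mem v⟩
  set z := h.operator.adjoint ⟨y, hy⟩
  have : h.resolvent (z + m • y) = y := by
    rw [← sub_eq_zero, ← inner_self_eq_zero (𝕜 := ℝ)]
    set v := h.resolvent (z + m • y) - y
    have h1 := hadj v
    rw [h.operator_resolvent, inner_sub_right, inner_smul_right] at h1
    have h2 : inner ℝ (h.resolvent (z + m • y)) v = inner ℝ y v := by
      rw [h.inner_resolvent, inner_add_left, inner_smul_left]
      simp only [conj_trivial] at *
      linarith
    change inner ℝ (h.resolvent (z + m • y) - y) v = 0
    rw [inner_sub_left, h2, sub_self]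
  rw [← this]
  exact h.resolvent_mem _

/-- Uniqueness of the operator of a form, by maximality of self-adjoint operators: the form equation
makes `A` a restriction of the operator of the form. -/
theorem eq_operator (h : IsCoerciveForm J a m) (A : H →ₗ.[ℝ] H) (hA : IsSelfAdjoint A)
    (hdom : ∀ x : A.domain, ∃ u, J u = x)
    (hform : ∀ (w u : W) (x : A.domain), J u = x → a w u = inner ℝ (J w) (A x)) :
    A = h.operator := by
  have key (x : A.domain) : h.resolvent (A x + m • (x : H)) = x := by
    obtain ⟨u, hu⟩ := hdom x
    rw [resolvent_apply, ← h.eq_green (u := u), hu]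
    intro w
    rw [h.symm, hform w u x hu, hu, inner_add_left, inner_smul_left, real_inner_comm]
    simp
  have hle : A ≤ h.operator := by
    refine ⟨fun x hx => ?_, ?_⟩
    · have := h.resolvent_mem (A ⟨x, hx⟩ + m • x)
      rwa [key ⟨x, hx⟩] at this
    · rintro x ⟨y, hy⟩ hxy
      have : (⟨y, hy⟩ : h.operator.domain) =
          ⟨h.resolvent (A x + m • (x : H)), h.resolvent_mem _⟩ :=
        Subtype.ext ((key x).trans hxy).symm
      rw [this, h.operator_resolvent, key]
      simp
  refine LinearPMap.eq_of_le_of_domain_eq hle (le_antisymm hle.1 fun y hy => ?_)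
  -- Taking adjoints reverses the inclusion, and both operators are their own adjoints.
  rw [← LinearPMap.isSelfAdjoint_def.1 hA]
  refine A.mem_adjoint_domain_of_exists y ⟨h.operator ⟨y, hy⟩, fun x => ?_⟩
  have hs := LinearPMap.isSelfAdjoint_def.1 h.isSelfAdjoint_operator
  have hf : h.operator.IsFormalAdjoint h.operator := by
    conv_lhs => rw [← hs]
    exact LinearPMap.adjoint_isFormalAdjoint h.dense_operator_domain
  rw [hf ⟨y, hy⟩ ⟨x, hle.1 x.2⟩, hle.2 (x := x) (y := ⟨x, hle.1 x.2⟩) rfl]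

/-- Eigenvectors of the form are those of the resolvent, with eigenvalue `(μ + m)⁻¹`. -/
theorem isWeakEigenvector_iff (h : IsCoerciveForm J a m) {μ : ℝ} {u : W} :
    IsWeakEigenvector J a μ u ↔ u = (μ + m) • h.green (J u) := by
  rw [← map_smul]
  constructor
  · intro hu
    apply h.eq_green
    intro w
    rw [hu w, inner_smul_left]
    simp only [conj_trivial]
    ring
  · intro hu w
    have := h.green_spec ((μ + m) • J u) w
    rw [← hu, inner_smul_left] at this
    simp only [conj_trivial] at this
    linarith

theorem isWeakEigenvector_of_operator (h : IsCoerciveForm J a m) {μ : ℝ} {u : W}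
    {x : h.operator.domain} (hx : J u = x) (hA : h.operator x = μ • (x : H)) :
    IsWeakEigenvector J a μ u := by
  intro w
  rw [h.symm, h.form_eq_inner_operator w u x hx, hA, hx, inner_smul_right, real_inner_comm]

theorem operator_of_isWeakEigenvector (h : IsCoerciveForm J a m) {μ : ℝ} {u : W}
    (hu : IsWeakEigenvector J a μ u) :
    ∃ hx : J u ∈ h.operator.domain, h.operator ⟨J u, hx⟩ = μ • J u := by
  rw [h.isWeakEigenvector_iff, ← map_smul] at hu
  have hJ : J u = h.resolvent ((μ + m) • J u) := by
    conv_lhs => rw [hu]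
    rfl
  have hx : J u ∈ h.operator.domain := by
    rw [hJ]
    exact h.resolvent_mem _
  refine ⟨hx, ?_⟩
  have : (⟨J u, hx⟩ : h.operator.domain) = ⟨h.resolvent ((μ + m) • J u), h.resolvent_mem _⟩ :=
    Subtype.ext hJ
  rw [this, h.operator_resolvent, ← hJ, add_smul]
  abel

theorem exists_of_mem_domain (h : IsCoerciveForm J a m) (x : h.operator.domain) :
    ∃ u, J u = x := by
  obtain ⟨v, hv, rfl, -⟩ := h.exists_eq_resolvent x
  exact ⟨h.green v, rfl⟩

theorem exists_isCompactOperator_inverse (h : IsCoerciveForm J a m) :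
    ∃ (z : ℝ) (R : H →L[ℝ] H), IsCompactOperator R ∧
      (∀ v : H, ∃ hv : R v ∈ h.operator.domain, h.operator ⟨R v, hv⟩ - z • R v = v) ∧
      (∀ u : h.operator.domain, R (h.operator u - z • (u : H)) = u) := by
  refine ⟨-m, h.resolvent, h.isCompactOperator_resolvent, fun v => ⟨h.resolvent_mem v, ?_⟩,
    fun u => ?_⟩
  · rw [h.operator_resolvent]
    simp
  · obtain ⟨v, hv, rfl, hA⟩ := h.exists_eq_resolvent u
    rw [hA]
    simp

theorem inner_eq_zero_of_ne (h : IsCoerciveForm J a m) {μ ν : ℝ} {u v : W}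
    (hu : IsWeakEigenvector J a μ u) (hv : IsWeakEigenvector J a ν v) (hμν : μ ≠ ν) :
    inner ℝ (J u) (J v) = 0 := by
  have h1 := hu v
  rw [h.symm, hv u, real_inner_comm] at h1
  have : (μ - ν) * inner ℝ (J u) (J v) = 0 := by linarith
  exact (mul_eq_zero.1 this).resolve_left (sub_ne_zero.2 hμν)

/-- An infinite orthonormal system of eigenvectors has unbounded eigenvalues, as it would otherwise
be bounded in the form domain and hence have a convergent subsequence in `H`. -/
theorem not_bounded_eigenvalues (h : IsCoerciveForm J a m) (e : ℕ → W) (ev : ℕ → ℝ)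
    (he : ∀ k, IsWeakEigenvector J a (ev k) (e k)) (ho : Orthonormal ℝ (fun k => J (e k)))
    (c : ℝ) (hc : ∀ k, ev k ≤ c) : False := by
  obtain ⟨δ, hδ, hcoer⟩ := h.coercive
  have hb (k : ℕ) : e k ∈ Metric.closedBall (0 : W) (√((c + m) / δ)) := by
    rw [mem_closedBall_zero_iff]
    apply Real.le_sqrt_of_sq_le
    rw [le_div_iff₀ hδ]
    have h1 := hcoer (e k)
    rw [he k, real_inner_self_eq_norm_sq, ho.1 k] at h1
    linarith [hc k]
  obtain ⟨K, hK, hsub⟩ := h.compact.image_closedBall_subset_compact (𝕜₁ := ℝ) (f := (J : W →ₗ[ℝ] H))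
    (√((c + m) / δ))
  obtain ⟨x, -, φ, hφ, hlim⟩ := hK.tendsto_subseq (x := fun k => J (e k))
    (fun k => hsub ⟨e k, hb k, rfl⟩)
  obtain ⟨N, hN⟩ := Metric.cauchySeq_iff.1 hlim.cauchySeq 1 one_pos
  have hd := hN N le_rfl (N + 1) (Nat.le_succ N)
  have hne : φ N ≠ φ (N + 1) := (hφ (Nat.lt_succ_self N)).ne
  rw [dist_eq_norm] at hd
  have hsq := norm_sub_sq_real (J (e (φ N))) (J (e (φ (N + 1))))
  rw [ho.1, ho.1, ho.2 hne] at hsq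
  simp only [Function.comp_apply] at hd
  nlinarith [norm_nonneg (J (e (φ N)) - J (e (φ (N + 1))))]

theorem exists_isWeakEigenvector_of_resolvent (h : IsCoerciveForm J a m) {ν : ℝ} {x : H}
    (hx : h.resolvent x = ν • x) (h0 : x ≠ 0) :
    ∃ u : W, J u = x ∧ IsWeakEigenvector J a (ν⁻¹ - m) u := by
  have hν : ν ≠ 0 := by
    rintro rfl
    exact h0 (h.resolvent_injective (by simpa using hx))
  have hJ : J (ν⁻¹ • h.green x) = x := by
    rw [map_smul, ← resolvent_apply, hx, inv_smul_smul₀ hν]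
  refine ⟨ν⁻¹ • h.green x, hJ, ?_⟩
  rw [h.isWeakEigenvector_iff, hJ]
  simp

/-- The spectral theorem: a subspace which contains all eigenvectors is dense. -/
theorem orthogonal_eq_bot_of_eigenvectors (h : IsCoerciveForm J a m) (F : Submodule ℝ H)
    (hF : ∀ μ u, IsWeakEigenvector J a μ u → J u ∈ F) : Fᗮ = ⊥ := by
  rw [eq_bot_iff, ← ContinuousLinearMap.orthogonalComplement_iSup_eigenspaces_eq_bot
    h.isCompactOperator_resolvent h.isSymmetric_resolvent]
  apply Submodule.orthogonal_le
  refine iSup_le fun ν x hx => ?_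
  rw [Module.End.mem_eigenspace_iff] at hx
  by_cases h0 : x = 0
  · rw [h0]
    exact F.zero_mem
  obtain ⟨u, rfl, hu⟩ := h.exists_isWeakEigenvector_of_resolvent hx h0
  exact hF _ u hu

end IsCoerciveForm

end AbstractForm

/-! ### Enumeration of the eigenvalues and the variational principle -/

/-- An infinite set of reals with finitely many elements below each level is the range of a strictly
increasing sequence. -/
theorem exists_strictMono_range_eq {S : Set ℝ} (hinf : S.Infinite)
    (hfin : ∀ c, (S ∩ Iic c).Finite) : ∃ f : ℕ → ℝ, StrictMono f ∧ range f = S := by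
  have hmin (T : Set ℝ) (hT : T ⊆ S) (hne : T.Nonempty) : ∃ x ∈ T, ∀ y ∈ T, x ≤ y := by
    obtain ⟨t, ht⟩ := hne
    obtain ⟨x, ⟨hxT, hxt⟩, hx⟩ := ((hfin t).subset (inter_subset_inter_left _ hT)).exists_minimal
      ⟨t, ht, mem_Iic.2 le_rfl⟩
    refine ⟨x, hxT, fun y hy => ?_⟩
    by_contra! hlt
    exact hlt.not_ge (hx ⟨hy, hlt.le.trans hxt⟩ hlt.le)
  have hstep (c : ℝ) : ∃ x ∈ S ∩ Ioi c, ∀ y ∈ S ∩ Ioi c, x ≤ y := by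
    apply hmin _ inter_subset_left
    by_contra hemp
    apply hinf
    refine (hfin c).subset fun x hx => ⟨hx, ?_⟩
    by_contra hc
    exact hemp ⟨x, hx, mem_Ioi.2 (not_le.1 hc)⟩
  obtain ⟨x₀, hx₀S, hx₀⟩ := hmin S subset_rfl hinf.nonempty
  choose nxt hnxt hleast using hstep
  let f : ℕ → ℝ := fun n => Nat.rec x₀ (fun _ y => nxt y) n
  have hf (n : ℕ) : f (n + 1) = nxt (f n) := rfl
  have hmono : StrictMono f := strictMono_nat_of_lt_succ fun n => by
    rw [hf]
    exact (hnxt (f n)).2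
  have hmem (n : ℕ) : f n ∈ S := by
    cases n with
    | zero => exact hx₀S
    | succ n => exact (hnxt (f n)).1
  refine ⟨f, hmono, Subset.antisymm (range_subset_iff.2 hmem) fun s hs => ?_⟩
  by_contra hn
  have hlt (n : ℕ) : f n < s := by
    induction n with
    | zero => exact lt_of_le_of_ne (hx₀ s hs) fun h => hn ⟨0, h⟩
    | succ n ih => exact lt_of_le_of_ne (hleast (f n) s ⟨hs, ih⟩) fun h => hn ⟨n + 1, h⟩
  refine (infinite_range_of_injective hmono.injective) ((hfin s).subset ?_)
  rintro _ ⟨n, rfl⟩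
  exact ⟨hmem n, (hlt n).le⟩

section AbstractForm

variable {H W : Type*} [NormedAddCommGroup H] [InnerProductSpace ℝ H] [CompleteSpace H]
  [NormedAddCommGroup W] [InnerProductSpace ℝ W] [CompleteSpace W]

/-- Every eigenvalue of the form is simple. -/
def HasSimpleEigenvalues (J : W →L[ℝ] H) (a : W →L[ℝ] W →L[ℝ] ℝ) : Prop :=
  ∀ μ u v, IsWeakEigenvector J a μ u → IsWeakEigenvector J a μ v → u ≠ 0 → ∃ t : ℝ, v = t • u

/-- The weak counterpart of `RandomSchrodinger.Problem.IsEigenEnumeration`: `ev` lists the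
eigenvalues of the form in increasing order with multiplicity, and the `e k` are eigenvectors whose
images in `H` are orthonormal within each eigenspace and span it. -/
structure IsWeakEigenEnumeration (J : W →L[ℝ] H) (a : W →L[ℝ] W →L[ℝ] ℝ) (ev : ℕ → ℝ)
    (e : ℕ → W) : Prop where
  mono : Monotone ev
  eigen : ∀ k, IsWeakEigenvector J a (ev k) (e k)
  norm_one : ∀ k, ‖J (e k)‖ = 1
  orthogonal : ∀ j k, j ≠ k → ev j = ev k → inner ℝ (J (e j)) (J (e k)) = 0
  exhaust : ∀ μ u, IsWeakEigenvector J a μ u →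
    J u ∈ Submodule.span ℝ ((fun k => J (e k)) '' {k | ev k = μ})

theorem IsWeakEigenvector.smul {J : W →L[ℝ] H} {a : W →L[ℝ] W →L[ℝ] ℝ} {μ : ℝ} {u : W}
    (hu : IsWeakEigenvector J a μ u) (t : ℝ) : IsWeakEigenvector J a μ (t • u) := by
  intro w
  have := hu w
  simp only [map_smul, smul_apply, smul_eq_mul, inner_smul_left, conj_trivial,
    this]
  ring

namespace IsCoerciveForm

variable {J : W →L[ℝ] H} {a : W →L[ℝ] W →L[ℝ] ℝ} {m : ℝ}

/-- As the eigenvalues are simple, infinite in number and finite in number below each level, listing them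
in strictly increasing order accounts for the multiplicities. -/
theorem exists_enumeration (h : IsCoerciveForm J a m) (hs : HasSimpleEigenvalues J a)
    (hdim : ¬ FiniteDimensional ℝ H) :
    ∃ (ev : ℕ → ℝ) (e : ℕ → W), IsWeakEigenEnumeration J a ev e := by
  let S : Set ℝ := {μ | ∃ u, u ≠ 0 ∧ IsWeakEigenvector J a μ u}
  have hunit (μ : ℝ) (hμ : μ ∈ S) : ∃ u, ‖J u‖ = 1 ∧ IsWeakEigenvector J a μ u := by
    obtain ⟨u, h0, hu⟩ := hμ
    have hJ : ‖J u‖ ≠ 0 := fun h1 => h0 (h.inj (by simpa using h1))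
    refine ⟨‖J u‖⁻¹ • u, ?_, hu.smul _⟩
    rw [map_smul, norm_smul, norm_inv, norm_norm, inv_mul_cancel₀ hJ]
  choose! u hu1 hu using hunit
  have hne (μ : ℝ) (hμ : μ ∈ S) : u μ ≠ 0 := by
    intro h0
    simpa [h0] using hu1 μ hμ
  have hfin (c : ℝ) : (S ∩ Iic c).Finite := by
    by_contra hinf
    let f := Set.Infinite.natEmbedding _ hinf
    refine h.not_bounded_eigenvalues (fun n => u (f n)) (fun n => f n)
      (fun n => hu _ (f n).2.1) ⟨fun n => hu1 _ (f n).2.1, fun i j hij => ?_⟩ c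
      (fun n => (f n).2.2)
    exact h.inner_eq_zero_of_ne (hu _ (f i).2.1) (hu _ (f j).2.1)
      fun heq => hij (f.injective (Subtype.ext heq))
  have hinf : S.Infinite := by
    intro hS
    apply hdim
    have : FiniteDimensional ℝ (Submodule.span ℝ ((fun μ => J (u μ)) '' S)) :=
      FiniteDimensional.span_of_finite ℝ (hS.image _)
    have htop : Submodule.span ℝ ((fun μ => J (u μ)) '' S) = ⊤ := by
      rw [← Submodule.orthogonal_eq_bot_iff]
      apply h.orthogonal_eq_bot_of_eigenvectors
      intro μ v hv
      by_cases h0 : v = 0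
      · simp [h0]
      have hμ : μ ∈ S := ⟨v, h0, hv⟩
      obtain ⟨t, rfl⟩ := hs μ _ v (hu μ hμ) hv (hne μ hμ)
      rw [map_smul]
      exact Submodule.smul_mem _ _ (Submodule.subset_span ⟨μ, hμ, rfl⟩)
    rw [htop] at this
    exact Module.Finite.equiv (Submodule.topEquiv (R := ℝ) (M := H))
  obtain ⟨ev, hmono, hrange⟩ := exists_strictMono_range_eq hinf hfin
  have hmem (k : ℕ) : ev k ∈ S := hrange ▸ mem_range_self k
  refine ⟨ev, fun k => u (ev k), hmono.monotone, fun k => hu _ (hmem k),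
    fun k => hu1 _ (hmem k), fun j k hjk heq => absurd (hmono.injective heq) hjk, ?_⟩
  intro μ v hv
  by_cases h0 : v = 0
  · simp [h0]
  have hμ : μ ∈ S := ⟨v, h0, hv⟩
  obtain ⟨k, rfl⟩ : μ ∈ range ev := hrange ▸ hμ
  obtain ⟨t, rfl⟩ := hs _ _ v (hu _ hμ) hv (hne _ hμ)
  rw [map_smul]
  exact Submodule.smul_mem _ _ (Submodule.subset_span ⟨k, rfl, rfl⟩)

variable {ev : ℕ → ℝ} {e : ℕ → W}

theorem orthonormal (h : IsCoerciveForm J a m) (he : IsWeakEigenEnumeration J a ev e) :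
    Orthonormal ℝ (fun k => J (e k)) := by
  refine ⟨he.norm_one, fun j k hjk => ?_⟩
  by_cases heq : ev j = ev k
  · exact he.orthogonal j k hjk heq
  · exact h.inner_eq_zero_of_ne (he.eigen j) (he.eigen k) heq

theorem topologicalClosure_span (h : IsCoerciveForm J a m)
    (he : IsWeakEigenEnumeration J a ev e) :
    (Submodule.span ℝ (range fun k => J (e k))).topologicalClosure = ⊤ := by
  rw [Submodule.topologicalClosure_eq_top_iff]
  apply h.orthogonal_eq_bot_of_eigenvectors
  intro μ u hu
  exact Submodule.span_mono (image_subset_range _ _) (he.exhaust μ u hu)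

theorem tendsto_eigenvalues (h : IsCoerciveForm J a m) (he : IsWeakEigenEnumeration J a ev e) :
    Tendsto ev atTop atTop := by
  refine tendsto_atTop_atTop_of_monotone he.mono fun c => ?_
  by_contra! hc
  exact h.not_bounded_eigenvalues e ev he.eigen (h.orthonormal he) c fun k => (hc k).le

theorem eigenvalue_injective (h : IsCoerciveForm J a m) (he : IsWeakEigenEnumeration J a ev e)
    (hs : HasSimpleEigenvalues J a) : Function.Injective ev := by
  intro j k hjk
  by_contra hne
  have hj : e j ≠ 0 := fun h0 => by simpa [h0] using he.norm_one j
  obtain ⟨t, ht⟩ := hs _ _ (e k) (he.eigen j) (hjk ▸ he.eigen k) hj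
  have h0 : inner ℝ (J (e j)) (J (e k)) = 0 := (h.orthonormal he).2 hne
  rw [ht, map_smul, inner_smul_right, real_inner_self_eq_norm_sq, he.norm_one] at h0
  have := he.norm_one k
  rw [ht] at this
  simp at h0
  simp [h0] at this

/-- Bessel's inequality for the shifted form, combined with Parseval's identity in `H`. The second
term, for one arbitrary `i`, measures the failure of equality in the variational principle. -/
theorem eigenvalue_mul_le (h : IsCoerciveForm J a m) (he : IsWeakEigenEnumeration J a ev e)
    {k : ℕ} {u : W} (hu : ∀ j < k, inner ℝ (J (e j)) (J u) = 0) (i : ℕ) :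
    ev k * ‖J u‖ ^ 2 + (ev i - ev k) * inner ℝ (J (e i)) (J u) ^ 2 ≤ a u u := by
  have ho := h.orthonormal he
  set c : ℕ → ℝ := fun j => inner ℝ (J (e j)) (J u) with hc
  set b : W → W → ℝ := fun u v => a u v + m * inner ℝ (J u) (J v) with hb
  have hpars : HasSum (fun j => c j ^ 2) (‖J u‖ ^ 2) := by
    have hsum := (HilbertBasis.mk ho (h.topologicalClosure_span he).ge).hasSum_inner_mul_inner
      (J u) (J u)
    simp only [HilbertBasis.coe_mk, real_inner_self_eq_norm_sq] at hsum
    convert! hsum using 2 with j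
    rw [real_inner_comm (J (e j)), pow_two]
  have hbessel (n : ℕ) : ∑ j ∈ Finset.range n, (ev j + m) * c j ^ 2 ≤ b u u := by
    set s : W := ∑ j ∈ Finset.range n, c j • e j with hsdef
    have hbe (j : ℕ) (v : W) : b (e j) v = (ev j + m) * inner ℝ (J (e j)) (J v) := by
      simp only [hb]
      rw [he.eigen j v]
      ring
    have hbs (v : W) : b s v = ∑ j ∈ Finset.range n, c j * b (e j) v := by
      simp only [hb, hsdef, map_sum, map_smul, sum_apply, sum_inner,
        smul_apply, smul_eq_mul, inner_smul_left, conj_trivial,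
        Finset.mul_sum, ← Finset.sum_add_distrib]
      refine Finset.sum_congr rfl fun j _ => ?_
      ring
    have h1 : b s u = ∑ j ∈ Finset.range n, (ev j + m) * c j ^ 2 := by
      rw [hbs]
      refine Finset.sum_congr rfl fun j _ => ?_
      rw [hbe]
      ring
    have h2 : b s s = ∑ j ∈ Finset.range n, (ev j + m) * c j ^ 2 := by
      rw [hbs]
      refine Finset.sum_congr rfl fun j hj => ?_
      have : inner ℝ (J (e j)) (J s) = c j := by
        rw [hsdef, map_sum]
        simp only [map_smul]
        exact ho.inner_right_sum c hj
      rw [hbe, this]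
      ring
    have hpos : 0 ≤ b (u - s) (u - s) := by
      obtain ⟨δ, hδ, hcoer⟩ := h.coercive
      have := hcoer (u - s)
      simp only [hb, real_inner_self_eq_norm_sq]
      exact le_trans (by positivity) this
    have hexp : b (u - s) (u - s) = b u u - 2 * b s u + b s s := by
      simp only [hb, map_sub, sub_apply, inner_sub_left, inner_sub_right]
      rw [h.symm u s, real_inner_comm (J s) (J u)]
      ring
    rw [hexp, h1, h2] at hpos
    linarith
  have hpart (n : ℕ) (hn : i < n) :
      (ev k + m) * ∑ j ∈ Finset.range n, c j ^ 2 + (ev i - ev k) * c i ^ 2 ≤ b u u := by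
    refine le_trans ?_ (hbessel n)
    have hin : i ∈ Finset.range n := Finset.mem_range.2 hn
    rw [Finset.mul_sum, ← Finset.add_sum_erase _ _ hin,
      ← Finset.add_sum_erase _ (fun j => (ev j + m) * c j ^ 2) hin]
    have : ∑ j ∈ (Finset.range n).erase i, (ev k + m) * c j ^ 2 ≤
        ∑ j ∈ (Finset.range n).erase i, (ev j + m) * c j ^ 2 := by
      refine Finset.sum_le_sum fun j _ => ?_
      rcases lt_or_ge j k with hjk | hjk
      · simp [hc, hu j hjk]
      · gcongr
        exact he.mono hjk
    linarith
  have hlim := ((hpars.tendsto_sum_nat.const_mul (ev k + m)).add_const ((ev i - ev k) * c i ^ 2))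
  have := le_of_tendsto hlim ((eventually_gt_atTop i).mono hpart)
  simp only [hb, real_inner_self_eq_norm_sq] at this
  linarith

theorem eigenvalue_mul_norm_sq_le (h : IsCoerciveForm J a m)
    (he : IsWeakEigenEnumeration J a ev e) {k : ℕ} {u : W}
    (hu : ∀ j < k, inner ℝ (J (e j)) (J u) = 0) : ev k * ‖J u‖ ^ 2 ≤ a u u := by
  simpa using h.eigenvalue_mul_le he hu k

/-- Equality in the variational principle forces the components along all other eigenvectors to vanish,
since simplicity makes the eigenvalues after the `k`-th strictly larger. -/
theorem eq_smul_of_form_le (h : IsCoerciveForm J a m) (he : IsWeakEigenEnumeration J a ev e)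
    (hs : HasSimpleEigenvalues J a) {k : ℕ} {u : W}
    (hu : ∀ j < k, inner ℝ (J (e j)) (J u) = 0) (hle : a u u ≤ ev k * ‖J u‖ ^ 2) :
    ∃ t : ℝ, u = t • e k := by
  have ho := h.orthonormal he
  have hc (i : ℕ) (hik : i ≠ k) : inner ℝ (J (e i)) (J u) = 0 := by
    rcases lt_or_gt_of_ne hik with hlt | hgt
    · exact hu i hlt
    have h1 := (h.eigenvalue_mul_le he hu i).trans hle
    have h2 : ev k < ev i := lt_of_le_of_ne (he.mono hgt.le)
      fun heq => hik (h.eigenvalue_injective he hs heq.symm)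
    have h3 : inner ℝ (J (e i)) (J u) ^ 2 ≤ 0 := by
      by_contra! hpos
      nlinarith
    simpa using le_antisymm h3 (sq_nonneg _)
  -- `J u` has no component along `J (e i)` for `i ≠ k`, so it is its projection to `J (e k)`.
  refine ⟨inner ℝ (J (e k)) (J u), h.inj ?_⟩
  rw [← sub_eq_zero]
  have hmem : J u - J (inner ℝ (J (e k)) (J u) • e k) ∈
      (Submodule.span ℝ (range fun k => J (e k)))ᗮ := by
    rw [Submodule.mem_orthogonal]
    intro x hx
    induction hx using Submodule.span_induction with
    | mem x hx =>
      obtain ⟨i, rfl⟩ := hx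
      rw [map_smul, inner_sub_right, inner_smul_right]
      by_cases hik : i = k
      · rw [hik, real_inner_self_eq_norm_sq, he.norm_one]
        ring
      · rw [hc i hik, ho.2 hik]
        ring
    | zero => simp
    | add x y _ _ hx hy => rw [inner_add_left, hx, hy, add_zero]
    | smul t x _ hx => rw [inner_smul_left, hx, mul_zero]
  rwa [Submodule.topologicalClosure_eq_top_iff.1 (h.topologicalClosure_span he),
    Submodule.mem_bot] at hmem

end IsCoerciveForm

end AbstractForm

/-! ### Calculus on the form domain -/

/-- The Cauchy–Schwarz inequality, squared, for real functions. -/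
theorem sq_integral_mul_le {α : Type*} [MeasurableSpace α] {μ : Measure α} {f g : α → ℝ}
    (hf : MemLp f 2 μ) (hg : MemLp g 2 μ) :
    (∫ x, f x * g x ∂μ) ^ 2 ≤ (∫ x, f x ^ 2 ∂μ) * ∫ x, g x ^ 2 ∂μ := by
  have hfg : Integrable (fun x => f x * g x) μ := hf.integrable_mul hg
  have key (t : ℝ) : 0 ≤ (∫ x, f x ^ 2 ∂μ) * (t * t) + (2 * ∫ x, f x * g x ∂μ) * t
      + ∫ x, g x ^ 2 ∂μ := by
    have h0 : 0 ≤ ∫ x, (t * f x + g x) ^ 2 ∂μ := integral_nonneg fun x => sq_nonneg _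
    have h1 : ∫ x, (t * f x + g x) ^ 2 ∂μ =
        ∫ x, (t * t) * f x ^ 2 + (2 * t) * (f x * g x) + g x ^ 2 ∂μ := by
      congr 1 with x
      ring
    have h2 : Integrable (fun x => t * t * f x ^ 2 + 2 * t * (f x * g x)) μ :=
      (hf.integrable_sq.const_mul _).add (hfg.const_mul _)
    rw [h1, integral_add h2 hg.integrable_sq,
      integral_add (hf.integrable_sq.const_mul _) (hfg.const_mul _), integral_const_mul,
      integral_const_mul] at h0
    linarith
  have := discrim_le_zero key
  rw [discrim] at this
  nlinarith

theorem absolutelyContinuousOnInterval_congr {f g : ℝ → ℝ} {x y : ℝ}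
    (hf : AbsolutelyContinuousOnInterval f x y) (h : EqOn f g (uIcc x y)) :
    AbsolutelyContinuousOnInterval g x y := by
  rw [absolutelyContinuousOnInterval_iff] at hf ⊢
  intro ε hε
  obtain ⟨δ, hδ, hE⟩ := hf ε hε
  refine ⟨δ, hδ, fun E hEm hlt => ?_⟩
  convert! hE E hEm hlt using 1
  refine Finset.sum_congr rfl fun i hi => ?_
  rw [h (hEm.1 i hi).1, h (hEm.1 i hi).2]

namespace RandomSchrodinger

namespace Problem

variable {c : Problem} {V f g : ℝ → ℝ}

theorem isOpen_dom (c : Problem) : IsOpen c.dom := by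
  cases c <;> simp [dom, isOpen_Ioi, isOpen_Ioo]

theorem measurableSet_dom (c : Problem) : MeasurableSet c.dom := c.isOpen_dom.measurableSet

theorem closure_dom_cases (c : Problem) :
    (c.dom = univ ∧ closure c.dom = univ) ∨ (c.dom = Ioi 0 ∧ closure c.dom = Ici 0) ∨
      ∃ b > 0, c.dom = Ioo 0 b ∧ closure c.dom = Icc 0 b := by
  cases c with
  | line => simp [dom]
  | halfDirichlet => simp [dom]
  | halfRobin α => simp [dom]
  | intervalDirichlet b hb => exact Or.inr (Or.inr ⟨b, hb, rfl, closure_Ioo hb.ne⟩)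
  | intervalRobin b hb α β => exact Or.inr (Or.inr ⟨b, hb, rfl, closure_Ioo hb.ne⟩)
  | intervalMixed b hb α => exact Or.inr (Or.inr ⟨b, hb, rfl, closure_Ioo hb.ne⟩)

theorem meas_eq_restrict_closure (c : Problem) : c.meas = volume.restrict (closure c.dom) := by
  rw [meas]
  rcases c.closure_dom_cases with ⟨h1, h2⟩ | ⟨h1, h2⟩ | ⟨b, -, h1, h2⟩ <;> rw [h2, h1]
  · exact restrict_Ioi_eq_restrict_Ici
  · exact restrict_Ioo_eq_restrict_Icc

theorem uIcc_subset_closure {x y : ℝ} (hx : x ∈ closure c.dom) (hy : y ∈ closure c.dom) :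
    uIcc x y ⊆ closure c.dom := by
  have : OrdConnected (closure c.dom) := by
    rcases c.closure_dom_cases with ⟨h1, h2⟩ | ⟨h1, h2⟩ | ⟨b, -, h1, h2⟩ <;> rw [h2]
    exacts [ordConnected_univ, ordConnected_Ici, ordConnected_Icc]
  exact this.uIcc_subset hx hy

theorem restrict_uIoc_le_meas {x y : ℝ} (hx : x ∈ closure c.dom) (hy : y ∈ closure c.dom) :
    volume.restrict (uIoc x y) ≤ c.meas := by
  rw [meas_eq_restrict_closure]
  exact Measure.restrict_mono (uIoc_subset_uIcc.trans (uIcc_subset_closure hx hy)) le_rfl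

/-- There is a length `δ` such that at each point of the closed interval, one of the two adjacent
intervals of length at most `δ` lies in the closed interval. -/
theorem exists_adjacent (c : Problem) : ∃ δ > 0, ∀ x ∈ closure c.dom, ∀ η ∈ Icc 0 δ,
    x + η ∈ closure c.dom ∨ x - η ∈ closure c.dom := by
  rcases c.closure_dom_cases with ⟨h1, h2⟩ | ⟨h1, h2⟩ | ⟨b, hb, h1, h2⟩ <;> rw [h2]
  · exact ⟨1, one_pos, by simp⟩
  · refine ⟨1, one_pos, fun x hx η hη => Or.inl ?_⟩
    simp only [mem_Ici, mem_Icc] at *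
    linarith
  · refine ⟨b / 2, by positivity, fun x hx η hη => ?_⟩
    simp only [mem_Icc] at *
    rcases le_total x (b / 2) with h | h
    · left
      constructor <;> linarith
    · right
      constructor <;> linarith

theorem LocallyAC.continuousOn (hf : c.LocallyAC f) : ContinuousOn f (closure c.dom) := by
  intro x hx
  -- A neighborhood of `x` in the closed interval is contained in a compact subinterval.
  suffices h : ∃ y ∈ closure c.dom, ∃ z ∈ closure c.dom, uIcc y z ∈ 𝓝[closure c.dom] x ∧
      x ∈ uIcc y z by
    obtain ⟨y, hy, z, hz, hn, hxyz⟩ := h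
    exact ((hf y hy z hz).continuousOn x hxyz).mono_of_mem_nhdsWithin hn
  rcases c.closure_dom_cases with ⟨h1, h2⟩ | ⟨h1, h2⟩ | ⟨b, hb, h1, h2⟩ <;> rw [h2] at hx ⊢
  · refine ⟨x - 1, trivial, x + 1, trivial, ?_, ?_⟩
    · rw [uIcc_of_le (by linarith)]
      exact mem_nhdsWithin_of_mem_nhds (Icc_mem_nhds (by linarith) (by linarith))
    · rw [uIcc_of_le (by linarith)]
      constructor <;> linarith
  · have hx0 : (0 : ℝ) ≤ x := hx
    refine ⟨0, mem_Ici.2 le_rfl, x + 1, mem_Ici.2 (by linarith), ?_, ?_⟩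
    · rw [uIcc_of_le (by linarith), ← Ici_inter_Iic]
      exact inter_mem_nhdsWithin _ (Iic_mem_nhds (by linarith))
    · rw [uIcc_of_le (by linarith)]
      constructor <;> linarith
  · refine ⟨0, left_mem_Icc.2 hb.le, b, right_mem_Icc.2 hb.le, ?_, ?_⟩
    · rw [uIcc_of_le hb.le]
      exact self_mem_nhdsWithin
    · rwa [uIcc_of_le hb.le]

theorem LocallyAC.sub_eq_integral (hf : c.LocallyAC f) {x y : ℝ} (hx : x ∈ closure c.dom)
    (hy : y ∈ closure c.dom) : f y - f x = ∫ t in x..y, deriv f t :=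
  (hf x hx y hy).integral_deriv_eq_sub.symm

theorem LocallyAC.ae_differentiableAt (hf : c.LocallyAC f) :
    ∀ᵐ x ∂c.meas, DifferentiableAt ℝ f x := by
  have h (p q : ℚ) : ∀ᵐ x : ℝ, (p : ℝ) ∈ closure c.dom → (q : ℝ) ∈ closure c.dom →
      x ∈ uIcc (p : ℝ) q → DifferentiableAt ℝ f x := by
    by_cases hp : (p : ℝ) ∈ closure c.dom
    · by_cases hq : (q : ℝ) ∈ closure c.dom
      · filter_upwards [(hf p hp q hq).ae_differentiableAt] with x hx _ _ using hx
      · simp [hq]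
    · simp [hp]
  have h' := ae_all_iff.2 fun p => ae_all_iff.2 (h p)
  rw [meas, ae_restrict_iff' c.measurableSet_dom]
  filter_upwards [h'] with x hx hxd
  obtain ⟨l, u, ⟨hl, hu⟩, hlu⟩ := (mem_nhds_iff_exists_Ioo_subset.1 (c.isOpen_dom.mem_nhds hxd))
  obtain ⟨p, hp1, hp2⟩ := exists_rat_btwn hl
  obtain ⟨q, hq1, hq2⟩ := exists_rat_btwn hu
  refine hx p q (subset_closure (hlu ⟨hp1, hp2.trans hu⟩)) (subset_closure (hlu ⟨hl.trans hq1, hq2⟩))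
    ?_
  rw [uIcc_of_le (hp2.trans hq1).le]
  exact ⟨hp2.le, hq1.le⟩

theorem LocallyAC.add (hf : c.LocallyAC f) (hg : c.LocallyAC g) : c.LocallyAC (f + g) :=
  fun x hx y hy => (hf x hx y hy).add (hg x hx y hy)

theorem LocallyAC.const_smul (t : ℝ) (hf : c.LocallyAC f) : c.LocallyAC (t • f) :=
  fun x hx y hy => (hf x hx y hy).const_mul t

theorem LocallyAC.mul (hf : c.LocallyAC f) (hg : c.LocallyAC g) : c.LocallyAC (f * g) :=
  fun x hx y hy => (hf x hx y hy).mul (hg x hx y hy)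

theorem LocallyAC.ae_deriv_add (hf : c.LocallyAC f) (hg : c.LocallyAC g) :
    deriv (f + g) =ᵐ[c.meas] deriv f + deriv g := by
  filter_upwards [hf.ae_differentiableAt, hg.ae_differentiableAt] with x h1 h2
  exact deriv_add h1 h2

theorem deriv_const_smul_eq (t : ℝ) (f : ℝ → ℝ) : deriv (t • f) = t • deriv f := by
  ext x
  exact deriv_const_smul_field t f

theorem LocallyAC.ae_deriv_mul (hf : c.LocallyAC f) (hg : c.LocallyAC g) :
    deriv (f * g) =ᵐ[c.meas] fun x => deriv f x * g x + f x * deriv g x := by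
  filter_upwards [hf.ae_differentiableAt, hg.ae_differentiableAt] with x h1 h2
  exact deriv_mul h1 h2

theorem DirichletCondition.add (hf : c.DirichletCondition f) (hg : c.DirichletCondition g) :
    c.DirichletCondition (f + g) := by
  cases c <;> simp_all [DirichletCondition]

theorem DirichletCondition.const_smul (t : ℝ) (hf : c.DirichletCondition f) :
    c.DirichletCondition (t • f) := by
  cases c <;> simp_all [DirichletCondition]

theorem DirichletCondition.mul_left (φ : ℝ → ℝ) (hf : c.DirichletCondition f) :
    c.DirichletCondition (φ * f) := by
  cases c <;> simp_all [DirichletCondition]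

theorem add_mem_formDomain (hf : f ∈ c.formDomain V) (hg : g ∈ c.formDomain V) :
    f + g ∈ c.formDomain V := by
  obtain ⟨a1, a2, a3, a4, a5⟩ := hf
  obtain ⟨b1, b2, b3, b4, b5⟩ := hg
  refine ⟨a1.add b1, a2.add b2, (a3.add b3).ae_eq (a1.ae_deriv_add b1).symm, ?_, a5.add b5⟩
  convert a4.add b4 using 1
  ext x
  simp [mul_add]

theorem smul_mem_formDomain (t : ℝ) (hf : f ∈ c.formDomain V) : t • f ∈ c.formDomain V := by
  obtain ⟨a1, a2, a3, a4, a5⟩ := hf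
  refine ⟨a1.const_smul t, a2.const_smul t, ?_, ?_, a5.const_smul t⟩
  · rw [deriv_const_smul_eq]
    exact a3.const_smul t
  convert a4.const_smul t using 1
  ext x
  simp only [Pi.smul_apply, smul_eq_mul]
  ring

theorem sub_mem_formDomain (hf : f ∈ c.formDomain V) (hg : g ∈ c.formDomain V) :
    f - g ∈ c.formDomain V := by
  have := add_mem_formDomain hf (smul_mem_formDomain (-1) hg)
  rwa [neg_one_smul, ← sub_eq_add_neg] at this

theorem zero_mem_formDomain (c : Problem) (V : ℝ → ℝ) : (0 : ℝ → ℝ) ∈ c.formDomain V := by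
  refine ⟨fun x _ y _ => ?_, MemLp.zero, ?_, ?_, ?_⟩
  · exact (LipschitzWith.const (0 : ℝ)).lipschitzOnWith.absolutelyContinuousOnInterval
  · have : deriv (0 : ℝ → ℝ) = 0 := deriv_zero
    rw [this]
    exact MemLp.zero
  · simp
  · cases c <;> simp [DirichletCondition]

theorem IsPotential.aestronglyMeasurable (hV : c.IsPotential V) :
    AEStronglyMeasurable V c.meas := by
  rw [meas_eq_restrict_closure]
  exact hV.locallyIntegrable.aestronglyMeasurable

theorem ae_mem_dom (c : Problem) : ∀ᵐ x ∂c.meas, x ∈ c.dom := ae_restrict_mem c.measurableSet_dom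

theorem IsPotential.ae_nonneg (hV : c.IsPotential V) : ∀ᵐ x ∂c.meas, 0 ≤ V x := by
  filter_upwards [c.ae_mem_dom] with x hx using hV.nonneg x hx

theorem sqrt_mul_sq_ae (hV : c.IsPotential V) (f : ℝ → ℝ) :
    (fun x => (√(V x) * f x) ^ 2) =ᵐ[c.meas] fun x => V x * f x ^ 2 := by
  filter_upwards [hV.ae_nonneg] with x hx
  rw [mul_pow, Real.sq_sqrt hx]

theorem integrable_potential_mul_sq (hV : c.IsPotential V) (hf : f ∈ c.formDomain V) :
    Integrable (fun x => V x * f x ^ 2) c.meas :=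
  hf.2.2.2.1.integrable_sq.congr (sqrt_mul_sq_ae hV f)

theorem formNormSq_eq (hV : c.IsPotential V) (hf : f ∈ c.formDomain V) :
    c.formNormSq V f = (∫ x, deriv f x ^ 2 ∂c.meas) + (∫ x, V x * f x ^ 2 ∂c.meas)
      + ∫ x, f x ^ 2 ∂c.meas := by
  have h1 := hf.2.2.1.integrable_sq
  have h2 := integrable_potential_mul_sq hV hf
  have h3 := hf.2.1.integrable_sq
  have h12 : Integrable (fun x => deriv f x ^ 2 + V x * f x ^ 2) c.meas := h1.add h2
  rw [formNormSq, ← integral_add h1 h2, ← integral_add h12 h3]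
  congr 1 with x
  ring

theorem integral_potential_mul_sq_nonneg (hV : c.IsPotential V) (f : ℝ → ℝ) :
    0 ≤ ∫ x, V x * f x ^ 2 ∂c.meas := by
  apply integral_nonneg_of_ae
  filter_upwards [hV.ae_nonneg] with x hx
  simp only [Pi.zero_apply]
  positivity

theorem integral_sq_nonneg (c : Problem) (f : ℝ → ℝ) : 0 ≤ ∫ x, f x ^ 2 ∂c.meas :=
  integral_nonneg fun _ => sq_nonneg _

theorem formNormSq_nonneg (hV : c.IsPotential V) (hf : f ∈ c.formDomain V) :
    0 ≤ c.formNormSq V f := by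
  rw [formNormSq_eq hV hf]
  have := integral_potential_mul_sq_nonneg hV f
  have := c.integral_sq_nonneg f
  have := c.integral_sq_nonneg (deriv f)
  positivity

theorem sq_intervalIntegral_le {x y : ℝ} (hx : x ∈ closure c.dom) (hy : y ∈ closure c.dom)
    {g : ℝ → ℝ} (hg : MemLp g 2 c.meas) :
    (∫ t in x..y, g t) ^ 2 ≤ |y - x| * ∫ t, g t ^ 2 ∂c.meas := by
  have hle := restrict_uIoc_le_meas hx hy
  have hg' : MemLp g 2 (volume.restrict (uIoc x y)) := hg.mono_measure hle
  have : IsFiniteMeasure (volume.restrict (uIoc x y)) := ⟨by simp [uIoc]⟩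
  have h1 : MemLp (fun _ : ℝ => (1 : ℝ)) 2 (volume.restrict (uIoc x y)) :=
    memLp_const _
  have key := sq_integral_mul_le h1 hg'
  have e1 : (∫ t in x..y, g t) ^ 2 = (∫ t, 1 * g t ∂(volume.restrict (uIoc x y))) ^ 2 := by
    simp only [one_mul]
    rw [intervalIntegral.intervalIntegral_eq_integral_uIoc, smul_eq_mul, mul_pow]
    split_ifs <;> simp
  have e2 : ∫ t, (1 : ℝ) ^ 2 ∂(volume.restrict (uIoc x y)) = |y - x| := by
    simp [uIoc, Real.volume_real_Ioc, abs_sub_comm, max_sub_min_eq_abs]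
  rw [e1]
  rw [e2] at key
  refine key.trans ?_
  exact mul_le_mul_of_nonneg_left
    (integral_mono_measure hle (ae_of_all _ fun _ => sq_nonneg _) hg.integrable_sq) (abs_nonneg _)

/-- Elements of the form domain are Hölder continuous of order one half. -/
theorem sq_sub_le (hf : f ∈ c.formDomain V) {x y : ℝ} (hx : x ∈ closure c.dom)
    (hy : y ∈ closure c.dom) : (f y - f x) ^ 2 ≤ |y - x| * ∫ t, deriv f t ^ 2 ∂c.meas := by
  rw [hf.1.sub_eq_integral hx hy]
  exact sq_intervalIntegral_le hx hy hf.2.2.1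

/-- The trace inequality: point values are controlled by the derivative with a small constant. -/
theorem exists_trace_bound (c : Problem) : ∃ δ > 0, ∀ η ∈ Ioc 0 δ, ∀ V : ℝ → ℝ,
    ∀ f ∈ c.formDomain V, ∀ x ∈ closure c.dom,
      f x ^ 2 ≤ 2 * η * (∫ t, deriv f t ^ 2 ∂c.meas) + 2 / η * ∫ t, f t ^ 2 ∂c.meas := by
  obtain ⟨δ, hδ, hadj⟩ := c.exists_adjacent
  refine ⟨δ, hδ, fun η hη V f hf x hx => ?_⟩
  have hη0 : 0 < η := hη.1
  set D := ∫ t, deriv f t ^ 2 ∂c.meas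
  -- `y` is the other endpoint of an interval of length `η` over which the values are averaged.
  obtain ⟨y, hy, hxy⟩ : ∃ y ∈ closure c.dom, |y - x| = η := by
    rcases hadj x hx η ⟨hη.1.le, hη.2⟩ with h | h
    · exact ⟨_, h, by simp [abs_of_pos hη0]⟩
    · exact ⟨_, h, by simp [abs_of_pos hη0]⟩
  have hle := restrict_uIoc_le_meas hx hy
  have hpt : ∀ t ∈ uIoc x y, f x ^ 2 ≤ 2 * f t ^ 2 + 2 * η * D := by
    intro t ht
    have htm := uIoc_subset_uIcc ht
    have h1 := sq_sub_le hf hx (uIcc_subset_closure hx hy htm)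
    have h2 : |t - x| ≤ η := hxy ▸ abs_sub_left_of_mem_uIcc htm
    have hD : 0 ≤ D := c.integral_sq_nonneg _
    have h3 : |t - x| * D ≤ η * D := by gcongr
    -- `f x = f t - (f t - f x)`, and `(a - b)² ≤ 2a² + 2b²`.
    nlinarith [sq_nonneg (f t + (f t - f x))]
  have hint : IntegrableOn (fun t => f t ^ 2) (uIoc x y) := hf.2.1.integrable_sq.mono_measure hle
  have hvol : volume.real (uIoc x y) = η := by
    rw [← hxy]
    simp [uIoc, Real.volume_real_Ioc, abs_sub_comm, max_sub_min_eq_abs]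
  have hmono : ∫ _ in uIoc x y, f x ^ 2 ≤ ∫ t in uIoc x y, (2 * f t ^ 2 + 2 * η * D) := by
    refine setIntegral_mono_on ?_ ?_ measurableSet_uIoc hpt
    · exact integrableOn_const (by simp [uIoc])
    · exact (hint.const_mul 2).add (integrableOn_const (by simp [uIoc]))
  rw [integral_add (hint.const_mul 2) (integrableOn_const (by simp [uIoc])), setIntegral_const,
    setIntegral_const, integral_const_mul, hvol, smul_eq_mul, smul_eq_mul] at hmono
  have hle2 : ∫ t in uIoc x y, f t ^ 2 ≤ ∫ t, f t ^ 2 ∂c.meas :=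
    integral_mono_measure hle (ae_of_all _ fun _ => sq_nonneg _) hf.2.1.integrable_sq
  have : η * f x ^ 2 ≤ η * (2 * η * D + 2 / η * ∫ t, f t ^ 2 ∂c.meas) := by
    have : η * (2 * η * D + 2 / η * ∫ t, f t ^ 2 ∂c.meas) =
      η * (2 * η * D) + 2 * ∫ t, f t ^ 2 ∂c.meas := by
      field_simp
    linarith
  exact le_of_mul_le_mul_left this hη0

/-- Point evaluations are bounded in the form norm, with a constant that does not depend on `V`. -/
theorem exists_sq_le_formNormSq (c : Problem) : ∃ K > 0, ∀ V : ℝ → ℝ, c.IsPotential V →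
    ∀ f ∈ c.formDomain V, ∀ x ∈ closure c.dom, f x ^ 2 ≤ K * c.formNormSq V f := by
  obtain ⟨δ, hδ, h⟩ := c.exists_trace_bound
  refine ⟨2 * δ + 2 / δ, by positivity, fun V hV f hf x hx => ?_⟩
  refine (h δ ⟨hδ, le_rfl⟩ V f hf x hx).trans ?_
  rw [formNormSq_eq hV hf]
  have h1 := integral_potential_mul_sq_nonneg hV f
  have h2 := c.integral_sq_nonneg f
  have h3 := c.integral_sq_nonneg (deriv f)
  have h4 : 0 < 2 / δ := by positivity
  nlinarith [mul_nonneg hδ.le h1, mul_nonneg hδ.le h2, mul_nonneg h4.le h1, mul_nonneg h4.le h3]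

/-- Elements of the form domain which agree almost everywhere agree on the closed interval. -/
theorem eqOn_of_ae_eq (hf : c.LocallyAC f) (hg : c.LocallyAC g) (h : f =ᵐ[c.meas] g) :
    EqOn f g (closure c.dom) := by
  have hd : EqOn f g c.dom :=
    Measure.eqOn_of_ae_eq h (hf.continuousOn.mono subset_closure)
      (hg.continuousOn.mono subset_closure) (by rw [c.isOpen_dom.interior_eq]; exact subset_closure)
  exact hd.of_subset_closure hf.continuousOn hg.continuousOn subset_closure subset_rfl

theorem deriv_eqOn_of_eqOn (h : EqOn f g (closure c.dom)) : EqOn (deriv f) (deriv g) c.dom :=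
  fun _ hx => ((h.mono subset_closure).eventuallyEq_of_mem (c.isOpen_dom.mem_nhds hx)).deriv_eq

theorem ae_deriv_eq (hf : c.LocallyAC f) (hg : c.LocallyAC g) (h : f =ᵐ[c.meas] g) :
    deriv f =ᵐ[c.meas] deriv g := by
  filter_upwards [c.ae_mem_dom] with x hx
  exact deriv_eqOn_of_eqOn (eqOn_of_ae_eq hf hg h) hx

theorem lipschitz_locallyAC {K : NNReal} {φ : ℝ → ℝ} (hφ : LipschitzWith K φ) :
    c.LocallyAC φ := fun _ _ _ _ => hφ.lipschitzOnWith.absolutelyContinuousOnInterval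

theorem abs_deriv_le_of_lipschitz {K : NNReal} {φ : ℝ → ℝ} (hφ : LipschitzWith K φ) (x : ℝ) :
    |deriv φ x| ≤ K := by
  simpa using norm_deriv_le_of_lipschitz (x₀ := x) hφ

/-- The form domain is stable under multiplication by bounded Lipschitz functions. -/
theorem mul_mem_formDomain {K : NNReal} {B : ℝ} {φ : ℝ → ℝ} (hφ : LipschitzWith K φ)
    (hB : ∀ x, |φ x| ≤ B) (hf : f ∈ c.formDomain V) : φ * f ∈ c.formDomain V := by
  have hm : AEStronglyMeasurable φ c.meas := hφ.continuous.aestronglyMeasurable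
  have hbdd {u : ℝ → ℝ} (hu : MemLp u 2 c.meas) : MemLp (fun x => φ x * u x) 2 c.meas := by
    refine (hu.const_mul B).mono (hm.mul hu.1) (ae_of_all _ fun x => ?_)
    simp only [norm_mul, Real.norm_eq_abs]
    exact mul_le_mul_of_nonneg_right ((hB x).trans (le_abs_self B)) (abs_nonneg _)
  refine ⟨(lipschitz_locallyAC hφ).mul hf.1, hbdd hf.2.1, ?_, ?_, hf.2.2.2.2.mul_left φ⟩
  · refine MemLp.ae_eq ((lipschitz_locallyAC hφ).ae_deriv_mul hf.1).symm ?_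
    refine MemLp.add ?_ (hbdd hf.2.2.1)
    refine (hf.2.1.const_mul (K : ℝ)).mono
      ((measurable_deriv φ).aestronglyMeasurable.mul hf.2.1.1) (ae_of_all _ fun x => ?_)
    simp only [norm_mul, Real.norm_eq_abs, NNReal.abs_eq]
    gcongr
    exact abs_deriv_le_of_lipschitz hφ x
  · convert hbdd hf.2.2.2.1 using 1
    ext x
    simp only [Pi.mul_apply]
    ring

end Problem

end RandomSchrodinger

/-! ### The form domain as a Hilbert space -/

namespace RandomSchrodinger

namespace Problem

variable {c : Problem} {V f g : ℝ → ℝ}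

theorem L2_norm_sq_eq (u : c.L2) : ‖u‖ ^ 2 = ∫ x, u x ^ 2 ∂c.meas := by
  rw [← real_inner_self_eq_norm_sq, L2.inner_def]
  simp [pow_two]

theorem L2_inner_eq (u v : c.L2) : inner ℝ u v = ∫ x, u x * v x ∂c.meas := by
  rw [L2.inner_def]
  simp [mul_comm]

/-- The form domain as a Hilbert space: the subspace of `L² × L² × L²` of the classes of
`(f, f', V^{1/2} f)` for `f` in the form domain. For a potential `V`, its norm is the form norm
(`norm_sq_eq`) and it is closed (`isClosed_formSpace`). -/
def formSpace (c : Problem) (V : ℝ → ℝ) : Submodule ℝ (PiLp 2 fun _ : Fin 3 => c.L2) where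
  carrier := {p | ∃ f ∈ c.formDomain V, f =ᵐ[c.meas] p 0 ∧ deriv f =ᵐ[c.meas] p 1 ∧
    (fun x => √(V x) * f x) =ᵐ[c.meas] p 2}
  add_mem' := by
    rintro p q ⟨f, hf, f0, f1, f2⟩ ⟨g, hg, g0, g1, g2⟩
    refine ⟨f + g, add_mem_formDomain hf hg, ?_, ?_, ?_⟩
    · exact (f0.add g0).trans (Lp.coeFn_add _ _).symm
    · exact (hf.1.ae_deriv_add hg.1).trans ((f1.add g1).trans (Lp.coeFn_add _ _).symm)
    · refine EventuallyEq.trans ?_ ((f2.add g2).trans (Lp.coeFn_add _ _).symm)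
      exact Eventually.of_forall fun x => by simp [mul_add]
  zero_mem' := by
    have hd : deriv (0 : ℝ → ℝ) = 0 := deriv_zero
    refine ⟨0, zero_mem_formDomain c V, (Lp.coeFn_zero _ _ _).symm, ?_, ?_⟩
    · rw [hd]
      exact (Lp.coeFn_zero _ _ _).symm
    · refine EventuallyEq.trans ?_ (Lp.coeFn_zero _ _ _).symm
      exact Eventually.of_forall fun x => by simp
  smul_mem' := by
    rintro t p ⟨f, hf, f0, f1, f2⟩
    refine ⟨t • f, smul_mem_formDomain t hf, ?_, ?_, ?_⟩
    · exact (f0.const_smul t).trans (Lp.coeFn_smul _ _).symm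
    · rw [deriv_const_smul_eq]
      exact (f1.const_smul t).trans (Lp.coeFn_smul _ _).symm
    · refine EventuallyEq.trans ?_ ((f2.const_smul t).trans (Lp.coeFn_smul _ _).symm)
      exact Eventually.of_forall fun x => by simp [mul_left_comm]

/-- A function in the form domain representing an element of the form space. It is unique on the
closed interval, but arbitrary outside. -/
noncomputable def rep (p : c.formSpace V) : ℝ → ℝ := p.2.choose

theorem rep_mem (p : c.formSpace V) : rep p ∈ c.formDomain V := p.2.choose_spec.1

theorem rep_ae (p : c.formSpace V) : rep p =ᵐ[c.meas] p.1 0 := p.2.choose_spec.2.1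

theorem deriv_rep_ae (p : c.formSpace V) : deriv (rep p) =ᵐ[c.meas] p.1 1 :=
  p.2.choose_spec.2.2.1

theorem sqrt_rep_ae (p : c.formSpace V) : (fun x => √(V x) * rep p x) =ᵐ[c.meas] p.1 2 :=
  p.2.choose_spec.2.2.2

/-- The element of the form space given by a function in the form domain. -/
noncomputable def toFormSpace (f : ℝ → ℝ) (hf : f ∈ c.formDomain V) : c.formSpace V :=
  ⟨WithLp.toLp 2 ![hf.2.1.toLp, hf.2.2.1.toLp, hf.2.2.2.1.toLp],
    ⟨f, hf, hf.2.1.coeFn_toLp.symm, hf.2.2.1.coeFn_toLp.symm, hf.2.2.2.1.coeFn_toLp.symm⟩⟩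

theorem rep_toFormSpace_ae (hf : f ∈ c.formDomain V) : rep (toFormSpace f hf) =ᵐ[c.meas] f :=
  (rep_ae _).trans hf.2.1.coeFn_toLp

theorem rep_add_ae (p q : c.formSpace V) : rep (p + q) =ᵐ[c.meas] rep p + rep q :=
  (rep_ae _).trans ((Lp.coeFn_add _ _).trans ((rep_ae p).add (rep_ae q)).symm)

theorem rep_smul_ae (t : ℝ) (p : c.formSpace V) : rep (t • p) =ᵐ[c.meas] t • rep p :=
  (rep_ae _).trans ((Lp.coeFn_smul _ _).trans ((rep_ae p).const_smul t).symm)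

theorem integral_sq_congr (h : f =ᵐ[c.meas] g) :
    ∫ x, f x ^ 2 ∂c.meas = ∫ x, g x ^ 2 ∂c.meas :=
  integral_congr_ae (by filter_upwards [h] with x hx; rw [hx])

theorem norm_sq_eq (hV : c.IsPotential V) (p : c.formSpace V) :
    ‖p‖ ^ 2 = c.formNormSq V (rep p) := by
  change ‖(p : PiLp 2 fun _ : Fin 3 => c.L2)‖ ^ 2 = _
  rw [PiLp.norm_sq_eq_of_L2, Fin.sum_univ_three, formNormSq_eq hV (rep_mem p)]
  change ‖p.1 0‖ ^ 2 + ‖p.1 1‖ ^ 2 + ‖p.1 2‖ ^ 2 = _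
  rw [L2_norm_sq_eq, L2_norm_sq_eq, L2_norm_sq_eq,
    ← integral_congr_ae (sqrt_mul_sq_ae hV (rep p)),
    integral_sq_congr (rep_ae p), integral_sq_congr (deriv_rep_ae p),
    integral_sq_congr (sqrt_rep_ae p)]
  ring

theorem formNormSq_congr (hf : f ∈ c.formDomain V) (hg : g ∈ c.formDomain V)
    (h : f =ᵐ[c.meas] g) : c.formNormSq V f = c.formNormSq V g := by
  apply integral_congr_ae
  filter_upwards [h, ae_deriv_eq hf.1 hg.1 h] with x h1 h2
  rw [h1, h2]

theorem norm_sub_sq_eq (hV : c.IsPotential V) (p q : c.formSpace V) :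
    ‖p - q‖ ^ 2 = c.formNormSq V (rep p - rep q) := by
  rw [norm_sq_eq hV]
  apply formNormSq_congr (rep_mem _) (sub_mem_formDomain (rep_mem p) (rep_mem q))
  exact (rep_ae _).trans ((Lp.coeFn_sub _ _).trans ((rep_ae p).sub (rep_ae q)).symm)

theorem norm_toFormSpace_sub_sq (hV : c.IsPotential V) (hf : f ∈ c.formDomain V)
    (hg : g ∈ c.formDomain V) :
    ‖toFormSpace f hf - toFormSpace g hg‖ ^ 2 = c.formNormSq V (f - g) := by
  rw [norm_sub_sq_eq hV]
  exact formNormSq_congr (sub_mem_formDomain (rep_mem _) (rep_mem _)) (sub_mem_formDomain hf hg)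
    ((rep_toFormSpace_ae hf).sub (rep_toFormSpace_ae hg))

/-- The embedding of the form space into `L²`. -/
noncomputable def embed (c : Problem) (V : ℝ → ℝ) : c.formSpace V →L[ℝ] c.L2 :=
  (PiLp.proj 2 (fun _ : Fin 3 => c.L2) 0 : _ →L[ℝ] c.L2) ∘L (c.formSpace V).subtypeL

theorem embed_ae (p : c.formSpace V) : embed c V p =ᵐ[c.meas] rep p := (rep_ae p).symm

theorem embed_toFormSpace_ae (hf : f ∈ c.formDomain V) :
    embed c V (toFormSpace f hf) =ᵐ[c.meas] f := hf.2.1.coeFn_toLp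

theorem embed_injective (hV : c.IsPotential V) : Function.Injective (embed c V) := by
  rw [injective_iff_map_eq_zero]
  intro p hp
  have h0 : rep p =ᵐ[c.meas] (0 : ℝ → ℝ) := by
    refine (embed_ae p).symm.trans ?_
    rw [hp]
    exact Lp.coeFn_zero _ _ _
  have h1 := norm_sq_eq hV p
  rw [formNormSq_congr (rep_mem p) (zero_mem_formDomain c V) h0] at h1
  have hd : deriv (0 : ℝ → ℝ) = 0 := deriv_zero
  simpa [formNormSq, hd] using h1

/-- A primitive of a square integrable function is locally absolutely continuous, and has that
function as its derivative. -/
theorem locallyAC_of_sub_eq_integral {F v : ℝ → ℝ} (hv : MemLp v 2 c.meas)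
    (hF : ∀ x ∈ closure c.dom, ∀ y ∈ closure c.dom, F y - F x = ∫ t in x..y, v t) :
    c.LocallyAC F ∧ deriv F =ᵐ[c.meas] v := by
  have hint {x y : ℝ} (hx : x ∈ closure c.dom) (hy : y ∈ closure c.dom) :
      IntervalIntegrable v volume x y := by
    have hle := restrict_uIoc_le_meas hx hy
    have : IsFiniteMeasure (volume.restrict (uIoc x y)) := ⟨by simp [uIoc]⟩
    rw [intervalIntegrable_iff]
    exact ((hv.mono_measure hle).integrable one_le_two)
  have hAC : c.LocallyAC F := by
    intro x hx y hy
    have h1 := (hint hx hy).absolutelyContinuousOnInterval_intervalIntegral (c := x) left_mem_uIcc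
    have h2 : AbsolutelyContinuousOnInterval (fun _ : ℝ => F x) x y :=
      (LipschitzWith.const (F x)).lipschitzOnWith.absolutelyContinuousOnInterval
    refine absolutelyContinuousOnInterval_congr (h1.add h2) fun t ht => ?_
    simp [← hF x hx t (uIcc_subset_closure hx hy ht)]
  refine ⟨hAC, ?_⟩
  have h (p q : ℚ) : ∀ᵐ x : ℝ, (p : ℝ) ∈ closure c.dom → (q : ℝ) ∈ closure c.dom →
      x ∈ Ioo (p : ℝ) q → deriv F x = v x := by
    by_cases hp : (p : ℝ) ∈ closure c.dom
    · by_cases hq : (q : ℝ) ∈ closure c.dom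
      · filter_upwards [(hint hp hq).ae_hasDerivAt_integral] with x hx _ _ hxm
        have hpq : (p : ℝ) ≤ q := (hxm.1.trans hxm.2).le
        have hd := hx (uIcc_of_le hpq ▸ Ioo_subset_Icc_self hxm) p left_mem_uIcc
        have heq : F =ᶠ[𝓝 x] fun y => (∫ t in (p : ℝ)..y, v t) + F p := by
          filter_upwards [isOpen_Ioo.mem_nhds hxm] with y hy
          rw [← hF p hp y (uIcc_subset_closure hp hq (uIcc_of_le hpq ▸ Ioo_subset_Icc_self hy))]
          ring
        rw [heq.deriv_eq]
        exact (hd.add_const _).deriv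
      · simp [hq]
    · simp [hp]
  have h' := ae_all_iff.2 fun p => ae_all_iff.2 (h p)
  rw [meas, EventuallyEq, ae_restrict_iff' c.measurableSet_dom]
  filter_upwards [h'] with x hx hxd
  obtain ⟨l, u, ⟨hl, hu⟩, hlu⟩ := (mem_nhds_iff_exists_Ioo_subset.1 (c.isOpen_dom.mem_nhds hxd))
  obtain ⟨p, hp1, hp2⟩ := exists_rat_btwn hl
  obtain ⟨q, hq1, hq2⟩ := exists_rat_btwn hu
  exact hx p q (subset_closure (hlu ⟨hp1, hp2.trans hu⟩)) (subset_closure (hlu ⟨hl.trans hq1, hq2⟩))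
    ⟨hp2, hq1⟩

theorem DirichletCondition.of_tendsto {F : ℕ → ℝ → ℝ} (hF : ∀ n, c.DirichletCondition (F n))
    (h : ∀ x ∈ closure c.dom, Tendsto (fun n => F n x) atTop (𝓝 (f x))) :
    c.DirichletCondition f := by
  have key {x : ℝ} (hx : x ∈ closure c.dom) (h0 : ∀ n, F n x = 0) : f x = 0 :=
    tendsto_nhds_unique (h x hx) (by simp [h0])
  cases c with
  | line => trivial
  | halfDirichlet => exact key (by simp [dom]) hF
  | halfRobin α => trivial
  | intervalDirichlet b hb =>
    exact ⟨key (by simp [dom, closure_Ioo hb.ne, hb.le]) fun n => (hF n).1,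
      key (by simp [dom, closure_Ioo hb.ne, hb.le]) fun n => (hF n).2⟩
  | intervalRobin b hb α β => trivial
  | intervalMixed b hb α => exact key (by simp [dom, closure_Ioo hb.ne, hb.le]) hF

theorem ae_eq_of_tendsto_of_tendsto_L2 {F : ℕ → ℝ → ℝ} {G : ℝ → ℝ} {U : ℕ → c.L2} {u : c.L2}
    (hFU : ∀ n, F n =ᵐ[c.meas] U n) (hU : Tendsto U atTop (𝓝 u))
    (hF : ∀ x ∈ c.dom, Tendsto (fun n => F n x) atTop (𝓝 (G x))) : G =ᵐ[c.meas] u := by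
  obtain ⟨ns, hns, hlim⟩ := (tendstoInMeasure_of_tendsto_Lp hU).exists_seq_tendsto_ae
  filter_upwards [hlim, ae_all_iff.2 hFU, c.ae_mem_dom] with x h1 h2 h3
  refine tendsto_nhds_unique ((hF x h3).comp hns.tendsto_atTop) (h1.congr fun n => ?_)
  exact (h2 (ns n)).symm

/-- The form norm is complete: a limit of elements of the form space converges pointwise on the closed
interval, to a function which is a primitive of the limit of the derivatives. -/
theorem isClosed_formSpace (hV : c.IsPotential V) :
    IsClosed (c.formSpace V : Set (PiLp 2 fun _ : Fin 3 => c.L2)) := by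
  apply IsSeqClosed.isClosed
  intro P p hP hlim
  let Q : ℕ → c.formSpace V := fun n => ⟨P n, hP n⟩
  obtain ⟨K, hK, hpt⟩ := c.exists_sq_le_formNormSq
  have hsub (n m : ℕ) : rep (Q n) - rep (Q m) ∈ c.formDomain V :=
    sub_mem_formDomain (rep_mem _) (rep_mem _)
  have hcauchy : CauchySeq Q := by
    have := hlim.cauchySeq
    rw [Metric.cauchySeq_iff] at this ⊢
    exact this
  -- Convergence in the form norm implies pointwise convergence on the closed interval.
  have hpoint (x : ℝ) (hx : x ∈ closure c.dom) : CauchySeq fun n => rep (Q n) x := by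
    rw [Metric.cauchySeq_iff] at hcauchy ⊢
    intro ε hε
    obtain ⟨N, hN⟩ := hcauchy (ε / √K) (by positivity)
    refine ⟨N, fun n hn m hm => ?_⟩
    have h1 := hpt V hV _ (hsub n m) x hx
    have h2 := hN n hn m hm
    rw [dist_eq_norm] at h2
    rw [← norm_sub_sq_eq hV] at h1
    have h3 : |rep (Q n) x - rep (Q m) x| ≤ √K * ‖Q n - Q m‖ := by
      apply abs_le_of_sq_le_sq _ (by positivity)
      rw [mul_pow, Real.sq_sqrt hK.le]
      exact h1
    calc dist (rep (Q n) x) (rep (Q m) x) ≤ √K * ‖Q n - Q m‖ := h3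
      _ < √K * (ε / √K) := by gcongr
      _ = ε := by field_simp
  let F : ℝ → ℝ := fun x => limUnder atTop fun n => rep (Q n) x
  have hF (x : ℝ) (hx : x ∈ closure c.dom) : Tendsto (fun n => rep (Q n) x) atTop (𝓝 (F x)) :=
    (hpoint x hx).tendsto_limUnder
  have hcomp (i : Fin 3) : Tendsto (fun n => (P n) i) atTop (𝓝 (p i)) :=
    ((PiLp.proj 2 (𝕜 := ℝ) (fun _ : Fin 3 => c.L2) i).continuous.tendsto p).comp hlim
  have hslope (x : ℝ) (hx : x ∈ closure c.dom) (y : ℝ) (hy : y ∈ closure c.dom) :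
      F y - F x = ∫ t in x..y, p 1 t := by
    refine tendsto_nhds_unique ((hF y hy).sub (hF x hx)) ?_
    rw [tendsto_iff_norm_sub_tendsto_zero]
    have hn0 : Tendsto (fun n => √|y - x| * ‖P n 1 - p 1‖) atTop (𝓝 0) := by
      simpa using (tendsto_iff_norm_sub_tendsto_zero.1 (hcomp 1)).const_mul (√|y - x|)
    refine squeeze_zero (fun _ => norm_nonneg _) (fun n => ?_) hn0
    have hint (u : c.L2) : IntervalIntegrable u volume x y := by
      have hle := restrict_uIoc_le_meas hx hy
      have : IsFiniteMeasure (volume.restrict (uIoc x y)) := ⟨by simp [uIoc]⟩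
      rw [intervalIntegrable_iff]
      exact (((Lp.memLp u).mono_measure hle).integrable one_le_two)
    have hae : ∀ᵐ t, t ∈ uIoc x y → deriv (rep (Q n)) t - p 1 t = (P n 1 - p 1 : c.L2) t := by
      rw [← ae_restrict_iff' measurableSet_uIoc]
      refine ae_mono (restrict_uIoc_le_meas hx hy) ?_
      filter_upwards [deriv_rep_ae (Q n), Lp.coeFn_sub (P n 1) (p 1)] with t h1 h2
      rw [h1, h2]
      rfl
    have hd : IntervalIntegrable (deriv (rep (Q n))) volume x y :=
      ((rep_mem (Q n)).1 x hx y hy).intervalIntegrable_deriv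
    rw [(rep_mem (Q n)).1.sub_eq_integral hx hy, ← intervalIntegral.integral_sub hd (hint _),
      intervalIntegral.integral_congr_ae hae]
    apply abs_le_of_sq_le_sq _ (by positivity)
    rw [mul_pow, Real.sq_sqrt (abs_nonneg _), L2_norm_sq_eq]
    exact sq_intervalIntegral_le hx hy (Lp.memLp _)
  obtain ⟨hAC, hder⟩ := locallyAC_of_sub_eq_integral (Lp.memLp (p 1)) hslope
  have h0 : F =ᵐ[c.meas] p 0 := ae_eq_of_tendsto_of_tendsto_L2 (fun n => rep_ae (Q n)) (hcomp 0)
    fun x hx => hF x (subset_closure hx)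
  have h2 : (fun x => √(V x) * F x) =ᵐ[c.meas] p 2 :=
    ae_eq_of_tendsto_of_tendsto_L2 (fun n => sqrt_rep_ae (Q n)) (hcomp 2)
      fun x hx => (hF x (subset_closure hx)).const_mul _
  exact ⟨F, ⟨hAC, (Lp.memLp (p 0)).ae_eq h0.symm, (Lp.memLp (p 1)).ae_eq hder.symm,
    (Lp.memLp (p 2)).ae_eq h2.symm,
    DirichletCondition.of_tendsto (fun n => (rep_mem (Q n)).2.2.2.2) hF⟩, h0, hder, h2⟩

theorem completeSpace_formSpace (hV : c.IsPotential V) : CompleteSpace (c.formSpace V) :=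
  (isClosed_formSpace hV).completeSpace_coe

/-- Smooth functions with compact support inside the open interval are in the form domain. -/
theorem mem_formDomain_of_contDiff (hV : c.IsPotential V) (hg : ContDiff ℝ (⊤ : ℕ∞) g)
    (hc : HasCompactSupport g) (hs : tsupport g ⊆ c.dom) : g ∈ c.formDomain V := by
  have hg1 : ContDiff ℝ 1 g := hg.of_le (by exact_mod_cast le_top)
  have hmem {u : ℝ → ℝ} (hu : Continuous u) (hcu : HasCompactSupport u) : MemLp u 2 c.meas :=
    (hu.memLp_of_hasCompactSupport hcu (p := 2) (μ := volume)).restrict _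
  have hzero {x : ℝ} (hx : x ∉ c.dom) : g x = 0 := by
    by_contra h
    exact hx (hs (subset_tsupport g h))
  refine ⟨fun x _ y _ => hg1.contDiffOn.absolutelyContinuousOnInterval, hmem hg.continuous hc,
    hmem (hg1.continuous_deriv le_rfl) hc.deriv, ?_, ?_⟩
  · have hm : AEStronglyMeasurable (fun x => √(V x) * g x) c.meas :=
      (Real.continuous_sqrt.comp_aestronglyMeasurable hV.aestronglyMeasurable).mul
        hg.continuous.aestronglyMeasurable
    rw [memLp_two_iff_integrable_sq hm]
    have hint : IntegrableOn V (tsupport g) :=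
      hV.locallyIntegrable.integrableOn_compact_subset (hs.trans subset_closure) hc
    have h1 : IntegrableOn (fun x => V x * g x ^ 2) (tsupport g) :=
      hint.mul_continuousOn (hg.continuous.pow 2).continuousOn hc
    have h2 : Integrable (fun x => V x * g x ^ 2) volume := by
      rw [← integrableOn_iff_integrable_of_support_subset (s := tsupport g)]
      · exact h1
      · intro x hx
        apply subset_tsupport g
        intro h0
        simp [h0] at hx
    exact (h2.restrict (s := c.dom)).congr (sqrt_mul_sq_ae hV g).symm
  · cases c with
    | line => trivial
    | halfDirichlet => exact hzero (by simp [dom])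
    | halfRobin α => trivial
    | intervalDirichlet b hb => exact ⟨hzero (by simp [dom]), hzero (by simp [dom])⟩
    | intervalRobin b hb α β => trivial
    | intervalMixed b hb α => exact hzero (by simp [dom])

theorem denseRange_embed (hV : c.IsPotential V) : DenseRange (embed c V) := by
  have : Dense (LinearMap.range (embed c V : c.formSpace V →ₗ[ℝ] c.L2) : Set c.L2) := by
    rw [Submodule.dense_iff_topologicalClosure_eq_top, Submodule.topologicalClosure_eq_top_iff,
      Submodule.eq_bot_iff]
    intro u hu
    have horth (g : ℝ → ℝ) (hg : ContDiff ℝ (⊤ : ℕ∞) g) (hc : HasCompactSupport g)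
        (hs : tsupport g ⊆ c.dom) : ∫ x, g x • u x ∂c.meas = 0 := by
      have hgm := mem_formDomain_of_contDiff hV hg hc hs
      have h1 : inner ℝ (embed c V (toFormSpace g hgm)) u = 0 := hu _ ⟨toFormSpace g hgm, rfl⟩
      rw [L2_inner_eq] at h1
      rw [← h1]
      apply integral_congr_ae
      filter_upwards [embed_toFormSpace_ae hgm] with x hx
      rw [hx, smul_eq_mul]
    have : IsLocallyFiniteMeasure c.meas := by
      unfold meas
      infer_instance
    have hloc : LocallyIntegrableOn u c.dom c.meas :=
      ((Lp.memLp u).locallyIntegrable one_le_two).locallyIntegrableOn _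
    have h0 := c.isOpen_dom.ae_eq_zero_of_integral_contDiff_smul_eq_zero hloc horth
    apply (Lp.eq_zero_iff_ae_eq_zero).2
    filter_upwards [h0, c.ae_mem_dom] with x h1 h2 using h1 h2
  rwa [LinearMap.coe_range] at this

theorem exists_Ioo_subset_dom (c : Problem) : ∃ b > 0, Ioo 0 b ⊆ c.dom := by
  rcases c.closure_dom_cases with ⟨h1, h2⟩ | ⟨h1, h2⟩ | ⟨b, hb, h1, h2⟩ <;> rw [h1]
  · exact ⟨1, one_pos, subset_univ _⟩
  · exact ⟨1, one_pos, Ioo_subset_Ioi_self⟩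
  · exact ⟨b, hb, subset_rfl⟩

/-- `L²` of the interval is infinite dimensional, as it contains the indicators of infinitely many
disjoint intervals. -/
theorem not_finiteDimensional_L2 (c : Problem) : ¬ FiniteDimensional ℝ c.L2 := by
  intro hfd
  obtain ⟨b, hb, hbd⟩ := c.exists_Ioo_subset_dom
  let s : ℕ → Set ℝ := fun n => Ioo (b / (n + 2)) (b / (n + 1))
  have hlt (n : ℕ) : b / ((n : ℝ) + 2) < b / (n + 1) := by
    apply div_lt_div_of_pos_left hb (by positivity)
    linarith
  have hsub (n : ℕ) : s n ⊆ c.dom := by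
    refine (Ioo_subset_Ioo (by positivity) ?_).trans hbd
    exact div_le_self hb.le (by linarith [Nat.cast_nonneg (α := ℝ) n])
  have hvol (n : ℕ) : c.meas (s n) = volume (s n) :=
    Measure.restrict_eq_self _ (hsub n)
  have hfin (n : ℕ) : c.meas (s n) ≠ ⊤ := by
    rw [hvol]
    simp [s]
  have hpos (n : ℕ) : c.meas.real (s n) ≠ 0 := by
    rw [Measure.real, hvol]
    simp only [s, Real.volume_Ioo]
    rw [ENNReal.toReal_ofReal (by linarith [hlt n])]
    linarith [hlt n]
  have hdisj : Pairwise fun i j => Disjoint (s i) (s j) := by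
    have key (i j : ℕ) (hij : i < j) : Disjoint (s i) (s j) := by
      rw [Set.disjoint_left]
      intro x h1 h2
      have h3 : b / ((j : ℝ) + 1) ≤ b / (i + 2) := by
        apply div_le_div_of_nonneg_left hb.le (by positivity)
        have : (i : ℝ) + 1 ≤ j := by exact_mod_cast hij
        linarith
      exact absurd (h1.1.trans (h2.2.trans_le h3)) (lt_irrefl _)
    intro i j hij
    rcases lt_or_gt_of_ne hij with h | h
    · exact key i j h
    · exact (key j i h).symm
  let v : ℕ → c.L2 := fun n => indicatorConstLp 2 measurableSet_Ioo (hfin n) (1 : ℝ)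
  have hinner (i j : ℕ) : inner ℝ (v i) (v j) = c.meas.real (s i ∩ s j) := by
    rw [L2.inner_indicatorConstLp_indicatorConstLp _ _ (hfin i) (hfin j)]
    simp [s]
  have hli : LinearIndependent ℝ v := by
    apply linearIndependent_of_ne_zero_of_inner_eq_zero
    · intro i h0
      have := hinner i i
      rw [h0, inner_zero_left, inter_self] at this
      exact hpos i this.symm
    · intro i j hij
      change inner ℝ (v i) (v j) = 0
      rw [hinner, (hdisj hij).inter_eq]
      simp
  have : Finite ℕ := hli.finite
  exact _root_.not_finite ℕ

end Problem

end RandomSchrodinger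

/-! ### Compactness of the embedding into `L²` -/

namespace RandomSchrodinger

namespace Problem

variable {c : Problem} {V f g : ℝ → ℝ}

/-- The growth condition with the division by the logarithm cleared. -/
theorem IsPotential.exists_log_le (hV : c.IsPotential V) {A : ℝ} :
    ∃ R ≥ 3, ∀ x ∈ c.dom, R ≤ |x| → A * Real.log |x| ≤ V x := by
  have h := hV.growth.eventually_ge_atTop A
  rw [eventually_inf_principal, hasBasis_cobounded_norm.eventually_iff] at h
  obtain ⟨R, -, hR⟩ := h
  refine ⟨max R 3, le_max_right _ _, fun x hx hxR => ?_⟩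
  have h1 := hR ((le_max_left _ _).trans hxR : R ≤ ‖x‖) hx
  have h3 : (3 : ℝ) ≤ |x| := (le_max_right _ _).trans hxR
  rwa [le_div_iff₀ (Real.log_pos (by linarith))] at h1

theorem IsPotential.exists_le (hV : c.IsPotential V) (M : ℝ) :
    ∃ R > 0, ∀ x ∈ c.dom, R ≤ |x| → M ≤ V x := by
  obtain ⟨R, hR, h⟩ := hV.exists_log_le (A := |M|)
  refine ⟨R, by linarith, fun x hx hxR => ?_⟩
  refine le_trans ?_ (h x hx hxR)
  have h1 : 1 ≤ Real.log |x| := by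
    rw [Real.le_log_iff_exp_le (by linarith)]
    linarith [Real.exp_one_lt_d9]
  nlinarith [le_abs_self M, abs_nonneg M]

/-- The logarithm is bounded relative to the potential, with an arbitrarily small constant. -/
theorem IsPotential.exists_log_add_le (hV : c.IsPotential V) {ε : ℝ} (hε : 0 < ε) :
    ∃ C, ∀ x ∈ c.dom, Real.log (3 + |x|) ≤ ε * V x + C := by
  obtain ⟨R, hR, h⟩ := hV.exists_log_le (A := 2 / ε)
  refine ⟨Real.log (3 + R), fun x hx => ?_⟩
  have hV0 := hV.nonneg x hx
  have hx0 := abs_nonneg x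
  rcases le_total R |x| with hxR | hxR
  · have h1 := h x hx hxR
    have h2 : Real.log (3 + |x|) ≤ 2 * Real.log |x| := by
      rw [← Real.log_rpow (by linarith)]
      apply Real.log_le_log (by positivity)
      rw [Real.rpow_two]
      nlinarith
    have h3 : 0 ≤ Real.log (3 + R) := Real.log_nonneg (by linarith)
    rw [div_mul_eq_mul_div, div_le_iff₀ hε] at h1
    linarith
  · have : Real.log (3 + |x|) ≤ Real.log (3 + R) :=
      Real.log_le_log (by positivity) (by linarith)
    have : 0 ≤ ε * V x := by positivity
    linarith

theorem isCompactOperator_smulRight {E F : Type*} [NormedAddCommGroup E] [NormedSpace ℝ E]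
    [NormedAddCommGroup F] [NormedSpace ℝ F] (l : E →L[ℝ] ℝ) (y : F) :
    IsCompactOperator (l.smulRight y) := by
  have h1 : IsCompactOperator (_root_.id : ℝ → ℝ) :=
    isCompactOperator_id_iff_locallyCompactSpace.2 inferInstance
  have h2 : IsCompactOperator (ContinuousLinearMap.id ℝ ℝ) := h1
  exact (h2.comp_clm l).clm_comp (ContinuousLinearMap.toSpanSingleton ℝ y)

theorem isCompactOperator_sum {ι E F : Type*} [NormedAddCommGroup E] [NormedSpace ℝ E]
    [NormedAddCommGroup F] [NormedSpace ℝ F] (s : Finset ι) (T : ι → E →L[ℝ] F)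
    (hT : ∀ i ∈ s, IsCompactOperator (T i)) : IsCompactOperator (∑ i ∈ s, T i : E →L[ℝ] F) :=
  (compactOperator (RingHom.id ℝ) E F).sum_mem hT

/-- Evaluation at a point of the closed interval, as a continuous functional on the form space. -/
noncomputable def evalAt (hV : c.IsPotential V) {x : ℝ} (hx : x ∈ closure c.dom) :
    c.formSpace V →L[ℝ] ℝ :=
  LinearMap.mkContinuous
    { toFun := fun p => rep p x
      map_add' := fun p q => eqOn_of_ae_eq (rep_mem _).1
        (add_mem_formDomain (rep_mem p) (rep_mem q)).1 (rep_add_ae p q) hx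
      map_smul' := fun t p => eqOn_of_ae_eq (rep_mem _).1
        (smul_mem_formDomain t (rep_mem p)).1 (rep_smul_ae t p) hx }
    (√c.exists_sq_le_formNormSq.choose) fun p => by
      obtain ⟨hK, h⟩ := c.exists_sq_le_formNormSq.choose_spec
      apply abs_le_of_sq_le_sq _ (by positivity)
      rw [mul_pow, Real.sq_sqrt hK.le, norm_sq_eq hV]
      exact h V hV _ (rep_mem p) x hx

theorem evalAt_apply (hV : c.IsPotential V) {x : ℝ} (hx : x ∈ closure c.dom)
    (p : c.formSpace V) : evalAt hV hx p = rep p x := rfl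

/-- The embedding of the form space into `L²` is compact: it is approximated by sampling at finitely
many points of `[-R, R)`, where the error is controlled by the derivative inside `[-R, R)`, and by
the growth of the potential outside. -/
theorem isCompactOperator_embed (hV : c.IsPotential V) : IsCompactOperator (embed c V) := by
  have hcl := isClosed_setOfPred_isCompactOperator (σ₁₂ := RingHom.id ℝ) (M₁ := c.formSpace V)
    (M₂ := c.L2)
  suffices h : embed c V ∈ closure {T : c.formSpace V →L[ℝ] c.L2 | IsCompactOperator T} by
    rw [hcl.closure_eq] at h
    exact h
  refine (Metric.mem_closure_iff (α := c.formSpace V →L[ℝ] c.L2)).2 fun ε hε => ?_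
  obtain ⟨R, hR, hVR⟩ := hV.exists_le (8 / ε ^ 2)
  obtain ⟨n, hn⟩ := exists_nat_gt (32 * R ^ 2 / ε ^ 2)
  have hn0 : (0 : ℝ) < n := lt_trans (by positivity) hn
  set h := 2 * R / n with hh
  have hhpos : 0 < h := by positivity
  let j : ℝ → ℕ := fun x => ⌊(x + R) / h⌋₊
  have hj : Measurable j := Nat.measurable_floor.comp (by fun_prop)
  -- The cells into which `[-R, R)` is divided, and a sampling point for each cell.
  let E : ℕ → Set ℝ := fun i => c.dom ∩ (Ico (-R) R ∩ j ⁻¹' {i})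
  have hE (i : ℕ) : MeasurableSet (E i) :=
    c.measurableSet_dom.inter (measurableSet_Ico.inter (hj (measurableSet_singleton i)))
  have hfin (i : ℕ) : c.meas (E i) ≠ ⊤ := by
    refine ne_top_of_le_ne_top ?_ ((Measure.restrict_le_self (s := c.dom)) (E i))
    refine ne_top_of_le_ne_top ?_ (measure_mono (inter_subset_right.trans inter_subset_left))
    simp
  obtain ⟨x₀, hx₀⟩ : (closure c.dom).Nonempty := by
    obtain ⟨b, hb, hbd⟩ := c.exists_Ioo_subset_dom
    exact ⟨b / 2, subset_closure (hbd ⟨by linarith, by linarith⟩)⟩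
  have hsample (i : ℕ) : ∃ y ∈ closure c.dom, ∀ x ∈ E i, |x - y| ≤ h := by
    by_cases hne : (E i).Nonempty
    · obtain ⟨y, hy⟩ := hne
      refine ⟨y, subset_closure hy.1, fun x hx => ?_⟩
      have bounds (z : ℝ) (hz : z ∈ E i) : (i : ℝ) * h ≤ z + R ∧ z + R < (i + 1) * h := by
        have hz3 : ⌊(z + R) / h⌋₊ = i := hz.2.2
        have hz4 : 0 ≤ (z + R) / h := div_nonneg (by linarith [hz.2.1.1]) hhpos.le
        have h1 := Nat.floor_le hz4
        have h2 := Nat.lt_floor_add_one ((z + R) / h)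
        rw [hz3, le_div_iff₀ hhpos] at h1
        rw [hz3, div_lt_iff₀ hhpos] at h2
        exact ⟨h1, h2⟩
      obtain ⟨a1, a2⟩ := bounds x hx
      obtain ⟨b1, b2⟩ := bounds y hy
      rw [abs_le]
      constructor <;> nlinarith
    · exact ⟨x₀, hx₀, fun x hx => absurd ⟨x, hx⟩ hne⟩
  choose y hy hyE using hsample
  let T : c.formSpace V →L[ℝ] c.L2 := ∑ i ∈ Finset.range n,
    (evalAt hV (hy i)).smulRight (indicatorConstLp 2 (hE i) (hfin i) (1 : ℝ))
  have hT : IsCompactOperator T :=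
    isCompactOperator_sum _ _ fun i _ => isCompactOperator_smulRight _ _
  refine ⟨T, hT, ?_⟩
  refine (dist_eq_norm (embed c V) T).trans_lt ?_
  refine lt_of_le_of_lt (ContinuousLinearMap.opNorm_le_bound _ (by positivity : 0 ≤ ε / 2)
    fun p => ?_) (by linarith)
  apply abs_le_of_sq_le_sq' _ (by positivity) |>.2
  set D := ∫ t, deriv (rep p) t ^ 2 ∂c.meas
  have hD : 0 ≤ D := c.integral_sq_nonneg _
  have hTp : ∀ᵐ x ∂c.meas, (T p) x = ∑ i ∈ Finset.range n, rep p (y i) * (E i).indicator 1 x := by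
    have hgen (s : Finset ℕ) : ∀ᵐ x ∂c.meas, (∑ i ∈ s, rep p (y i) •
        indicatorConstLp 2 (hE i) (hfin i) (1 : ℝ) : c.L2) x =
          ∑ i ∈ s, rep p (y i) * (E i).indicator 1 x := by
      induction s using Finset.induction_on with
      | empty =>
        simp only [Finset.sum_empty]
        exact Lp.coeFn_zero _ _ _
      | insert i s his ih =>
        simp only [Finset.sum_insert his]
        filter_upwards [ih, Lp.coeFn_add (rep p (y i) •
          indicatorConstLp 2 (hE i) (hfin i) (1 : ℝ)) (∑ i ∈ s, rep p (y i) •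
          indicatorConstLp 2 (hE i) (hfin i) (1 : ℝ)),
          Lp.coeFn_smul (rep p (y i)) (indicatorConstLp 2 (hE i) (hfin i) (1 : ℝ)),
          indicatorConstLp_coeFn (p := 2) (hs := hE i) (hμs := hfin i) (c := (1 : ℝ))]
          with x h1 h2 h3 h4
        rw [h2, Pi.add_apply, h1, h3, Pi.smul_apply, h4]
        rfl
    have hTeq : T p = ∑ i ∈ Finset.range n, rep p (y i) •
        indicatorConstLp 2 (hE i) (hfin i) (1 : ℝ) := by
      simp [T, sum_apply, evalAt_apply]
    rw [hTeq]
    exact hgen _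
  have hbound : ∀ᵐ x ∂c.meas, ((embed c V - T) p : c.L2) x ^ 2 ≤
      (Ico (-R) R).indicator (fun _ => h * D) x + ε ^ 2 / 8 * (V x * rep p x ^ 2) := by
    filter_upwards [hTp, embed_ae p, Lp.coeFn_sub (embed c V p) (T p), c.ae_mem_dom]
      with x h1 h2 h3 hx
    have hVx := hV.nonneg x hx
    rw [sub_apply, h3, Pi.sub_apply, h1, h2]
    by_cases hxR : x ∈ Ico (-R) R
    · have hjn : j x ∈ Finset.range n := by
        rw [Finset.mem_range]
        apply Nat.floor_lt' (by exact_mod_cast hn0.ne') |>.2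
        rw [div_lt_iff₀ hhpos, hh]
        field_simp
        linarith [hxR.2]
      have hxE : x ∈ E (j x) := ⟨hx, hxR, rfl⟩
      rw [Finset.sum_eq_single_of_mem _ hjn, indicator_of_mem hxE, indicator_of_mem hxR]
      · have h4 := sq_sub_le (rep_mem p) (hy (j x)) (subset_closure hx)
        have h5 : |x - y (j x)| * D ≤ h * D := by
          gcongr
          exact hyE _ x hxE
        have h6 : 0 ≤ ε ^ 2 / 8 * (V x * rep p x ^ 2) := by positivity
        simp only [Pi.one_apply, mul_one]
        linarith
      · intro i _ hij
        rw [indicator_of_notMem, mul_zero]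
        exact fun hxi => hij hxi.2.2.symm
    · rw [Finset.sum_eq_zero, indicator_of_notMem hxR]
      · have hxR' : R ≤ |x| := by
          by_contra! hlt
          exact hxR ⟨(abs_lt.1 hlt).1.le, (abs_lt.1 hlt).2⟩
        have h7 := hVR x hx hxR'
        rw [div_le_iff₀ (by positivity)] at h7
        nlinarith [sq_nonneg (rep p x)]
      · intro i _
        rw [indicator_of_notMem, mul_zero]
        exact fun hxi => hxR hxi.2.1
  have hmeasI : c.meas.real (Ico (-R) R) ≤ 2 * R := by
    rw [Measure.real]
    refine ENNReal.toReal_le_of_le_ofReal (by positivity) ?_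
    refine ((Measure.restrict_le_self (s := c.dom)) _).trans ?_
    rw [Real.volume_Ico]
    apply ENNReal.ofReal_le_ofReal
    linarith
  have hfinI : c.meas (Ico (-R) R) ≠ ⊤ := by
    refine ne_top_of_le_ne_top ?_ ((Measure.restrict_le_self (s := c.dom)) _)
    simp
  have hi1 : Integrable ((Ico (-R) R).indicator fun _ => h * D) c.meas :=
    (integrable_indicator_iff measurableSet_Ico).2 (integrableOn_const hfinI)
  have hi2 := (integrable_potential_mul_sq hV (rep_mem p)).const_mul (ε ^ 2 / 8)
  have hint := integral_mono_ae (Lp.memLp ((embed c V - T) p)).integrable_sq (hi1.add hi2) hbound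
  rw [← L2_norm_sq_eq] at hint
  refine hint.trans ?_
  simp only [Pi.add_apply]
  rw [integral_add hi1 hi2, integral_indicator measurableSet_Ico, setIntegral_const,
    integral_const_mul, smul_eq_mul, mul_pow, norm_sq_eq hV, formNormSq_eq hV (rep_mem p)]
  have hP := integral_potential_mul_sq_nonneg hV (rep p)
  have hN := c.integral_sq_nonneg (rep p)
  have h8 : c.meas.real (Ico (-R) R) * (h * D) ≤ 2 * R * (h * D) := by gcongr
  have h9 : 2 * R * h ≤ ε ^ 2 / 8 := by
    rw [hh, mul_div_assoc', div_le_div_iff₀ hn0 (by norm_num)]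
    rw [div_lt_iff₀ (by positivity)] at hn
    nlinarith
  have h10 : 2 * R * (h * D) ≤ ε ^ 2 / 8 * D := by
    rw [← mul_assoc]
    gcongr
  have h11 : 0 ≤ ε ^ 2 * D := by positivity
  have h12 : 0 ≤ ε ^ 2 * ∫ x, V x * rep p x ^ 2 ∂c.meas := by positivity
  have h13 : 0 ≤ ε ^ 2 * ∫ x, rep p x ^ 2 ∂c.meas := by positivity
  change _ ≤ (ε / 2) ^ 2 * (D + _ + _)
  nlinarith

end Problem

end RandomSchrodinger

/-! ### Lower order forms -/

/-- A symmetric bilinear form on an inner product space is bounded if its quadratic form is. -/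
theorem abs_bilin_le_of_abs_diag_le {W : Type*} [NormedAddCommGroup W] [InnerProductSpace ℝ W]
    (B : W →ₗ[ℝ] W →ₗ[ℝ] ℝ) (hsymm : ∀ u v, B u v = B v u) {K : ℝ}
    (hK : ∀ u, |B u u| ≤ K * ‖u‖ ^ 2) (u v : W) : |B u v| ≤ K * ‖u‖ * ‖v‖ := by
  have hunit (u v : W) (hu : ‖u‖ = 1) (hv : ‖v‖ = 1) : |B u v| ≤ K := by
    have h1 := hK (u + v)
    have h2 := hK (u - v)
    have hpar := parallelogram_law_with_norm ℝ u v
    have hpol : B (u + v) (u + v) - B (u - v) (u - v) = 4 * B u v := by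
      simp only [map_add, map_sub, LinearMap.add_apply, LinearMap.sub_apply, hsymm v u]
      ring
    rw [hu, hv] at hpar
    rw [abs_le] at h1 h2 ⊢
    constructor <;> nlinarith
  by_cases hu : u = 0
  · simp [hu]
  by_cases hv : v = 0
  · simp [hv]
  have hu' : 0 < ‖u‖ := norm_pos_iff.2 hu
  have hv' : 0 < ‖v‖ := norm_pos_iff.2 hv
  have h := hunit (‖u‖⁻¹ • u) (‖v‖⁻¹ • v) (norm_smul_inv_norm (𝕜 := ℝ) hu)
    (norm_smul_inv_norm (𝕜 := ℝ) hv)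
  have hB : B (‖u‖⁻¹ • u) (‖v‖⁻¹ • v) = ‖u‖⁻¹ * ‖v‖⁻¹ * B u v := by
    simp only [map_smul, LinearMap.smul_apply, smul_eq_mul]
    ring
  rw [hB, abs_mul, abs_of_pos (by positivity)] at h
  calc |B u v| = ‖u‖ * ‖v‖ * (‖u‖⁻¹ * ‖v‖⁻¹ * |B u v|) := by field_simp
    _ ≤ ‖u‖ * ‖v‖ * K := by gcongr
    _ = K * ‖u‖ * ‖v‖ := by ring

namespace RandomSchrodinger

namespace Problem

variable {c : Problem} {V f g : ℝ → ℝ}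

/-- `B` is a symmetric bilinear form on the form domain, bounded in the form norm and independent of
the choice of representatives. -/
structure IsFormBilin (c : Problem) (V : ℝ → ℝ) (B : (ℝ → ℝ) → (ℝ → ℝ) → ℝ) : Prop where
  symm : ∀ f ∈ c.formDomain V, ∀ g ∈ c.formDomain V, B f g = B g f
  add : ∀ f ∈ c.formDomain V, ∀ g ∈ c.formDomain V, ∀ h ∈ c.formDomain V,
    B (f + g) h = B f h + B g h
  smul : ∀ (t : ℝ), ∀ f ∈ c.formDomain V, ∀ g ∈ c.formDomain V, B (t • f) g = t * B f g
  congr : ∀ f ∈ c.formDomain V, ∀ f' ∈ c.formDomain V, ∀ g ∈ c.formDomain V,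
    f =ᵐ[c.meas] f' → B f g = B f' g
  bound : ∃ K, ∀ f ∈ c.formDomain V, |B f f| ≤ K * c.formNormSq V f

/-- Such a form is a bounded bilinear form on the Hilbert space of the form domain. -/
theorem IsFormBilin.exists_lift (hV : c.IsPotential V) {B : (ℝ → ℝ) → (ℝ → ℝ) → ℝ}
    (hB : IsFormBilin c V B) : ∃ b : c.formSpace V →L[ℝ] c.formSpace V →L[ℝ] ℝ,
      ∀ (f g : ℝ → ℝ) (hf : f ∈ c.formDomain V) (hg : g ∈ c.formDomain V),
        b (toFormSpace f hf) (toFormSpace g hg) = B f g := by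
  have hadd (p q : c.formSpace V) (g : ℝ → ℝ) (hg : g ∈ c.formDomain V) :
      B (rep (p + q)) g = B (rep p) g + B (rep q) g := by
    rw [hB.congr _ (rep_mem _) _ (add_mem_formDomain (rep_mem p) (rep_mem q)) g hg (rep_add_ae p q),
      hB.add _ (rep_mem p) _ (rep_mem q) g hg]
  have hsmul (t : ℝ) (p : c.formSpace V) (g : ℝ → ℝ) (hg : g ∈ c.formDomain V) :
      B (rep (t • p)) g = t * B (rep p) g := by
    rw [hB.congr _ (rep_mem _) _ (smul_mem_formDomain t (rep_mem p)) g hg (rep_smul_ae t p),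
      hB.smul t _ (rep_mem p) g hg]
  let b₀ : c.formSpace V →ₗ[ℝ] c.formSpace V →ₗ[ℝ] ℝ :=
    LinearMap.mk₂ ℝ (fun p q => B (rep p) (rep q))
      (fun p q u => hadd p q _ (rep_mem u)) (fun t p u => hsmul t p _ (rep_mem u))
      (fun u p q => by
        rw [hB.symm _ (rep_mem _) _ (rep_mem _), hadd p q _ (rep_mem u),
          hB.symm _ (rep_mem p) _ (rep_mem u), hB.symm _ (rep_mem q) _ (rep_mem u)])
      (fun t u p => by
        rw [hB.symm _ (rep_mem _) _ (rep_mem _), hsmul t p _ (rep_mem u),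
          hB.symm _ (rep_mem p) _ (rep_mem u)]
        rfl)
  obtain ⟨K, hK⟩ := hB.bound
  have hbound := abs_bilin_le_of_abs_diag_le b₀
    (fun u v => hB.symm _ (rep_mem u) _ (rep_mem v)) (K := K) fun u => by
      rw [norm_sq_eq hV]
      exact hK _ (rep_mem u)
  refine ⟨b₀.mkContinuous₂ K hbound, fun f g hf hg => ?_⟩
  rw [LinearMap.mkContinuous₂_apply]
  change B (rep _) (rep _) = B f g
  rw [hB.congr _ (rep_mem _) f hf _ (rep_mem _) (rep_toFormSpace_ae hf),
    hB.symm f hf _ (rep_mem _),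
    hB.congr _ (rep_mem _) g hg f hf (rep_toFormSpace_ae hg), hB.symm g hg f hf]

theorem IsFormBilin.add_form {B B' : (ℝ → ℝ) → (ℝ → ℝ) → ℝ} (hB : IsFormBilin c V B)
    (hB' : IsFormBilin c V B') : IsFormBilin c V fun f g => B f g + B' f g where
  symm f hf g hg := by rw [hB.symm f hf g hg, hB'.symm f hf g hg]
  add f hf g hg h hh := by
    rw [hB.add f hf g hg h hh, hB'.add f hf g hg h hh]
    ring
  smul t f hf g hg := by
    rw [hB.smul t f hf g hg, hB'.smul t f hf g hg]
    ring
  congr f hf f' hf' g hg h := by rw [hB.congr f hf f' hf' g hg h, hB'.congr f hf f' hf' g hg h]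
  bound := by
    obtain ⟨K, hK⟩ := hB.bound
    obtain ⟨K', hK'⟩ := hB'.bound
    refine ⟨K + K', fun f hf => (abs_add_le _ _).trans ?_⟩
    rw [add_mul]
    exact add_le_add (hK f hf) (hK' f hf)

/-- The principal part `½⟨f', g'⟩ + ⟨fg, V⟩` of the form. -/
noncomputable def principalForm (c : Problem) (V f g : ℝ → ℝ) : ℝ :=
  1 / 2 * (∫ x, deriv f x * deriv g x ∂c.meas) + ∫ x, f x * g x * V x ∂c.meas

theorem integrable_mul_mul_potential (hV : c.IsPotential V) (hf : f ∈ c.formDomain V)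
    (hg : g ∈ c.formDomain V) : Integrable (fun x => f x * g x * V x) c.meas := by
  refine (hf.2.2.2.1.integrable_mul hg.2.2.2.1).congr ?_
  filter_upwards [hV.ae_nonneg] with x hx
  simp only [Pi.mul_apply]
  rw [mul_mul_mul_comm, Real.mul_self_sqrt hx]
  ring

theorem isFormBilin_principalForm (hV : c.IsPotential V) :
    IsFormBilin c V (c.principalForm V) where
  symm f _ g _ := by
    simp only [principalForm]
    congr 2 <;> congr 1 with x <;> ring
  add f hf g hg h hh := by
    have h1 : ∫ x, deriv (f + g) x * deriv h x ∂c.meas =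
        (∫ x, deriv f x * deriv h x ∂c.meas) + ∫ x, deriv g x * deriv h x ∂c.meas := by
      have i1 : Integrable (fun x => deriv f x * deriv h x) c.meas :=
        hf.2.2.1.integrable_mul hh.2.2.1
      have i2 : Integrable (fun x => deriv g x * deriv h x) c.meas :=
        hg.2.2.1.integrable_mul hh.2.2.1
      rw [← integral_add i1 i2]
      apply integral_congr_ae
      filter_upwards [hf.1.ae_deriv_add hg.1] with x hx
      rw [hx, Pi.add_apply]
      ring
    have h2 : ∫ x, (f + g) x * h x * V x ∂c.meas =
        (∫ x, f x * h x * V x ∂c.meas) + ∫ x, g x * h x * V x ∂c.meas := by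
      rw [← integral_add (integrable_mul_mul_potential hV hf hh)
        (integrable_mul_mul_potential hV hg hh)]
      congr 1 with x
      rw [Pi.add_apply]
      ring
    rw [principalForm, h1, h2, principalForm, principalForm]
    ring
  smul t f hf g hg := by
    have h1 : ∫ x, deriv (t • f) x * deriv g x ∂c.meas = t * ∫ x, deriv f x * deriv g x ∂c.meas := by
      rw [← integral_const_mul, deriv_const_smul_eq]
      congr 1 with x
      rw [Pi.smul_apply, smul_eq_mul]
      ring
    have h2 : ∫ x, (t • f) x * g x * V x ∂c.meas = t * ∫ x, f x * g x * V x ∂c.meas := by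
      rw [← integral_const_mul]
      congr 1 with x
      rw [Pi.smul_apply, smul_eq_mul]
      ring
    rw [principalForm, h1, h2, principalForm]
    ring
  congr f hf f' hf' g _ h := by
    have h1 : ∫ x, deriv f x * deriv g x ∂c.meas = ∫ x, deriv f' x * deriv g x ∂c.meas := by
      apply integral_congr_ae
      filter_upwards [ae_deriv_eq hf.1 hf'.1 h] with x hx
      rw [hx]
    have h2 : ∫ x, f x * g x * V x ∂c.meas = ∫ x, f' x * g x * V x ∂c.meas := by
      apply integral_congr_ae
      filter_upwards [h] with x hx
      rw [hx]
    rw [principalForm, h1, h2, principalForm]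
  bound := by
    refine ⟨1, fun f hf => ?_⟩
    have h1 := c.integral_sq_nonneg f
    have h2 := c.integral_sq_nonneg (deriv f)
    have h3 := integral_potential_mul_sq_nonneg hV f
    have e1 : ∫ x, deriv f x * deriv f x ∂c.meas = ∫ x, deriv f x ^ 2 ∂c.meas := by
      congr 1 with x
      ring
    have e2 : ∫ x, f x * f x * V x ∂c.meas = ∫ x, V x * f x ^ 2 ∂c.meas := by
      congr 1 with x
      ring
    rw [principalForm, e1, e2, formNormSq_eq hV hf, abs_of_nonneg (by positivity)]
    linarith

/-- The data of a lower order form in `f` and `g`: the coefficients of `(fg)'` and of `fg`, and two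
points with the weights of the evaluations of `fg` there. -/
structure LowerOrder where
  /-- The coefficient of `(fg)'`. -/
  r : ℝ → ℝ
  /-- The coefficient of `fg`. -/
  s : ℝ → ℝ
  /-- The first evaluation point. -/
  pt₀ : ℝ
  /-- The second evaluation point. -/
  pt₁ : ℝ
  /-- The weight at the first point. -/
  wt₀ : ℝ
  /-- The weight at the second point. -/
  wt₁ : ℝ

/-- The form `-⟨f'g + fg', r⟩ + ⟨fg, s⟩` with two weighted point evaluations of `fg`. -/
noncomputable def lowerForm (c : Problem) (q : LowerOrder) (f g : ℝ → ℝ) : ℝ :=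
  -(∫ x, (deriv f x * g x + f x * deriv g x) * q.r x ∂c.meas) + (∫ x, f x * g x * q.s x ∂c.meas)
    + (q.wt₀ * (f q.pt₀ * g q.pt₀) + q.wt₁ * (f q.pt₁ * g q.pt₁))

/-- The coefficients are continuous, the points lie in the closed interval, and `r²` and `s` are
bounded relative to the potential with arbitrarily small constants. -/
structure LowerOrder.IsSmall (q : LowerOrder) (c : Problem) (V : ℝ → ℝ) : Prop where
  continuous_r : Continuous q.r
  continuous_s : Continuous q.s
  mem₀ : q.pt₀ ∈ closure c.dom
  mem₁ : q.pt₁ ∈ closure c.dom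
  r_le : ∀ ε > 0, ∃ C, ∀ x ∈ c.dom, q.r x ^ 2 ≤ ε * V x + C
  s_le : ∀ ε > 0, ∃ C, ∀ x ∈ c.dom, |q.s x| ≤ ε * V x + C

variable {q : LowerOrder}

theorem LowerOrder.IsSmall.integral_r_mul_sq_le (hV : c.IsPotential V) (hq : q.IsSmall c V)
    {ε : ℝ} (hε : 0 < ε) : ∃ C, ∀ f ∈ c.formDomain V, MemLp (fun x => q.r x * f x) 2 c.meas ∧
      ∫ x, (q.r x * f x) ^ 2 ∂c.meas ≤
        ε * (∫ x, V x * f x ^ 2 ∂c.meas) + C * ∫ x, f x ^ 2 ∂c.meas := by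
  obtain ⟨C, hC⟩ := hq.r_le ε hε
  refine ⟨C, fun f hf => ?_⟩
  have hm : AEStronglyMeasurable (fun x => q.r x * f x) c.meas :=
    hq.continuous_r.aestronglyMeasurable.mul hf.2.1.1
  have hi1 := (integrable_potential_mul_sq hV hf).const_mul ε
  have hi2 := hf.2.1.integrable_sq.const_mul C
  have hle : ∀ᵐ x ∂c.meas, (q.r x * f x) ^ 2 ≤ ε * (V x * f x ^ 2) + C * f x ^ 2 := by
    filter_upwards [c.ae_mem_dom] with x hx
    nlinarith [hC x hx, sq_nonneg (f x)]
  have hint : Integrable (fun x => (q.r x * f x) ^ 2) c.meas := by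
    refine (hi1.add hi2).mono' (hm.pow 2) ?_
    filter_upwards [hle] with x hx
    rw [Real.norm_of_nonneg (sq_nonneg _)]
    exact hx
  refine ⟨(memLp_two_iff_integrable_sq hm).2 hint, ?_⟩
  rw [← integral_const_mul, ← integral_const_mul, ← integral_add hi1 hi2]
  exact integral_mono_ae hint (hi1.add hi2) hle

theorem LowerOrder.IsSmall.memLp_r_mul (hV : c.IsPotential V) (hq : q.IsSmall c V)
    (hf : f ∈ c.formDomain V) : MemLp (fun x => q.r x * f x) 2 c.meas := by
  obtain ⟨C, hC⟩ := hq.integral_r_mul_sq_le hV one_pos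
  exact (hC f hf).1

theorem LowerOrder.IsSmall.integrable_r (hV : c.IsPotential V) (hq : q.IsSmall c V)
    (hf : f ∈ c.formDomain V) (hg : g ∈ c.formDomain V) :
    Integrable (fun x => (deriv f x * g x + f x * deriv g x) * q.r x) c.meas := by
  have h1 : Integrable (fun x => deriv f x * (q.r x * g x)) c.meas :=
    hf.2.2.1.integrable_mul (hq.memLp_r_mul hV hg)
  have h2 : Integrable (fun x => deriv g x * (q.r x * f x)) c.meas :=
    hg.2.2.1.integrable_mul (hq.memLp_r_mul hV hf)
  refine (h1.add h2).congr (Eventually.of_forall fun x => ?_)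
  simp only [Pi.add_apply]
  ring

theorem LowerOrder.IsSmall.integrable_s (hV : c.IsPotential V) (hq : q.IsSmall c V)
    (hf : f ∈ c.formDomain V) (hg : g ∈ c.formDomain V) :
    Integrable (fun x => f x * g x * q.s x) c.meas := by
  obtain ⟨C, hC⟩ := hq.s_le 1 one_pos
  have h1 : Integrable (fun x => f x * g x) c.meas := hf.2.1.integrable_mul hg.2.1
  refine ((integrable_mul_mul_potential hV hf hg).abs.add (h1.abs.const_mul C)).mono'
    (h1.1.mul hq.continuous_s.aestronglyMeasurable) ?_
  filter_upwards [c.ae_mem_dom] with x hx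
  have h2 := hC x hx
  simp only [norm_mul, Real.norm_eq_abs, Pi.add_apply, abs_mul, abs_of_nonneg (hV.nonneg x hx)]
  have : 0 ≤ |f x| * |g x| := by positivity
  nlinarith

/-- The lower order form has relative form bound zero. -/
theorem LowerOrder.IsSmall.abs_lowerForm_le (hV : c.IsPotential V) (hq : q.IsSmall c V)
    {ε : ℝ} (hε : 0 < ε) : ∃ C, ∀ f ∈ c.formDomain V, |c.lowerForm q f f| ≤
      ε * ((∫ x, deriv f x ^ 2 ∂c.meas) + ∫ x, V x * f x ^ 2 ∂c.meas)
        + C * ∫ x, f x ^ 2 ∂c.meas := by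
  obtain ⟨C₁, hC₁⟩ := hq.integral_r_mul_sq_le hV (ε := ε ^ 2 / 8) (by positivity)
  obtain ⟨C₂, hC₂⟩ := hq.s_le (ε / 2) (by positivity)
  obtain ⟨δ, hδ, htrace⟩ := c.exists_trace_bound
  have hpoint (w x : ℝ) (hx : x ∈ closure c.dom) : ∃ C, ∀ f ∈ c.formDomain V,
      |w * (f x * f x)| ≤ ε / 4 * (∫ x, deriv f x ^ 2 ∂c.meas) + C * ∫ x, f x ^ 2 ∂c.meas := by
    set η := min δ (ε / (8 * (|w| + 1))) with hη
    have hη0 : 0 < η := lt_min hδ (by positivity)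
    refine ⟨|w| * (2 / η), fun f hf => ?_⟩
    have h1 := htrace η ⟨hη0, min_le_left _ _⟩ V f hf x hx
    have hD := c.integral_sq_nonneg (deriv f)
    have h2 : |w| * (2 * η) ≤ ε / 4 := by
      have h3 : η ≤ ε / (8 * (|w| + 1)) := min_le_right _ _
      rw [le_div_iff₀ (by positivity)] at h3
      nlinarith [abs_nonneg w]
    rw [abs_mul, ← pow_two, abs_of_nonneg (sq_nonneg (f x))]
    calc |w| * f x ^ 2 ≤ |w| * (2 * η * (∫ t, deriv f t ^ 2 ∂c.meas)
          + 2 / η * ∫ t, f t ^ 2 ∂c.meas) := by gcongr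
      _ = |w| * (2 * η) * (∫ t, deriv f t ^ 2 ∂c.meas)
          + |w| * (2 / η) * ∫ t, f t ^ 2 ∂c.meas := by ring
      _ ≤ _ := by gcongr
  obtain ⟨C₃, hC₃⟩ := hpoint q.wt₀ q.pt₀ hq.mem₀
  obtain ⟨C₄, hC₄⟩ := hpoint q.wt₁ q.pt₁ hq.mem₁
  refine ⟨4 / ε * C₁ + C₂ + C₃ + C₄, fun f hf => ?_⟩
  have hD := c.integral_sq_nonneg (deriv f)
  have hP := integral_potential_mul_sq_nonneg hV f
  obtain ⟨hm, hr⟩ := hC₁ f hf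
  have b1 : |∫ x, (deriv f x * f x + f x * deriv f x) * q.r x ∂c.meas| ≤
      ε / 4 * (∫ x, deriv f x ^ 2 ∂c.meas) + 4 / ε * ∫ x, (q.r x * f x) ^ 2 ∂c.meas := by
    have i1 := hf.2.2.1.integrable_sq.const_mul (ε / 4)
    have i2 := hm.integrable_sq.const_mul (4 / ε)
    rw [← integral_const_mul, ← integral_const_mul, ← integral_add i1 i2, ← Real.norm_eq_abs]
    refine norm_integral_le_of_norm_le (i1.add i2) (ae_of_all _ fun x => ?_)
    rw [Real.norm_eq_abs]
    have e1 : (deriv f x * f x + f x * deriv f x) * q.r x = 2 * deriv f x * (q.r x * f x) := by ring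
    have hε2 : ε / 4 * (4 / ε) = 1 := by field_simp
    set A := deriv f x
    set B := q.r x * f x
    have key (σ : ℝ) (hσ : σ ^ 2 = 1) : σ * (2 * A * B) ≤ ε / 4 * A ^ 2 + 4 / ε * B ^ 2 := by
      have h0 : 0 ≤ ε / 4 * (A - σ * (4 / ε) * B) ^ 2 := by positivity
      have h1 : ε / 4 * (A - σ * (4 / ε) * B) ^ 2 =
          ε / 4 * A ^ 2 - σ * (2 * A * B) * (ε / 4 * (4 / ε))
            + σ ^ 2 * (ε / 4 * (4 / ε)) * (4 / ε) * B ^ 2 := by ring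
      rw [h1, hε2, hσ] at h0
      linarith
    rw [e1, abs_le]
    constructor
    · linarith [key (-1) (by norm_num)]
    · linarith [key 1 (by norm_num)]
  have b2 : |∫ x, f x * f x * q.s x ∂c.meas| ≤
      ε / 2 * (∫ x, V x * f x ^ 2 ∂c.meas) + C₂ * ∫ x, f x ^ 2 ∂c.meas := by
    have i1 := (integrable_potential_mul_sq hV hf).const_mul (ε / 2)
    have i2 := hf.2.1.integrable_sq.const_mul C₂
    rw [← integral_const_mul, ← integral_const_mul, ← integral_add i1 i2, ← Real.norm_eq_abs]
    refine norm_integral_le_of_norm_le (i1.add i2) ?_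
    filter_upwards [c.ae_mem_dom] with x hx
    have h1 := hC₂ x hx
    rw [Real.norm_eq_abs, abs_mul, ← pow_two, abs_of_nonneg (sq_nonneg (f x))]
    nlinarith [sq_nonneg (f x)]
  have b3 := hC₃ f hf
  have b4 := hC₄ f hf
  have b5 : 4 / ε * ∫ x, (q.r x * f x) ^ 2 ∂c.meas ≤ ε / 2 * (∫ x, V x * f x ^ 2 ∂c.meas)
      + 4 / ε * C₁ * ∫ x, f x ^ 2 ∂c.meas := by
    calc 4 / ε * ∫ x, (q.r x * f x) ^ 2 ∂c.meas ≤ 4 / ε * (ε ^ 2 / 8 *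
          (∫ x, V x * f x ^ 2 ∂c.meas) + C₁ * ∫ x, f x ^ 2 ∂c.meas) := by gcongr
      _ = _ := by
        field_simp
        ring
  rw [lowerForm]
  have h1 := abs_add_le (-(∫ x, (deriv f x * f x + f x * deriv f x) * q.r x ∂c.meas)
    + ∫ x, f x * f x * q.s x ∂c.meas)
    (q.wt₀ * (f q.pt₀ * f q.pt₀) + q.wt₁ * (f q.pt₁ * f q.pt₁))
  have h2 := abs_add_le (-(∫ x, (deriv f x * f x + f x * deriv f x) * q.r x ∂c.meas))
    (∫ x, f x * f x * q.s x ∂c.meas)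
  have h3 := abs_add_le (q.wt₀ * (f q.pt₀ * f q.pt₀)) (q.wt₁ * (f q.pt₁ * f q.pt₁))
  rw [abs_neg] at h2
  have h4 : 0 ≤ ε * ∫ x, deriv f x ^ 2 ∂c.meas := by positivity
  linarith

theorem LowerOrder.IsSmall.isFormBilin (hV : c.IsPotential V) (hq : q.IsSmall c V) :
    IsFormBilin c V (c.lowerForm q) where
  symm f _ g _ := by
    rw [lowerForm, lowerForm]
    congr 1
    · congr 1
      · congr 2 with x
        ring
      · congr 1 with x
        ring
    · ring
  add f hf g hg h hh := by
    have h1 : ∫ x, (deriv (f + g) x * h x + (f + g) x * deriv h x) * q.r x ∂c.meas =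
        (∫ x, (deriv f x * h x + f x * deriv h x) * q.r x ∂c.meas) +
          ∫ x, (deriv g x * h x + g x * deriv h x) * q.r x ∂c.meas := by
      rw [← integral_add (hq.integrable_r hV hf hh) (hq.integrable_r hV hg hh)]
      apply integral_congr_ae
      filter_upwards [hf.1.ae_deriv_add hg.1] with x hx
      rw [hx, Pi.add_apply, Pi.add_apply]
      ring
    have h2 : ∫ x, (f + g) x * h x * q.s x ∂c.meas =
        (∫ x, f x * h x * q.s x ∂c.meas) + ∫ x, g x * h x * q.s x ∂c.meas := by
      rw [← integral_add (hq.integrable_s hV hf hh) (hq.integrable_s hV hg hh)]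
      congr 1 with x
      rw [Pi.add_apply]
      ring
    rw [lowerForm, h1, h2, lowerForm, lowerForm, Pi.add_apply, Pi.add_apply]
    ring
  smul t f hf g hg := by
    have h1 : ∫ x, (deriv (t • f) x * g x + (t • f) x * deriv g x) * q.r x ∂c.meas =
        t * ∫ x, (deriv f x * g x + f x * deriv g x) * q.r x ∂c.meas := by
      rw [← integral_const_mul, deriv_const_smul_eq]
      congr 1 with x
      simp only [Pi.smul_apply, smul_eq_mul]
      ring
    have h2 : ∫ x, (t • f) x * g x * q.s x ∂c.meas = t * ∫ x, f x * g x * q.s x ∂c.meas := by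
      rw [← integral_const_mul]
      congr 1 with x
      rw [Pi.smul_apply, smul_eq_mul]
      ring
    rw [lowerForm, h1, h2, lowerForm, Pi.smul_apply, Pi.smul_apply, smul_eq_mul, smul_eq_mul]
    ring
  congr f hf f' hf' g _ h := by
    have heq := eqOn_of_ae_eq hf.1 hf'.1 h
    have h1 : ∫ x, (deriv f x * g x + f x * deriv g x) * q.r x ∂c.meas =
        ∫ x, (deriv f' x * g x + f' x * deriv g x) * q.r x ∂c.meas := by
      apply integral_congr_ae
      filter_upwards [h, ae_deriv_eq hf.1 hf'.1 h] with x hx hx'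
      rw [hx, hx']
    have h2 : ∫ x, f x * g x * q.s x ∂c.meas = ∫ x, f' x * g x * q.s x ∂c.meas := by
      apply integral_congr_ae
      filter_upwards [h] with x hx
      rw [hx]
    rw [lowerForm, h1, h2, heq hq.mem₀, heq hq.mem₁, lowerForm]
  bound := by
    obtain ⟨C, hC⟩ := hq.abs_lowerForm_le hV one_pos
    refine ⟨1 + |C|, fun f hf => (hC f hf).trans ?_⟩
    have h1 := c.integral_sq_nonneg f
    have h2 := c.integral_sq_nonneg (deriv f)
    have h3 := integral_potential_mul_sq_nonneg hV f
    have h4 : C * ∫ x, f x ^ 2 ∂c.meas ≤ |C| * ∫ x, f x ^ 2 ∂c.meas := by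
      gcongr
      exact le_abs_self C
    have h5 : 0 ≤ |C| * ∫ x, deriv f x ^ 2 ∂c.meas := by positivity
    have h6 : 0 ≤ |C| * ∫ x, V x * f x ^ 2 ∂c.meas := by positivity
    rw [formNormSq_eq hV hf]
    nlinarith

/-- The total form `½⟨f', g'⟩ + ⟨fg, V⟩` plus a lower order form. -/
noncomputable def totalForm (c : Problem) (V : ℝ → ℝ) (q : LowerOrder) (f g : ℝ → ℝ) : ℝ :=
  c.principalForm V f g + c.lowerForm q f g

theorem LowerOrder.IsSmall.isFormBilin_totalForm (hV : c.IsPotential V) (hq : q.IsSmall c V) :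
    IsFormBilin c V (c.totalForm V q) :=
  (isFormBilin_principalForm hV).add_form (hq.isFormBilin hV)

/-- As the lower order form has relative bound zero, the principal part controls the form norm. -/
theorem LowerOrder.IsSmall.exists_coercive (hV : c.IsPotential V) (hq : q.IsSmall c V) :
    ∃ m, ∀ f ∈ c.formDomain V,
      1 / 4 * c.formNormSq V f ≤ c.totalForm V q f f + m * ∫ x, f x ^ 2 ∂c.meas := by
  obtain ⟨C, hC⟩ := hq.abs_lowerForm_le hV (ε := 1 / 4) (by norm_num)
  refine ⟨C + 1 / 4, fun f hf => ?_⟩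
  have h := (abs_le.1 (hC f hf)).1
  have e1 : ∫ x, deriv f x * deriv f x ∂c.meas = ∫ x, deriv f x ^ 2 ∂c.meas := by
    congr 1 with x
    ring
  have e2 : ∫ x, f x * f x * V x ∂c.meas = ∫ x, V x * f x ^ 2 ∂c.meas := by
    congr 1 with x
    ring
  have h3 := integral_potential_mul_sq_nonneg hV f
  rw [totalForm, principalForm, e1, e2, formNormSq_eq hV hf]
  linarith

end Problem

end RandomSchrodinger

/-! ### Extension of the noise form by continuity -/

namespace RandomSchrodinger

namespace Problem

variable {c : Problem} {V f g : ℝ → ℝ} {q : LowerOrder}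

/-- The Lipschitz cutoff which vanishes for `|x| ≤ n + 1` and is `1` for `|x| ≥ 2(n + 1)`. -/
noncomputable def outerCutoff (n : ℕ) (x : ℝ) : ℝ := max 0 (min 1 (|x| / (n + 1) - 1))

theorem outerCutoff_nonneg (n : ℕ) (x : ℝ) : 0 ≤ outerCutoff n x := le_max_left _ _

theorem outerCutoff_le_one (n : ℕ) (x : ℝ) : outerCutoff n x ≤ 1 :=
  max_le zero_le_one (min_le_left _ _)

theorem lipschitzWith_outerCutoff (n : ℕ) : LipschitzWith ((n : NNReal) + 1)⁻¹ (outerCutoff n) := by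
  have h1 : LipschitzWith ((n : NNReal) + 1)⁻¹ fun x : ℝ => |x| / (n + 1) - 1 := by
    apply LipschitzWith.of_dist_le_mul
    intro x y
    simp only [Real.dist_eq, NNReal.coe_inv, NNReal.coe_add, NNReal.coe_natCast, NNReal.coe_one]
    have e : |x| / ((n : ℝ) + 1) - 1 - (|y| / (n + 1) - 1) = ((n : ℝ) + 1)⁻¹ * (|x| - |y|) := by
      field_simp
      ring
    rw [e, abs_mul, abs_of_pos (by positivity : (0 : ℝ) < ((n : ℝ) + 1)⁻¹)]
    exact mul_le_mul_of_nonneg_left (abs_abs_sub_abs_le x y) (by positivity)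
  exact (h1.const_min 1).const_max 0

theorem outerCutoff_eq_zero {n : ℕ} {x : ℝ} (h : |x| ≤ n + 1) : outerCutoff n x = 0 := by
  have : |x| / ((n : ℝ) + 1) - 1 ≤ 0 := by
    rw [sub_nonpos, div_le_one (by positivity)]
    exact h
  rw [outerCutoff, max_eq_left ((min_le_right _ _).trans this)]

theorem outerCutoff_eq_one {n : ℕ} {x : ℝ} (h : 2 * ((n : ℝ) + 1) < |x|) : outerCutoff n x = 1 := by
  have : 1 ≤ |x| / ((n : ℝ) + 1) - 1 := by
    rw [le_sub_iff_add_le, le_div_iff₀ (by positivity)]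
    linarith
  rw [outerCutoff, min_eq_left this, max_eq_right zero_le_one]

theorem abs_outerCutoff_le (n : ℕ) (x : ℝ) : |outerCutoff n x| ≤ 1 := by
  rw [abs_of_nonneg (outerCutoff_nonneg n x)]
  exact outerCutoff_le_one n x

/-- Cutting off outside large intervals gives an approximation in the form norm. -/
theorem tendsto_formNormSq_outerCutoff (hV : c.IsPotential V) (hf : f ∈ c.formDomain V) :
    Tendsto (fun n => c.formNormSq V (outerCutoff n * f)) atTop (𝓝 0) := by
  let G : ℝ → ℝ := fun x => deriv f x ^ 2 + (V x * f x ^ 2 + f x ^ 2)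
  have hGi : Integrable G c.meas :=
    hf.2.2.1.integrable_sq.add ((integrable_potential_mul_sq hV hf).add hf.2.1.integrable_sq)
  have hG0 : ∀ᵐ x ∂c.meas, 0 ≤ G x := by
    filter_upwards [hV.ae_nonneg] with x hx
    simp only [G]
    positivity
  let F : ℕ → ℝ → ℝ := fun n x => 2 * (((n : ℝ) + 1)⁻¹ ^ 2 * f x ^ 2) + 2 * (outerCutoff n x ^ 2 * G x)
  have hFm (n : ℕ) : AEStronglyMeasurable (F n) c.meas := by
    have h1 := hf.2.1.integrable_sq.1
    have h2 : AEStronglyMeasurable (outerCutoff n) c.meas :=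
      (lipschitzWith_outerCutoff n).continuous.aestronglyMeasurable
    exact ((h1.const_mul _).const_mul _).add (((h2.pow 2).mul hGi.1).const_mul _)
  have hbi : Integrable (fun x => 2 * f x ^ 2 + 2 * G x) c.meas :=
    (hf.2.1.integrable_sq.const_mul 2).add (hGi.const_mul 2)
  have hFb (n : ℕ) : ∀ᵐ x ∂c.meas, ‖F n x‖ ≤ 2 * f x ^ 2 + 2 * G x := by
    filter_upwards [hG0] with x hx
    rw [Real.norm_of_nonneg (by positivity)]
    have h1 : ((n : ℝ) + 1)⁻¹ ^ 2 ≤ 1 := by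
      apply pow_le_one₀ (by positivity)
      exact inv_le_one_of_one_le₀ (by linarith [Nat.cast_nonneg (α := ℝ) n])
    have h2 : outerCutoff n x ^ 2 ≤ 1 :=
      pow_le_one₀ (outerCutoff_nonneg n x) (outerCutoff_le_one n x)
    have h3 : ((n : ℝ) + 1)⁻¹ ^ 2 * f x ^ 2 ≤ 1 * f x ^ 2 := by gcongr
    have h4 : outerCutoff n x ^ 2 * G x ≤ 1 * G x := by gcongr
    simp only [F]
    linarith
  have hFlim : ∀ᵐ x ∂c.meas, Tendsto (fun n => F n x) atTop (𝓝 0) := by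
    refine ae_of_all _ fun x => ?_
    have h1 : Tendsto (fun n : ℕ => 2 * (((n : ℝ) + 1)⁻¹ ^ 2 * f x ^ 2)) atTop (𝓝 0) := by
      have h0 : Tendsto (fun n : ℕ => ((n : ℝ) + 1)⁻¹) atTop (𝓝 0) := by
        simpa [one_div] using tendsto_one_div_add_atTop_nhds_zero_nat (𝕜 := ℝ)
      simpa using (((h0.pow 2).mul_const (f x ^ 2)).const_mul 2)
    refine h1.congr' ?_
    filter_upwards [eventually_ge_atTop ⌈|x|⌉₊] with n hn
    have h2 : |x| ≤ n + 1 := by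
      have := (Nat.le_ceil |x|).trans (Nat.cast_le.2 hn)
      linarith
    simp [F, outerCutoff_eq_zero h2]
  have hlim := tendsto_integral_of_dominated_convergence _ hFm hbi hFb hFlim
  rw [integral_zero] at hlim
  have hmem (n : ℕ) : outerCutoff n * f ∈ c.formDomain V :=
    mul_mem_formDomain (lipschitzWith_outerCutoff n) (abs_outerCutoff_le n) hf
  refine squeeze_zero (fun n => formNormSq_nonneg hV (hmem n)) (fun n => ?_) hlim
  have hi : Integrable (fun x => deriv (outerCutoff n * f) x ^ 2 +
      (V x + 1) * (outerCutoff n * f) x ^ 2) c.meas := by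
    refine ((hmem n).2.2.1.integrable_sq.add ((integrable_potential_mul_sq hV (hmem n)).add
      (hmem n).2.1.integrable_sq)).congr (ae_of_all _ fun x => ?_)
    simp only [Pi.add_apply, Pi.mul_apply]
    ring
  refine integral_mono_ae hi (hbi.mono' (hFm n) (hFb n)) ?_
  filter_upwards [(lipschitz_locallyAC (lipschitzWith_outerCutoff n)).ae_deriv_mul hf.1,
    hV.ae_nonneg] with x hx hVx
  have h1 : deriv (outerCutoff n) x ^ 2 ≤ ((n : ℝ) + 1)⁻¹ ^ 2 := by
    apply sq_le_sq' <;>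
    · have := abs_le.1 (abs_deriv_le_of_lipschitz (lipschitzWith_outerCutoff n) x)
      simp only [NNReal.coe_inv, NNReal.coe_add, NNReal.coe_natCast, NNReal.coe_one] at this
      linarith [this.1, this.2]
  have h2 : deriv (outerCutoff n) x ^ 2 * f x ^ 2 ≤ ((n : ℝ) + 1)⁻¹ ^ 2 * f x ^ 2 := by gcongr
  have h3 : 0 ≤ outerCutoff n x ^ 2 * ((V x + 1) * f x ^ 2) := by positivity
  simp only [hx, F, G, Pi.mul_apply]
  nlinarith [sq_nonneg (deriv (outerCutoff n) x * f x - outerCutoff n x * deriv f x)]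

/-- The form core is dense in the form domain. -/
theorem exists_mem_formCore (hV : c.IsPotential V) (hf : f ∈ c.formDomain V) {ε : ℝ}
    (hε : 0 < ε) : ∃ p ∈ c.formCore V, c.formNormSq V (p - f) < ε := by
  obtain ⟨n, hn⟩ := ((tendsto_formNormSq_outerCutoff hV hf).eventually_lt_const hε).exists
  have hmem : outerCutoff n * f ∈ c.formDomain V :=
    mul_mem_formDomain (lipschitzWith_outerCutoff n) (abs_outerCutoff_le n) hf
  refine ⟨f - outerCutoff n * f, ⟨sub_mem_formDomain hf hmem, 2 * ((n : ℝ) + 1), ?_⟩, ?_⟩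
  · intro x _ hx
    simp [outerCutoff_eq_one hx]
  · have : f - outerCutoff n * f - f = (-1 : ℝ) • (outerCutoff n * f) := by
      rw [neg_one_smul]
      abel
    have e : c.formNormSq V ((-1 : ℝ) • (outerCutoff n * f)) =
        c.formNormSq V (outerCutoff n * f) := by
      unfold formNormSq
      rw [deriv_const_smul_eq]
      congr 1 with x
      simp only [Pi.smul_apply, smul_eq_mul]
      ring
    rw [this, e]
    exact hn

theorem coreNhds_neBot (hV : c.IsPotential V) (hf : f ∈ c.formDomain V)
    (hg : g ∈ c.formDomain V) : (c.coreNhds V f g).NeBot := by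
  rw [coreNhds, ((Metric.nhds_basis_ball.comap _).inf_principal _).neBot_iff]
  intro ε hε
  obtain ⟨p, hp, hpf⟩ := exists_mem_formCore hV hf (half_pos hε)
  obtain ⟨p', hp', hpg⟩ := exists_mem_formCore hV hg (half_pos hε)
  refine ⟨(p, p'), ?_, hp, hp'⟩
  have h1 := formNormSq_nonneg hV (sub_mem_formDomain hp.1 hf)
  have h2 := formNormSq_nonneg hV (sub_mem_formDomain hp'.1 hg)
  rw [mem_preimage, Metric.mem_ball, Real.dist_eq, sub_zero, abs_of_nonneg (by positivity)]
  linarith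

open Classical in
/-- `toFormSpace`, extended by zero outside the form domain. -/
noncomputable def toFormSpaceTotal (c : Problem) (V f : ℝ → ℝ) : c.formSpace V :=
  if hf : f ∈ c.formDomain V then toFormSpace f hf else 0

theorem toFormSpaceTotal_eq (hf : f ∈ c.formDomain V) :
    c.toFormSpaceTotal V f = toFormSpace f hf := dif_pos hf

/-- A bounded form which agrees with the explicit noise form on the form core is its extension by
continuity. -/
theorem tendsto_noiseFormula (hV : c.IsPotential V) {w : ℝ → ℝ} {B : (ℝ → ℝ) → (ℝ → ℝ) → ℝ}
    (hB : IsFormBilin c V B)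
    (hcore : ∀ f ∈ c.formCore V, ∀ g ∈ c.formCore V, c.noiseFormula w f g = B f g)
    (hf : f ∈ c.formDomain V) (hg : g ∈ c.formDomain V) :
    Tendsto (fun p => c.noiseFormula w p.1 p.2) (c.coreNhds V f g) (𝓝 (B f g)) := by
  obtain ⟨b, hb⟩ := hB.exists_lift hV
  have hdom : ∀ᶠ p in c.coreNhds V f g, p.1 ∈ c.formCore V ∧ p.2 ∈ c.formCore V :=
    mem_inf_of_right fun p hp => hp
  have hsum : Tendsto (fun p : (ℝ → ℝ) × (ℝ → ℝ) =>
      c.formNormSq V (p.1 - f) + c.formNormSq V (p.2 - g)) (c.coreNhds V f g) (𝓝 0) :=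
    tendsto_comap.mono_left inf_le_left
  have hsqrt (h : ℝ → ℝ) (hh : h ∈ c.formDomain V) (π : (ℝ → ℝ) × (ℝ → ℝ) → ℝ → ℝ)
      (hπ : ∀ᶠ p in c.coreNhds V f g, π p ∈ c.formDomain V ∧ c.formNormSq V (π p - h) ≤
        c.formNormSq V (p.1 - f) + c.formNormSq V (p.2 - g)) :
      Tendsto (fun p => c.toFormSpaceTotal V (π p)) (c.coreNhds V f g)
        (𝓝 (c.toFormSpaceTotal V h)) := by
    rw [tendsto_iff_norm_sub_tendsto_zero]
    have h0 : Tendsto (fun p : (ℝ → ℝ) × (ℝ → ℝ) => √(c.formNormSq V (p.1 - f) +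
        c.formNormSq V (p.2 - g))) (c.coreNhds V f g) (𝓝 0) := by
      have := (Real.continuous_sqrt.tendsto 0).comp hsum
      rw [Real.sqrt_zero] at this
      exact this
    refine squeeze_zero' (Eventually.of_forall fun _ => norm_nonneg _) ?_ h0
    filter_upwards [hπ] with p hp
    apply Real.le_sqrt_of_sq_le
    rw [toFormSpaceTotal_eq hp.1, toFormSpaceTotal_eq hh, norm_toFormSpace_sub_sq hV]
    exact hp.2
  have h1 := hsqrt f hf Prod.fst (by
    filter_upwards [hdom] with p hp
    exact ⟨hp.1.1, le_add_of_nonneg_right (formNormSq_nonneg hV (sub_mem_formDomain hp.2.1 hg))⟩)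
  have h2 := hsqrt g hg Prod.snd (by
    filter_upwards [hdom] with p hp
    exact ⟨hp.2.1, le_add_of_nonneg_left (formNormSq_nonneg hV (sub_mem_formDomain hp.1.1 hf))⟩)
  have hlim := (b.continuous₂.tendsto (c.toFormSpaceTotal V f, c.toFormSpaceTotal V g)).comp
    (h1.prodMk_nhds h2)
  have hval : Function.uncurry (fun x y => b x y)
      (c.toFormSpaceTotal V f, c.toFormSpaceTotal V g) = B f g := by
    rw [Function.uncurry_apply_pair, toFormSpaceTotal_eq hf, toFormSpaceTotal_eq hg, hb]
  rw [hval] at hlim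
  refine hlim.congr' ?_
  filter_upwards [hdom] with p hp
  rw [Function.comp_apply, Function.uncurry_apply_pair, toFormSpaceTotal_eq hp.1.1,
    toFormSpaceTotal_eq hp.2.1, hb, hcore _ hp.1 _ hp.2]

/-- The noise form is the bounded form with which it agrees on the form core. -/
theorem noise_eq (hV : c.IsPotential V) {w : ℝ → ℝ} {B : (ℝ → ℝ) → (ℝ → ℝ) → ℝ}
    (hB : IsFormBilin c V B)
    (hcore : ∀ f ∈ c.formCore V, ∀ g ∈ c.formCore V, c.noiseFormula w f g = B f g)
    (hf : f ∈ c.formDomain V) (hg : g ∈ c.formDomain V) : c.noise V w f g = B f g := by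
  have := coreNhds_neBot hV hf hg
  exact (tendsto_noiseFormula hV hB hcore hf hg).limUnder_eq

theorem noiseFormWellDefined (hV : c.IsPotential V) {w : ℝ → ℝ} {B : (ℝ → ℝ) → (ℝ → ℝ) → ℝ}
    (hB : IsFormBilin c V B)
    (hcore : ∀ f ∈ c.formCore V, ∀ g ∈ c.formCore V, c.noiseFormula w f g = B f g) :
    c.NoiseFormWellDefined V w := fun f hf g hg => by
  rw [noise_eq hV hB hcore hf hg]
  exact ⟨coreNhds_neBot hV hf hg, tendsto_noiseFormula hV hB hcore hf hg⟩

theorem toFormSpace_rep (hV : c.IsPotential V) (p : c.formSpace V) :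
    toFormSpace (rep p) (rep_mem p) = p :=
  embed_injective hV (Lp.ext ((embed_toFormSpace_ae (rep_mem p)).trans (embed_ae p).symm))

/-- The total form, on the form space, is coercive after a shift. -/
theorem LowerOrder.IsSmall.exists_isCoerciveForm (hV : c.IsPotential V) (hq : q.IsSmall c V) :
    ∃ (a : c.formSpace V →L[ℝ] c.formSpace V →L[ℝ] ℝ) (m : ℝ), IsCoerciveForm (embed c V) a m ∧
      ∀ (f g : ℝ → ℝ) (hf : f ∈ c.formDomain V) (hg : g ∈ c.formDomain V),
        a (toFormSpace f hf) (toFormSpace g hg) = c.totalForm V q f g := by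
  have hB := hq.isFormBilin_totalForm hV
  obtain ⟨a, ha⟩ := hB.exists_lift hV
  obtain ⟨m, hm⟩ := hq.exists_coercive hV
  refine ⟨a, m, ⟨embed_injective hV, denseRange_embed hV, isCompactOperator_embed hV, ?_,
    1 / 4, by norm_num, ?_⟩, ha⟩
  · intro u v
    rw [← toFormSpace_rep hV u, ← toFormSpace_rep hV v, ha, ha]
    exact hB.symm _ (rep_mem u) _ (rep_mem v)
  · intro u
    have h1 := hm _ (rep_mem u)
    have h2 : ‖embed c V u‖ ^ 2 = ∫ x, rep u x ^ 2 ∂c.meas := by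
      rw [L2_norm_sq_eq, integral_sq_congr (embed_ae u)]
    rw [norm_sq_eq hV, h2]
    conv_rhs => rw [← toFormSpace_rep hV u]
    rw [ha, toFormSpace_rep hV u]
    exact h1

end Problem

end RandomSchrodinger

/-! ### The lemma of du Bois-Reymond -/

section DuBoisReymond

variable {U : Set ℝ}

theorem MeasureTheory.LocallyIntegrableOn.intervalIntegrable_of_mem {k : ℝ → ℝ} (hU : OrdConnected U)
    (hk : LocallyIntegrableOn k U) {x y : ℝ} (hx : x ∈ U) (hy : y ∈ U) :
    IntervalIntegrable k volume x y :=
  (hk.integrableOn_compact_subset (hU.uIcc_subset hx hy) isCompact_uIcc).intervalIntegrable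

theorem MeasureTheory.LocallyIntegrableOn.continuousOn_primitive_of_mem {k : ℝ → ℝ} (hUo : IsOpen U)
    (hU : OrdConnected U) (hk : LocallyIntegrableOn k U) {x₀ : ℝ} (hx₀ : x₀ ∈ U) :
    ContinuousOn (fun x => ∫ t in x₀..x, k t) U := by
  intro x hx
  obtain ⟨l, u, ⟨hl, hu⟩, hlu⟩ := mem_nhds_iff_exists_Ioo_subset.1 (hUo.mem_nhds hx)
  obtain ⟨p, hp1, hp2⟩ := exists_between hl
  obtain ⟨q, hq1, hq2⟩ := exists_between hu
  have hpU : p ∈ U := hlu ⟨hp1, hp2.trans hu⟩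
  have hqU : q ∈ U := hlu ⟨hl.trans hq1, hq2⟩
  have hc : ContinuousOn (fun y => ∫ t in p..y, k t) (uIcc p q) :=
    intervalIntegral.continuousOn_primitive_interval' (hk.intervalIntegrable_of_mem hU hpU hqU)
      left_mem_uIcc
  have hn : uIcc p q ∈ 𝓝 x := by
    rw [uIcc_of_le (hp2.trans hq1).le]
    exact Icc_mem_nhds hp2 hq1
  have hat : ContinuousAt (fun y => (∫ t in x₀..p, k t) + ∫ t in p..y, k t) x :=
    continuousAt_const.add (hc.continuousAt hn)
  refine (hat.congr ?_).continuousWithinAt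
  filter_upwards [hUo.mem_nhds hx] with y hy
  exact intervalIntegral.integral_add_adjacent_intervals (hk.intervalIntegrable_of_mem hU hx₀ hpU)
    (hk.intervalIntegrable_of_mem hU hpU hy)

theorem exists_Icc_of_isCompact_subset {K : Set ℝ} (hK : IsCompact K)
    (hne : K.Nonempty) (hKU : K ⊆ U) : ∃ a ∈ U, ∃ b ∈ U, a ≤ b ∧ K ⊆ Icc a b := by
  refine ⟨sInf K, hKU (hK.sInf_mem hne), sSup K, hKU (hK.sSup_mem hne), ?_, fun x hx =>
    ⟨csInf_le hK.bddBelow hx, le_csSup hK.bddAbove hx⟩⟩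
  exact csInf_le hK.bddBelow (hK.sSup_mem hne)

theorem setIntegral_eq_intervalIntegral_of_eq_zero {φ : ℝ → ℝ} {a b : ℝ} (hm : MeasurableSet U)
    (hab : a ≤ b) (hI : Icc a b ⊆ U) (h : ∀ x ∈ U, x ∉ Icc a b → φ x = 0) :
    ∫ x in U, φ x = ∫ x in a..b, φ x := by
  rw [intervalIntegral.integral_of_le hab, ← integral_Icc_eq_integral_Ioc]
  exact setIntegral_eq_of_subset_of_forall_sdiff_eq_zero hm hI fun x hx => h x hx.1 hx.2

/-- The lemma of du Bois-Reymond: if `p' = k` weakly on an open interval, then `p` is, up to a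
constant, a primitive of `k`. -/
theorem exists_ae_eq_const_add_integral (hUo : IsOpen U) (hU : OrdConnected U) {p k : ℝ → ℝ}
    (hp : LocallyIntegrableOn p U) (hk : LocallyIntegrableOn k U) {x₀ : ℝ} (hx₀ : x₀ ∈ U)
    (h : ∀ f : ℝ → ℝ, ContDiff ℝ (⊤ : ℕ∞) f → HasCompactSupport f → tsupport f ⊆ U →
      ∫ x in U, (p x * deriv f x + k x * f x) = 0) :
    ∃ κ, ∀ᵐ x, x ∈ U → p x = κ + ∫ t in x₀..x, k t := by
  set F : ℝ → ℝ := fun x => ∫ t in x₀..x, k t with hF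
  have hFc : ContinuousOn F U := hk.continuousOn_primitive_of_mem hUo hU hx₀
  have hpF : LocallyIntegrableOn (fun x => p x - F x) U :=
    hp.sub (hFc.locallyIntegrableOn hUo.measurableSet)
  have hint {φ : ℝ → ℝ} (hφ : LocallyIntegrableOn φ U) {g : ℝ → ℝ} (hg : Continuous g) {a b : ℝ}
      (ha : a ∈ U) (hb : b ∈ U) : IntervalIntegrable (fun x => φ x * g x) volume a b :=
    (hφ.intervalIntegrable_of_mem hU ha hb).mul_continuousOn hg.continuousOn
  -- Integration by parts turns the weak equation into `∫ (p - F) f' = 0`.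
  have key (f : ℝ → ℝ) (hf : ContDiff ℝ (⊤ : ℕ∞) f) {a b : ℝ} (ha : a ∈ U) (hb : b ∈ U)
      (hab : a ≤ b) (hs : ∀ x ∉ Ioo a b, f x = 0) : ∫ x in a..b, (p x - F x) * deriv f x = 0 := by
    have hf1 : ContDiff ℝ 1 f := hf.of_le (by exact_mod_cast le_top)
    have hI : Icc a b ⊆ U := hU.out ha hb
    have hts : tsupport f ⊆ Icc a b := closure_minimal (fun x hx => by
      by_contra hx'
      exact hx (hs x fun hx'' => hx' (Ioo_subset_Icc_self hx''))) isClosed_Icc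
    have hd0 : ∀ x ∉ Icc a b, deriv f x = 0 := fun x hx => by
      by_contra hx'
      exact hx (hts (support_deriv_subset hx'))
    have h1 := h f hf (HasCompactSupport.of_support_subset_isCompact isCompact_Icc
      ((subset_tsupport f).trans hts)) (hts.trans hI)
    rw [setIntegral_eq_intervalIntegral_of_eq_zero hUo.measurableSet hab hI (fun x _ hx => by
      rw [hd0 x hx, hs x fun hx'' => hx (Ioo_subset_Icc_self hx'')]
      ring), intervalIntegral.integral_add (hint hp (hf1.continuous_deriv le_rfl) ha hb)
      (hint hk hf.continuous ha hb)] at h1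
    have hk' := hk.intervalIntegrable_of_mem hU ha hb
    have hac : AbsolutelyContinuousOnInterval F a b := by
      have h2 := hk'.absolutelyContinuousOnInterval_intervalIntegral (c := a) left_mem_uIcc
      have h3 : AbsolutelyContinuousOnInterval (fun _ : ℝ => F a) a b :=
        (LipschitzWith.const (F a)).lipschitzOnWith.absolutelyContinuousOnInterval
      refine absolutelyContinuousOnInterval_congr (h3.add h2) fun t ht => ?_
      exact intervalIntegral.integral_add_adjacent_intervals
        (hk.intervalIntegrable_of_mem hU hx₀ ha)
        (hk.intervalIntegrable_of_mem hU ha (hU.uIcc_subset ha hb ht))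
    have hparts := hac.integral_mul_deriv_eq_deriv_mul
      (hf1.contDiffOn.absolutelyContinuousOnInterval (a := a) (b := b))
    have hderiv : ∫ x in a..b, deriv F x * f x = ∫ x in a..b, k x * f x := by
      apply intervalIntegral.integral_congr_ae
      filter_upwards [hk'.ae_hasDerivAt_integral] with x hx hxm
      have hxm' := uIoc_subset_uIcc hxm
      have := hx hxm' a left_mem_uIcc
      by_cases hxb : f x = 0
      · simp [hxb]
      have hxI : x ∈ Ioo a b := by
        by_contra hx'
        exact hxb (hs x hx')
      have heq : F =ᶠ[𝓝 x] fun y => F a + ∫ t in a..y, k t := by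
        filter_upwards [isOpen_Ioo.mem_nhds hxI] with y hy
        exact (intervalIntegral.integral_add_adjacent_intervals
          (hk.intervalIntegrable_of_mem hU hx₀ ha)
          (hk.intervalIntegrable_of_mem hU ha (hI (Ioo_subset_Icc_self hy)))).symm
      rw [heq.deriv_eq, (this.const_add (F a)).deriv]
    rw [hs a (by simp), hs b (by simp), hderiv] at hparts
    have e : ∫ x in a..b, (p x - F x) * deriv f x =
        (∫ x in a..b, p x * deriv f x) - ∫ x in a..b, F x * deriv f x := by
      rw [← intervalIntegral.integral_sub (hint hp (hf1.continuous_deriv le_rfl) ha hb)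
        (hint (hFc.locallyIntegrableOn hUo.measurableSet) (hf1.continuous_deriv le_rfl) ha hb)]
      congr 1 with x
      ring
    rw [e, hparts]
    linarith
  -- A bump function with integral one.
  obtain ⟨g₀, hg₀s, hg₀c, hg₀d, hg₀1⟩ : ∃ g : ℝ → ℝ, tsupport g ⊆ U ∧ HasCompactSupport g ∧
      ContDiff ℝ (⊤ : ℕ∞) g ∧ ∫ x, g x = 1 := by
    obtain ⟨g, h1, h2, h3, h4, h5⟩ := exists_contDiff_tsupport_subset (n := ⊤) (hUo.mem_nhds hx₀)
    have hpos : 0 < ∫ x, g x :=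
      h3.continuous.integral_pos_of_hasCompactSupport_nonneg_nonzero h2
        (fun x => (h4 ⟨x, rfl⟩).1) (x := x₀) (by simp [h5])
    refine ⟨fun x => (∫ x, g x)⁻¹ * g x, ?_, h2.mul_left, contDiff_const.mul h3, ?_⟩
    · exact (closure_mono fun x hx => by
        intro h0
        exact hx (by simp [h0])).trans h1
    · rw [integral_const_mul, inv_mul_cancel₀ hpos.ne']
  set κ := ∫ x in U, (p x - F x) * g₀ x with hκ
  refine ⟨κ, ?_⟩
  have hz := hUo.ae_eq_zero_of_integral_contDiff_smul_eq_zero (μ := volume)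
    (f := fun x => p x - F x - κ)
    (hpF.sub (continuousOn_const.locallyIntegrableOn hUo.measurableSet)) ?_
  · filter_upwards [hz] with x hx hxU
    linarith [hx hxU]
  intro g hg hgc hgs
  obtain ⟨a', ha', b', hb', hab', hK⟩ := exists_Icc_of_isCompact_subset
    ((hgc.isCompact.union hg₀c.isCompact).union isCompact_singleton)
    ⟨x₀, Or.inr rfl⟩ (union_subset (union_subset hgs hg₀s) (singleton_subset_iff.2 hx₀))
  -- Slightly larger endpoints, outside the supports.
  obtain ⟨a, haU, ha⟩ : ∃ a ∈ U, a < a' := by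
    obtain ⟨l, u, ⟨hl, hu⟩, hlu⟩ := mem_nhds_iff_exists_Ioo_subset.1 (hUo.mem_nhds ha')
    obtain ⟨p, hp1, hp2⟩ := exists_between hl
    exact ⟨p, hlu ⟨hp1, hp2.trans hu⟩, hp2⟩
  obtain ⟨b, hbU, hb⟩ : ∃ b ∈ U, b' < b := by
    obtain ⟨l, u, ⟨hl, hu⟩, hlu⟩ := mem_nhds_iff_exists_Ioo_subset.1 (hUo.mem_nhds hb')
    obtain ⟨p, hp1, hp2⟩ := exists_between hu
    exact ⟨p, hlu ⟨hl.trans hp1, hp2⟩, hp1⟩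
  have hab : a ≤ b := (ha.le.trans hab').trans hb.le
  have hI : Icc a b ⊆ U := hU.out haU hbU
  have hg0 {x : ℝ} (hx : x ∉ Icc a' b') : g x = 0 := by
    by_contra h0
    exact hx (hK (Or.inl (Or.inl (subset_tsupport g h0))))
  have hg₀0 {x : ℝ} (hx : x ∉ Icc a' b') : g₀ x = 0 := by
    by_contra h0
    exact hx (hK (Or.inl (Or.inr (subset_tsupport g₀ h0))))
  set G : ℝ → ℝ := fun x => g x - (∫ y, g y) * g₀ x with hG
  have hGd : ContDiff ℝ (⊤ : ℕ∞) G := hg.sub (contDiff_const.mul hg₀d)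
  have hG0 {x : ℝ} (hx : x ∉ Icc a' b') : G x = 0 := by simp [hG, hg0 hx, hg₀0 hx]
  set f : ℝ → ℝ := fun x => ∫ t in a..x, G t with hf
  have hfd (x : ℝ) : HasDerivAt f (G x) x := intervalIntegral.integral_hasDerivAt_right
    (hGd.continuous.intervalIntegrable _ _) (hGd.continuous.stronglyMeasurableAtFilter _ _)
    hGd.continuous.continuousAt
  have hfderiv : deriv f = G := funext fun x => (hfd x).deriv
  have hfC : ContDiff ℝ (⊤ : ℕ∞) f := by
    rw [contDiff_infty_iff_deriv, hfderiv]
    exact ⟨fun x => (hfd x).differentiableAt, hGd⟩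
  have hsub : Icc a' b' ⊆ Icc a b := Icc_subset_Icc ha.le hb.le
  have htot : ∫ t in a..b, G t = 0 := by
    have e1 : ∫ t in a..b, g t = ∫ t, g t := by
      rw [← setIntegral_univ (f := g)]
      exact (setIntegral_eq_intervalIntegral_of_eq_zero MeasurableSet.univ hab (subset_univ _)
        fun x _ hx => hg0 fun hx' => hx (hsub hx')).symm
    have e2 : ∫ t in a..b, g₀ t = ∫ t, g₀ t := by
      rw [← setIntegral_univ (f := g₀)]
      exact (setIntegral_eq_intervalIntegral_of_eq_zero MeasurableSet.univ hab (subset_univ _)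
        fun x _ hx => hg₀0 fun hx' => hx (hsub hx')).symm
    rw [hG, intervalIntegral.integral_sub (hg.continuous.intervalIntegrable _ _)
      ((hg₀d.continuous.const_mul _).intervalIntegrable _ _), intervalIntegral.integral_const_mul,
      e1, e2, hg₀1]
    ring
  have hfs : ∀ x ∉ Ioo a b, f x = 0 := by
    intro x hx
    rcases le_or_gt x a with hxa | hxa
    · refine intervalIntegral.integral_zero_ae (ae_of_all _ fun t ht => hG0 fun ht' => ?_)
      have := (uIoc_of_ge hxa ▸ ht : t ∈ Ioc x a).2
      linarith [ht'.1]
    · have hxb : b ≤ x := by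
        by_contra hxb
        exact hx ⟨hxa, not_le.1 hxb⟩
      have h2 : ∫ t in b..x, G t = 0 :=
        intervalIntegral.integral_zero_ae (ae_of_all _ fun t ht => hG0 fun ht' => by
          have := (uIoc_of_le hxb ▸ ht : t ∈ Ioc b x).1
          linarith [ht'.2])
      simp only [hf]
      rw [← intervalIntegral.integral_add_adjacent_intervals
        (hGd.continuous.intervalIntegrable a b) (hGd.continuous.intervalIntegrable b x), htot, h2,
        add_zero]
  have hkey := key f hfC haU hbU hab hfs
  rw [hfderiv] at hkey
  have hκ' : κ = ∫ x in a..b, (p x - F x) * g₀ x :=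
    setIntegral_eq_intervalIntegral_of_eq_zero hUo.measurableSet hab hI fun x _ hx => by
      rw [hg₀0 fun hx' => hx (hsub hx'), mul_zero]
  have hgint : ∫ y, g y = ∫ x in a..b, g x := by
    rw [← setIntegral_univ (f := g)]
    exact setIntegral_eq_intervalIntegral_of_eq_zero MeasurableSet.univ hab (subset_univ _)
      fun x _ hx => hg0 fun hx' => hx (hsub hx')
  have i1 := hint hpF hg.continuous haU hbU
  have i2 := hint hpF hg₀d.continuous haU hbU
  have e1 : ∫ x in a..b, (p x - F x) * G x =
      (∫ x in a..b, (p x - F x) * g x) - (∫ y, g y) * κ := by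
    rw [hκ', ← intervalIntegral.integral_const_mul, ← intervalIntegral.integral_sub i1
      (i2.const_mul _)]
    congr 1 with x
    simp only [hG]
    ring
  rw [← setIntegral_univ, setIntegral_eq_intervalIntegral_of_eq_zero MeasurableSet.univ hab (subset_univ _)
    (fun x _ hx => by rw [hg0 fun hx' => hx (hsub hx'), zero_smul])]
  have e2 : ∫ x in a..b, g x • (p x - F x - κ) =
      (∫ x in a..b, (p x - F x) * g x) - κ * ∫ x in a..b, g x := by
    rw [← intervalIntegral.integral_const_mul, ← intervalIntegral.integral_sub i1
      ((hg.continuous.intervalIntegrable _ _).const_mul _)]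
    congr 1 with x
    simp only [smul_eq_mul]
    ring
  rw [e2, ← hgint]
  linarith

end DuBoisReymond

/-! ### Simplicity of the eigenvalues -/

namespace RandomSchrodinger

namespace Problem

variable {c : Problem} {V f g h : ℝ → ℝ} {q : LowerOrder} {μ : ℝ}

/-- `h` is a weak solution in the form domain of the eigenvalue equation with eigenvalue `μ`. -/
structure IsWeakSolution (c : Problem) (V : ℝ → ℝ) (q : LowerOrder) (μ : ℝ) (h : ℝ → ℝ) :
    Prop where
  mem : h ∈ c.formDomain V
  eq : ∀ f ∈ c.formDomain V, c.totalForm V q f h = μ * ∫ x, f x * h x ∂c.meas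

theorem IsWeakSolution.sub_smul {u v : ℝ → ℝ} (hV : c.IsPotential V) (hq : q.IsSmall c V)
    (hv : c.IsWeakSolution V q μ v) (hu : c.IsWeakSolution V q μ u) (t : ℝ) :
    c.IsWeakSolution V q μ (v + (-t) • u) := by
  have hB := hq.isFormBilin_totalForm hV
  have hmu := smul_mem_formDomain (-t) hu.mem
  refine ⟨add_mem_formDomain hv.mem hmu, fun f hf => ?_⟩
  have i1 : Integrable (fun x => f x * v x) c.meas := hf.2.1.integrable_mul hv.mem.2.1
  have i2 : Integrable (fun x => f x * u x) c.meas := hf.2.1.integrable_mul hu.mem.2.1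
  have e : ∫ x, f x * (v + (-t) • u) x ∂c.meas =
      (∫ x, f x * v x ∂c.meas) + (-t) * ∫ x, f x * u x ∂c.meas := by
    rw [← integral_const_mul, ← integral_add i1 (i2.const_mul _)]
    congr 1 with x
    simp only [Pi.add_apply, Pi.smul_apply, smul_eq_mul]
    ring
  rw [hB.symm f hf _ (add_mem_formDomain hv.mem hmu), hB.add _ hv.mem _ hmu _ hf,
    hB.smul _ _ hu.mem _ hf, hB.symm _ hv.mem _ hf, hB.symm _ hu.mem _ hf, hv.eq f hf, hu.eq f hf, e]
  ring

theorem ordConnected_dom (c : Problem) : OrdConnected c.dom := by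
  rcases c.closure_dom_cases with ⟨h1, h2⟩ | ⟨h1, h2⟩ | ⟨b, -, h1, h2⟩ <;> rw [h1]
  exacts [ordConnected_univ, ordConnected_Ioi, ordConnected_Ioo]

theorem locallyIntegrableOn_deriv (hf : f ∈ c.formDomain V) :
    LocallyIntegrableOn (deriv f) c.dom := by
  have h1 : LocallyIntegrable (deriv f) c.meas := by
    have : IsLocallyFiniteMeasure c.meas := by
      unfold meas
      infer_instance
    exact hf.2.2.1.locallyIntegrable one_le_two
  exact locallyIntegrableOn_of_locallyIntegrable_restrict h1

/-- The derivative of the quasi-derivative `½h' - rh` of a solution `h`, as given by the equation. It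
is only locally integrable, as `V` is. -/
noncomputable def quasiDensity (V : ℝ → ℝ) (q : LowerOrder) (μ : ℝ) (h : ℝ → ℝ) (x : ℝ) : ℝ :=
  h x * (V x + q.s x - μ) - deriv h x * q.r x

theorem locallyIntegrableOn_quasiDensity (hV : c.IsPotential V) (hq : q.IsSmall c V)
    (hf : f ∈ c.formDomain V) : LocallyIntegrableOn (quasiDensity V q μ f) c.dom := by
  have hVd : LocallyIntegrableOn V c.dom := hV.locallyIntegrable.mono_set subset_closure
  have hs : LocallyIntegrableOn (fun x => V x + (q.s x - μ)) c.dom :=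
    hVd.add ((hq.continuous_s.sub continuous_const).continuousOn.locallyIntegrableOn
      c.measurableSet_dom)
  have hfc : ContinuousOn f c.dom := hf.1.continuousOn.mono subset_closure
  have h1 := hs.continuousOn_mul hfc c.isOpen_dom.isLocallyClosed
  have h2 := (locallyIntegrableOn_deriv hf).continuousOn_mul hq.continuous_r.continuousOn
    c.isOpen_dom.isLocallyClosed
  refine (h1.sub h2).congr ?_
  refine ae_of_all _ fun x => ?_
  simp only [quasiDensity, Pi.sub_apply]
  ring

/-- Weak solutions are continuously differentiable, and solve the integrated equation. The point
evaluations may carry weight at the endpoints only, where test functions vanish. -/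
theorem IsWeakSolution.regularity (hV : c.IsPotential V) (hq : q.IsSmall c V)
    (h₀ : q.pt₀ ∈ c.dom → q.wt₀ = 0) (h₁ : q.pt₁ ∈ c.dom → q.wt₁ = 0)
    (hh : c.IsWeakSolution V q μ h) {x₀ : ℝ} (hx₀ : x₀ ∈ c.dom) :
    ContinuousOn (deriv h) c.dom ∧ (∀ x ∈ c.dom, DifferentiableAt ℝ h x) ∧
      ∃ κ, ∀ x ∈ c.dom, 1 / 2 * deriv h x - h x * q.r x =
        κ + ∫ t in x₀..x, quasiDensity V q μ h t := by
  have hm := hh.mem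
  have hk := locallyIntegrableOn_quasiDensity (μ := μ) hV hq hm
  have hhc : ContinuousOn h c.dom := hm.1.continuousOn.mono subset_closure
  have hp : LocallyIntegrableOn (fun x => 1 / 2 * deriv h x - h x * q.r x) c.dom := by
    have h1 := (locallyIntegrableOn_deriv hm).continuousOn_mul
      (continuousOn_const (c := (1 / 2 : ℝ))) c.isOpen_dom.isLocallyClosed
    exact h1.sub ((hhc.mul hq.continuous_r.continuousOn).locallyIntegrableOn c.measurableSet_dom)
  obtain ⟨κ, hκ⟩ := exists_ae_eq_const_add_integral c.isOpen_dom c.ordConnected_dom hp hk hx₀ (by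
    intro f hf hfc hfs
    have hfm := mem_formDomain_of_contDiff hV hf hfc hfs
    have hz {x : ℝ} (hx : x ∉ c.dom) : f x = 0 := by
      by_contra h0
      exact hx (hfs (subset_tsupport f h0))
    have e0 : q.wt₀ * (f q.pt₀ * h q.pt₀) = 0 := by
      by_cases hx : q.pt₀ ∈ c.dom
      · rw [h₀ hx, zero_mul]
      · rw [hz hx, zero_mul, mul_zero]
    have e1 : q.wt₁ * (f q.pt₁ * h q.pt₁) = 0 := by
      by_cases hx : q.pt₁ ∈ c.dom
      · rw [h₁ hx, zero_mul]
      · rw [hz hx, zero_mul, mul_zero]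
    have heq := hh.eq f hfm
    rw [totalForm, principalForm, lowerForm, e0, e1] at heq
    have i1 : Integrable (fun x => deriv f x * deriv h x) c.meas :=
      hfm.2.2.1.integrable_mul hm.2.2.1
    have i2 := integrable_mul_mul_potential hV hfm hm
    have i3 := hq.integrable_r hV hfm hm
    have i4 := hq.integrable_s hV hfm hm
    have i5 : Integrable (fun x => f x * h x) c.meas := hfm.2.1.integrable_mul hm.2.1
    have e : ∫ x, ((1 / 2 * deriv h x - h x * q.r x) * deriv f x + quasiDensity V q μ h x * f x)
        ∂c.meas = 1 / 2 * (∫ x, deriv f x * deriv h x ∂c.meas) + (∫ x, f x * h x * V x ∂c.meas)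
        - (∫ x, (deriv f x * h x + f x * deriv h x) * q.r x ∂c.meas)
        + (∫ x, f x * h x * q.s x ∂c.meas) - μ * ∫ x, f x * h x ∂c.meas := by
      have j1 : Integrable (fun x => 1 / 2 * (deriv f x * deriv h x) + f x * h x * V x) c.meas :=
        (i1.const_mul _).add i2
      have j2 : Integrable (fun x => 1 / 2 * (deriv f x * deriv h x) + f x * h x * V x
          - (deriv f x * h x + f x * deriv h x) * q.r x) c.meas := j1.sub i3
      have j3 : Integrable (fun x => 1 / 2 * (deriv f x * deriv h x) + f x * h x * V x
          - (deriv f x * h x + f x * deriv h x) * q.r x + f x * h x * q.s x) c.meas := j2.add i4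
      rw [← integral_const_mul, ← integral_const_mul, ← integral_add (i1.const_mul _) i2,
        ← integral_sub j1 i3, ← integral_add j2 i4, ← integral_sub j3 (i5.const_mul _)]
      congr 1 with x
      simp only [quasiDensity]
      ring
    change ∫ x, _ ∂c.meas = 0
    rw [e]
    linarith)
  -- The right-hand side of the first order equation for `h` is continuous.
  set G : ℝ → ℝ := fun x => 2 * (h x * q.r x + (κ + ∫ t in x₀..x, quasiDensity V q μ h t)) with hG
  have hGc : ContinuousOn G c.dom :=
    continuousOn_const.mul ((hhc.mul hq.continuous_r.continuousOn).add (continuousOn_const.add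
      (hk.continuousOn_primitive_of_mem c.isOpen_dom c.ordConnected_dom hx₀)))
  have hGi := hGc.locallyIntegrableOn c.measurableSet_dom (μ := volume)
  have hint (x : ℝ) (hx : x ∈ c.dom) : h x = h x₀ + ∫ t in x₀..x, G t := by
    rw [← sub_eq_iff_eq_add', hm.1.sub_eq_integral (subset_closure hx₀) (subset_closure hx)]
    apply intervalIntegral.integral_congr_ae
    filter_upwards [hκ] with t ht htm
    have := ht (c.ordConnected_dom.uIcc_subset hx₀ hx (uIoc_subset_uIcc htm))
    simp only [hG]
    linarith
  have hd (x : ℝ) (hx : x ∈ c.dom) : HasDerivAt h (G x) x := by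
    have h1 : HasDerivAt (fun y => ∫ t in x₀..y, G t) (G x) x :=
      intervalIntegral.integral_hasDerivAt_right
        (hGi.intervalIntegrable_of_mem c.ordConnected_dom hx₀ hx)
        (hGc.stronglyMeasurableAtFilter c.isOpen_dom x hx)
        (hGc.continuousAt (c.isOpen_dom.mem_nhds hx))
    refine (h1.const_add (h x₀)).congr_of_eventuallyEq ?_
    filter_upwards [c.isOpen_dom.mem_nhds hx] with y hy using hint y hy
  refine ⟨hGc.congr fun x hx => (hd x hx).deriv, fun x hx => (hd x hx).differentiableAt, κ,
    fun x hx => ?_⟩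
  rw [(hd x hx).deriv]
  simp only [hG]
  ring

/-- A solution with vanishing initial data vanishes nearby. -/
theorem IsWeakSolution.eventually_eq_zero (hV : c.IsPotential V) (hq : q.IsSmall c V)
    (h₀ : q.pt₀ ∈ c.dom → q.wt₀ = 0) (h₁ : q.pt₁ ∈ c.dom → q.wt₁ = 0)
    (hh : c.IsWeakSolution V q μ h) {x₀ : ℝ} (hx₀ : x₀ ∈ c.dom) (hz : h x₀ = 0)
    (hz' : deriv h x₀ = 0) : ∀ᶠ x in 𝓝 x₀, h x = 0 := by
  obtain ⟨hdc, hdiff, κ, hκ⟩ := hh.regularity hV hq h₀ h₁ hx₀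
  have hκ0 : κ = 0 := by
    have := hκ x₀ hx₀
    rw [hz, hz', intervalIntegral.integral_same] at this
    linarith
  subst hκ0
  obtain ⟨δ, hδ, hball⟩ := Metric.isOpen_iff.1 c.isOpen_dom x₀ hx₀
  have hsub (η : ℝ) (hη : η ≤ δ / 2) : Icc (x₀ - η) (x₀ + η) ⊆ c.dom := fun x hx => by
    apply hball
    rw [Metric.mem_ball, Real.dist_eq, abs_lt]
    constructor <;> linarith [hx.1, hx.2]
  obtain ⟨R, hR⟩ := isCompact_Icc.exists_bound_of_continuousOn
    (s := Icc (x₀ - δ / 2) (x₀ + δ / 2)) hq.continuous_r.continuousOn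
  have hVd : LocallyIntegrableOn V c.dom := hV.locallyIntegrable.mono_set subset_closure
  have hWi : LocallyIntegrableOn (fun x => V x + (q.s x - μ)) c.dom :=
    hVd.add ((hq.continuous_s.sub continuous_const).continuousOn.locallyIntegrableOn
      c.measurableSet_dom)
  have hWI := hWi.integrableOn_compact_subset (hsub (δ / 2) le_rfl) isCompact_Icc
  set K := ∫ x in Icc (x₀ - δ / 2) (x₀ + δ / 2), |V x + (q.s x - μ)| with hK
  have hK0 : 0 ≤ K := integral_nonneg fun _ => abs_nonneg _
  have hR0 : 0 ≤ R := (norm_nonneg _).trans (hR x₀ ⟨by linarith, by linarith⟩)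
  set η := min (δ / 2) (1 / (8 * R + 4 * K + 1)) with hηdef
  have hη : 0 < η := lt_min (by positivity) (by positivity)
  have hηδ : η ≤ δ / 2 := min_le_left _ _
  have hηC : η * (4 * R + 2 * K) ≤ 1 / 2 := by
    have h1 : η ≤ 1 / (8 * R + 4 * K + 1) := min_le_right _ _
    rw [le_div_iff₀ (by positivity)] at h1
    linarith
  have hIη := hsub η hηδ
  have hII : Icc (x₀ - η) (x₀ + η) ⊆ Icc (x₀ - δ / 2) (x₀ + δ / 2) :=
    Icc_subset_Icc (by linarith) (by linarith)
  have hx₀I : x₀ ∈ Icc (x₀ - η) (x₀ + η) := ⟨by linarith, by linarith⟩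
  have huI {x : ℝ} (hx : x ∈ Icc (x₀ - η) (x₀ + η)) : uIcc x₀ x ⊆ Icc (x₀ - η) (x₀ + η) :=
    ordConnected_Icc.uIcc_subset hx₀I hx
  -- The maximum of `|h'|` near `x₀` is at most half of itself.
  obtain ⟨y, hy, hymax⟩ := isCompact_Icc.exists_isMaxOn ⟨x₀, hx₀I⟩
    (hdc.mono hIη).norm
  set M := ‖deriv h y‖ with hM
  have hMb {x : ℝ} (hx : x ∈ Icc (x₀ - η) (x₀ + η)) : |deriv h x| ≤ M := hymax hx
  have hM0 : 0 ≤ M := norm_nonneg _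
  have hdist {x : ℝ} (hx : x ∈ Icc (x₀ - η) (x₀ + η)) : |x - x₀| ≤ η :=
    abs_le.2 ⟨by linarith [hx.1], by linarith [hx.2]⟩
  have hhb {x : ℝ} (hx : x ∈ Icc (x₀ - η) (x₀ + η)) : |h x| ≤ M * η := by
    have h1 := hh.mem.1.sub_eq_integral (subset_closure hx₀) (subset_closure (hIη hx))
    rw [hz, sub_zero] at h1
    rw [h1, ← Real.norm_eq_abs]
    refine (intervalIntegral.norm_integral_le_of_norm_le_const (C := M) fun t ht => ?_).trans ?_
    · exact hMb (huI hx (uIoc_subset_uIcc ht))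
    · exact mul_le_mul_of_nonneg_left (hdist hx) hM0
  have hint : |∫ t in x₀..y, quasiDensity V q μ h t| ≤ M * η * K + M * R * η := by
    have i1 : IntervalIntegrable (fun x => |V x + (q.s x - μ)|) volume x₀ y :=
      (hWi.intervalIntegrable_of_mem c.ordConnected_dom hx₀ (hIη hy)).abs
    rw [← Real.norm_eq_abs]
    have hpt : ∀ t ∈ uIoc x₀ y, ‖quasiDensity V q μ h t‖ ≤
        M * η * |V t + (q.s t - μ)| + M * R := fun t ht => by
      have htI := huI hy (uIoc_subset_uIcc ht)
      have e : quasiDensity V q μ h t = h t * (V t + (q.s t - μ)) + -(deriv h t * q.r t) := by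
        simp only [quasiDensity]
        ring
      rw [e]
      refine (norm_add_le _ _).trans ?_
      rw [norm_neg, norm_mul, norm_mul]
      have hRt := hR t (hII htI)
      exact add_le_add (mul_le_mul_of_nonneg_right (hhb htI) (norm_nonneg _))
        (mul_le_mul (hMb htI) hRt (norm_nonneg _) hM0)
    have i2 : IntegrableOn (fun t => M * η * |V t + (q.s t - μ)| + M * R) (uIoc x₀ y) :=
      (i1.def'.const_mul (M * η)).add (integrableOn_const (by simp [uIoc]))
    refine (intervalIntegral.norm_integral_le_integral_norm_uIoc).trans ?_
    have hqi := ((locallyIntegrableOn_quasiDensity (μ := μ) hV hq hh.mem).intervalIntegrable_of_mem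
      c.ordConnected_dom hx₀ (hIη hy)).def'.norm
    refine (setIntegral_mono_on hqi i2 measurableSet_uIoc hpt).trans ?_
    rw [integral_add (i1.def'.const_mul (M * η)) (integrableOn_const (by simp [uIoc])),
      setIntegral_const, integral_const_mul, smul_eq_mul]
    have hvol : volume.real (uIoc x₀ y) ≤ η := by
      refine le_trans (le_of_eq ?_) (hdist hy)
      simp [uIoc, Real.volume_real_Ioc, abs_sub_comm, max_sub_min_eq_abs]
    have hKle : ∫ t in uIoc x₀ y, |V t + (q.s t - μ)| ≤ K :=
      setIntegral_mono_set hWI.abs (ae_of_all _ fun _ => abs_nonneg _)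
        ((uIoc_subset_uIcc.trans (huI hy)).trans hII).eventuallyLE
    have hMR : 0 ≤ M * R := by positivity
    have hMη : 0 ≤ M * η := by positivity
    nlinarith [mul_le_mul_of_nonneg_left hvol hMR, mul_le_mul_of_nonneg_left hKle hMη]
  have hM1 : M ≤ 1 / 2 * M := by
    have h1 := hκ y (hIη hy)
    rw [zero_add] at h1
    have h2 : deriv h y = 2 * (h y * q.r y) + 2 * ∫ t in x₀..y, quasiDensity V q μ h t := by
      linarith
    have h3 : M ≤ 2 * (|h y| * |q.r y|) + 2 * |∫ t in x₀..y, quasiDensity V q μ h t| := by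
      rw [hM, h2, Real.norm_eq_abs]
      refine (abs_add_le _ _).trans (le_of_eq ?_)
      simp [abs_mul]
    have h4 : |h y| * |q.r y| ≤ M * η * R :=
      mul_le_mul (hhb hy) (hR y (hII hy)) (abs_nonneg _) (by positivity)
    have h5 := mul_le_mul_of_nonneg_left hηC hM0
    linarith
  have hMz : M = 0 := by linarith
  filter_upwards [Icc_mem_nhds (show x₀ - η < x₀ by linarith) (show x₀ < x₀ + η by linarith)]
    with x hx
  have := hhb hx
  rw [hMz, zero_mul] at this
  exact abs_nonpos_iff.1 this

/-- Uniqueness for the initial value problem: the set of points near which the solution vanishes is open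
and closed. -/
theorem IsWeakSolution.eqOn_zero (hV : c.IsPotential V) (hq : q.IsSmall c V)
    (h₀ : q.pt₀ ∈ c.dom → q.wt₀ = 0) (h₁ : q.pt₁ ∈ c.dom → q.wt₁ = 0)
    (hh : c.IsWeakSolution V q μ h) {x₀ : ℝ} (hx₀ : x₀ ∈ c.dom) (hz : h x₀ = 0)
    (hz' : deriv h x₀ = 0) : ∀ x ∈ c.dom, h x = 0 := by
  obtain ⟨hdc, hdiff, -⟩ := hh.regularity hV hq h₀ h₁ hx₀
  have hhc : ContinuousOn h c.dom := hh.mem.1.continuousOn.mono subset_closure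
  let Z : Set ℝ := {x | x ∈ c.dom ∧ ∀ᶠ y in 𝓝 x, h y = 0}
  have hZo : IsOpen Z := by
    rw [isOpen_iff_mem_nhds]
    rintro x ⟨hx, hxe⟩
    filter_upwards [c.isOpen_dom.mem_nhds hx, hxe.eventually_nhds] with y h1 h2 using ⟨h1, h2⟩
  have hsub : c.dom ⊆ Z := by
    refine c.ordConnected_dom.isPreconnected.subset_of_closure_inter_subset hZo
      ⟨x₀, hx₀, hx₀, hh.eventually_eq_zero hV hq h₀ h₁ hx₀ hz hz'⟩ ?_
    rintro x ⟨hxc, hx⟩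
    refine ⟨hx, hh.eventually_eq_zero hV hq h₀ h₁ hx ?_ ?_⟩
    · have := ((hhc.continuousAt (c.isOpen_dom.mem_nhds hx)).continuousWithinAt
        (s := Z)).mem_closure (t := {0}) hxc fun y hy => mem_singleton_iff.2 hy.2.self_of_nhds
      simpa using this
    · have := ((hdc.continuousAt (c.isOpen_dom.mem_nhds hx)).continuousWithinAt
        (s := Z)).mem_closure (t := {0}) hxc fun y hy => by
          have h1 : h =ᶠ[𝓝 y] fun _ => (0 : ℝ) := hy.2
          rw [mem_singleton_iff, h1.deriv_eq, deriv_const]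
      simpa using this
  exact fun x hx => (hsub hx).2.self_of_nhds

/-- Testing the equation for `u` with `φv` and the equation for `v` with `φu`, all terms cancel but
those with `φ'`. The cutoff `φ` need not vanish at the endpoints, so this includes the boundary
conditions. -/
theorem IsWeakSolution.integral_deriv_mul_wronskian {u v : ℝ → ℝ}
    (hu : c.IsWeakSolution V q μ u) (hv : c.IsWeakSolution V q μ v)
    {φ : ℝ → ℝ} {K : NNReal} {B : ℝ} (hφ : LipschitzWith K φ) (hB : ∀ x, |φ x| ≤ B) :
    ∫ x, deriv φ x * (v x * deriv u x - u x * deriv v x) ∂c.meas = 0 := by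
  have hφu := mul_mem_formDomain hφ hB hu.mem
  have hφv := mul_mem_formDomain hφ hB hv.mem
  have e1 := hu.eq _ hφv
  have e2 := hv.eq _ hφu
  have hdu := (lipschitz_locallyAC hφ).ae_deriv_mul hu.mem.1
  have hdv := (lipschitz_locallyAC hφ).ae_deriv_mul hv.mem.1
  have i1 : Integrable (fun x => deriv (φ * v) x * deriv u x) c.meas :=
    hφv.2.2.1.integrable_mul hu.mem.2.2.1
  have i2 : Integrable (fun x => deriv (φ * u) x * deriv v x) c.meas :=
    hφu.2.2.1.integrable_mul hv.mem.2.2.1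
  have a1 : ∫ x, deriv (φ * v) x * deriv u x ∂c.meas - ∫ x, deriv (φ * u) x * deriv v x ∂c.meas =
      ∫ x, deriv φ x * (v x * deriv u x - u x * deriv v x) ∂c.meas := by
    rw [← integral_sub i1 i2]
    apply integral_congr_ae
    filter_upwards [hdu, hdv] with x h1 h2
    rw [h1, h2]
    ring
  have a2 : ∫ x, (φ * v) x * u x * V x ∂c.meas = ∫ x, (φ * u) x * v x * V x ∂c.meas := by
    congr 1 with x
    simp only [Pi.mul_apply]
    ring
  have a3 : ∫ x, (deriv (φ * v) x * u x + (φ * v) x * deriv u x) * q.r x ∂c.meas =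
      ∫ x, (deriv (φ * u) x * v x + (φ * u) x * deriv v x) * q.r x ∂c.meas := by
    apply integral_congr_ae
    filter_upwards [hdu, hdv] with x h1 h2
    rw [h1, h2]
    simp only [Pi.mul_apply]
    ring
  have a4 : ∫ x, (φ * v) x * u x * q.s x ∂c.meas = ∫ x, (φ * u) x * v x * q.s x ∂c.meas := by
    congr 1 with x
    simp only [Pi.mul_apply]
    ring
  have a5 : ∫ x, (φ * v) x * u x ∂c.meas = ∫ x, (φ * u) x * v x ∂c.meas := by
    congr 1 with x
    simp only [Pi.mul_apply]
    ring
  rw [totalForm, principalForm, lowerForm, a2, a3, a4, a5] at e1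
  rw [totalForm, principalForm, lowerForm] at e2
  simp only [Pi.mul_apply] at e1 e2
  rw [← a1]
  linarith

/-- The Wronskian is continuous and has integral zero over each subinterval. -/
theorem IsWeakSolution.wronskian_eq_zero {u v : ℝ → ℝ} (hV : c.IsPotential V)
    (hq : q.IsSmall c V) (h₀ : q.pt₀ ∈ c.dom → q.wt₀ = 0) (h₁ : q.pt₁ ∈ c.dom → q.wt₁ = 0)
    (hu : c.IsWeakSolution V q μ u) (hv : c.IsWeakSolution V q μ v) {x : ℝ} (hx : x ∈ c.dom) :
    v x * deriv u x - u x * deriv v x = 0 := by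
  set W : ℝ → ℝ := fun x => v x * deriv u x - u x * deriv v x with hW
  have hWc : ContinuousOn W c.dom :=
    ((hv.mem.1.continuousOn.mono subset_closure).mul (hu.regularity hV hq h₀ h₁ hx).1).sub
      ((hu.mem.1.continuousOn.mono subset_closure).mul (hv.regularity hV hq h₀ h₁ hx).1)
  have hzero (s t : ℝ) (hs : s ∈ c.dom) (ht : t ∈ c.dom) (hst : s ≤ t) :
      ∫ y in s..t, W y = 0 := by
    -- The test function increases with slope one on `[s, t]` and is constant elsewhere.
    let φ : ℝ → ℝ := fun y => max s (min t y)
    have hφ : LipschitzWith 1 φ := (LipschitzWith.id.const_min t).const_max s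
    have hB (y : ℝ) : |φ y| ≤ max |s| |t| := by
      have h1 : s ≤ φ y := le_max_left _ _
      have h2 : φ y ≤ t := max_le hst (min_le_left _ _)
      exact abs_le_max_abs_abs h1 h2
    have hd1 (y : ℝ) (hy : y ∈ Ioo s t) : deriv φ y = 1 := by
      have : φ =ᶠ[𝓝 y] id := by
        filter_upwards [isOpen_Ioo.mem_nhds hy] with z hz
        simp only [φ, id]
        rw [min_eq_right hz.2.le, max_eq_right hz.1.le]
      rw [this.deriv_eq, deriv_id]
    have hd0 (y : ℝ) (hy : y ∉ Icc s t) : deriv φ y = 0 := by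
      have hn : (Icc s t)ᶜ ∈ 𝓝 y := isClosed_Icc.isOpen_compl.mem_nhds hy
      rcases lt_or_ge y s with h1 | h1
      · have : φ =ᶠ[𝓝 y] fun _ => s := by
          filter_upwards [Iio_mem_nhds h1] with z hz
          simp only [φ]
          exact max_eq_left ((min_le_right _ _).trans (le_of_lt hz))
        rw [this.deriv_eq, deriv_const]
      · have h2 : t < y := by
          by_contra h2
          exact hy ⟨h1, not_lt.1 h2⟩
        have : φ =ᶠ[𝓝 y] fun _ => t := by
          filter_upwards [Ioi_mem_nhds h2] with z hz
          simp only [φ]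
          rw [min_eq_left (le_of_lt hz), max_eq_right hst]
        rw [this.deriv_eq, deriv_const]
    have hI := hu.integral_deriv_mul_wronskian hv hφ hB
    have e := setIntegral_eq_intervalIntegral_of_eq_zero c.measurableSet_dom hst
      (c.ordConnected_dom.out hs ht) (φ := fun y => deriv φ y * W y) fun y _ hy => by
        rw [hd0 y hy, zero_mul]
    have e' : ∫ y in s..t, deriv φ y * W y = 0 := e.symm.trans hI
    rw [← e', intervalIntegral.integral_of_le hst, intervalIntegral.integral_of_le hst,
      integral_Ioc_eq_integral_Ioo, integral_Ioc_eq_integral_Ioo]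
    refine setIntegral_congr_fun measurableSet_Ioo fun y hy => ?_
    simp only [hd1 y hy, one_mul]
  have hderiv : HasDerivAt (fun y => ∫ t in x..y, W t) (W x) x :=
    intervalIntegral.integral_hasDerivAt_right (by simp)
      (hWc.stronglyMeasurableAtFilter c.isOpen_dom x hx)
      (hWc.continuousAt (c.isOpen_dom.mem_nhds hx))
  have hconst : (fun y => ∫ t in x..y, W t) =ᶠ[𝓝 x] fun _ => 0 := by
    filter_upwards [c.isOpen_dom.mem_nhds hx] with y hy
    rcases le_total x y with h | h
    · exact hzero x y hx hy h
    · rw [intervalIntegral.integral_symm, hzero y x hy hx h, neg_zero]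
  have := hderiv.deriv
  rw [hconst.deriv_eq, deriv_const] at this
  exact this.symm

/-- The eigenspaces are one-dimensional: the difference of `v` and the multiple of `u` with the same
value at `x₀` has vanishing derivative there too, as the Wronskian is zero. -/
theorem IsWeakSolution.exists_smul {u v : ℝ → ℝ} (hV : c.IsPotential V)
    (hq : q.IsSmall c V) (h₀ : q.pt₀ ∈ c.dom → q.wt₀ = 0) (h₁ : q.pt₁ ∈ c.dom → q.wt₁ = 0)
    (hu : c.IsWeakSolution V q μ u) (hv : c.IsWeakSolution V q μ v) {x₀ : ℝ} (hx₀ : x₀ ∈ c.dom)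
    (hne : u x₀ ≠ 0) : ∃ t : ℝ, ∀ x ∈ c.dom, v x = t * u x := by
  set t := v x₀ / u x₀ with ht
  have hw := hv.sub_smul hV hq hu t
  have hdw : deriv (v + (-t) • u) x₀ = deriv v x₀ - t * deriv u x₀ := by
    have h1 := (hv.regularity hV hq h₀ h₁ hx₀).2.1 x₀ hx₀
    have h2 := (hu.regularity hV hq h₀ h₁ hx₀).2.1 x₀ hx₀
    rw [deriv_add h1 (h2.const_smul _), deriv_const_smul_field]
    simp only [smul_eq_mul]
    ring
  have hW := hu.wronskian_eq_zero hV hq h₀ h₁ hv hx₀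
  refine ⟨t, fun x hx => ?_⟩
  have := hw.eqOn_zero hV hq h₀ h₁ hx₀ (by
    simp only [Pi.add_apply, Pi.smul_apply, smul_eq_mul, ht]
    field_simp
    ring) (by
    rw [hdw, ht]
    field_simp
    linarith) x hx
  simp only [Pi.add_apply, Pi.smul_apply, smul_eq_mul] at this
  linarith

theorem isWeakSolution_rep (hV : c.IsPotential V)
    {a : c.formSpace V →L[ℝ] c.formSpace V →L[ℝ] ℝ} (hsymm : ∀ u v, a u v = a v u)
    (ha : ∀ (f g : ℝ → ℝ) (hf : f ∈ c.formDomain V) (hg : g ∈ c.formDomain V),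
        a (toFormSpace f hf) (toFormSpace g hg) = c.totalForm V q f g)
    {p : c.formSpace V} (hp : IsWeakEigenvector (embed c V) a μ p) :
    c.IsWeakSolution V q μ (rep p) := by
  refine ⟨rep_mem p, fun f hf => ?_⟩
  have h1 := hp (toFormSpace f hf)
  rw [hsymm, L2_inner_eq] at h1
  rw [← ha f (rep p) hf (rep_mem p), toFormSpace_rep hV, h1]
  congr 1
  apply integral_congr_ae
  filter_upwards [embed_ae p, embed_toFormSpace_ae hf] with x h2 h3
  rw [h2, h3, mul_comm]

theorem hasSimpleEigenvalues (hV : c.IsPotential V) (hq : q.IsSmall c V)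
    (h₀ : q.pt₀ ∈ c.dom → q.wt₀ = 0) (h₁ : q.pt₁ ∈ c.dom → q.wt₁ = 0)
    {a : c.formSpace V →L[ℝ] c.formSpace V →L[ℝ] ℝ} (hsymm : ∀ u v, a u v = a v u)
    (ha : ∀ (f g : ℝ → ℝ) (hf : f ∈ c.formDomain V) (hg : g ∈ c.formDomain V),
        a (toFormSpace f hf) (toFormSpace g hg) = c.totalForm V q f g) :
    HasSimpleEigenvalues (embed c V) a := by
  intro μ p p' hp hp' hne
  have hu := isWeakSolution_rep hV hsymm ha hp
  have hv := isWeakSolution_rep hV hsymm ha hp'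
  obtain ⟨x₀, hx₀, hx⟩ : ∃ x ∈ c.dom, rep p x ≠ 0 := by
    by_contra! hcon
    apply hne
    apply embed_injective hV
    rw [map_zero]
    apply Lp.ext
    filter_upwards [embed_ae p, c.ae_mem_dom, Lp.coeFn_zero ℝ 2 c.meas] with x h1 h2 h3
    rw [h1, h3, hcon x h2, Pi.zero_apply]
  obtain ⟨t, ht⟩ := hu.exists_smul hV hq h₀ h₁ hv hx₀ hx
  refine ⟨t, embed_injective hV (Lp.ext ?_)⟩
  rw [map_smul]
  filter_upwards [embed_ae p, embed_ae p', c.ae_mem_dom, Lp.coeFn_smul t (embed c V p)]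
    with x h1 h2 h3 h4
  rw [h2, h4, Pi.smul_apply, h1, ht x h3, smul_eq_mul]

end Problem

end RandomSchrodinger

/-! ### Oscillation of the sample paths -/

section GaussianTail

/-- Fernique's theorem with constants independent of the space: a centered Gaussian measure which
gives the ball of radius `a` mass at least `3/4` has Gaussian tails on the scale `a`. -/
theorem exists_measure_norm_gt_le_of_isGaussian : ∃ κ > 0, ∃ K : ℝ, 0 ≤ K ∧
    ∀ (ι : Type) [Fintype ι] (ν : Measure (ι → ℝ)) [IsGaussian ν], ν[id] = 0 →
      ∀ a > 0, 3 / 4 ≤ ν {x | ‖x‖ ≤ a} → ∀ t ≥ 0,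
        ν {x | t < ‖x‖} ≤ ENNReal.ofReal (K * Real.exp (-(κ * (t / a) ^ 2))) := by
  have hgt : (2⁻¹ : ENNReal) < 3 / 4 := by
    rw [← ENNReal.toReal_lt_toReal (by simp) (ENNReal.div_ne_top (by simp) (by simp))]
    norm_num [ENNReal.toReal_div, ENNReal.toReal_inv]
  have hlt : (3 / 4 : ENNReal) < 1 := by
    rw [← ENNReal.toReal_lt_toReal (ENNReal.div_ne_top (by simp) (by simp)) (by simp)]
    norm_num [ENNReal.toReal_div]
  set κ := Fernique.logRatio (3 / 4) with hκ
  have hκ0 : 0 < κ := Fernique.logRatio_pos hgt hlt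
  set T : ENNReal := ENNReal.ofReal (Real.exp κ) + ∑' n : ℕ, ENNReal.ofReal
    (Real.exp (-2⁻¹ * Real.log ((3 / 4 : ENNReal) / (1 - 3 / 4)).toReal * 2 ^ n)) with hT
  have hTtop : T ≠ ⊤ := by
    refine (ENNReal.add_lt_top.mpr ⟨ENNReal.ofReal_lt_top, ?_⟩).ne
    refine Summable.tsum_ofReal_lt_top <|
      Real.summable_exp_nat_mul_of_ge ?_ (fun i => mod_cast (Nat.lt_pow_self (by simp)).le)
    have e : ((3 / 4 : ENNReal) / (1 - 3 / 4)).toReal = 3 := by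
      rw [ENNReal.toReal_div, ENNReal.toReal_sub_of_le hlt.le (by simp)]
      norm_num [ENNReal.toReal_div]
    rw [e]
    exact mul_neg_of_neg_of_pos (by norm_num) (Real.log_pos (by norm_num))
  refine ⟨κ, hκ0, T.toReal, ENNReal.toReal_nonneg, ?_⟩
  intro ι _ ν _ hν a ha hmass t ht
  have hint := lintegral_exp_mul_sq_norm_le_of_map_rotation_eq_self
    (IsGaussian.map_rotation_eq_self hν _) hmass hgt
  set e : ℝ := Real.exp (κ * (t / a) ^ 2) with he
  have he0 : 0 < e := Real.exp_pos _
  have hmarkov : ENNReal.ofReal e * ν {x | t < ‖x‖} ≤ T := by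
    refine le_trans ?_ hint
    refine le_trans ?_ (mul_meas_ge_le_lintegral₀ ?_ (ENNReal.ofReal e))
    · gcongr with x
      intro hx
      apply ENNReal.ofReal_le_ofReal
      apply Real.exp_le_exp.2
      rw [mul_assoc]
      apply mul_le_mul_of_nonneg_left _ hκ0.le
      rw [← mul_pow, div_eq_mul_inv, mul_comm]
      have hx' : t < ‖x‖ := hx
      gcongr
    · fun_prop
  have h1 : ν {x | t < ‖x‖} ≤ T / ENNReal.ofReal e := by
    rw [ENNReal.le_div_iff_mul_le (Or.inl (by simpa using he0)) (Or.inl ENNReal.ofReal_ne_top),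
      mul_comm]
    exact hmarkov
  refine h1.trans (le_of_eq ?_)
  rw [← ENNReal.ofReal_toReal hTtop, ENNReal.toReal_ofReal ENNReal.toReal_nonneg,
    ← ENNReal.ofReal_div_of_pos he0, he, Real.exp_neg, div_eq_mul_inv]

end GaussianTail

namespace RandomSchrodinger

namespace IsNoisePrimitive

variable {Ω : Type*} [MeasurableSpace Ω] {P : Measure Ω} {X : ℝ → Ω → ℝ}

/-- Increments from a point have Gaussian tails, uniformly in the point and over finite sets of
rationals of the unit interval. -/
theorem exists_tail_finset [IsProbabilityMeasure P] (hX : IsNoisePrimitive P X) :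
    ∃ κ > 0, ∃ K : ℝ, 0 ≤ K ∧
    ∀ (s : Finset ℝ), (∀ x ∈ s, x ∈ Icc (0 : ℝ) 1 ∩ range ((↑) : ℚ → ℝ)) → ∀ (n : ℝ), ∀ t ≥ 0,
      P {ω | ∃ x ∈ s, t < |X (x + n) ω - X n ω|} ≤
        ENNReal.ofReal (K * Real.exp (-(κ * t ^ 2))) := by
  obtain ⟨κ, hκ, K, hK, htail⟩ := exists_measure_norm_gt_le_of_isGaussian
  -- Sample paths are bounded on the unit interval, with large probability by a fixed constant.
  let D : Set ℝ := Icc (0 : ℝ) 1 ∩ range ((↑) : ℚ → ℝ)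
  let A : ℕ → Set Ω := fun m => {ω | ∀ x ∈ D, |X x ω - X 0 ω| ≤ m}
  have hAmono : Monotone A := fun m m' h ω hω x hx => (hω x hx).trans (Nat.cast_le.2 h)
  have hAunion : P (⋃ m, A m) = 1 := by
    have hae : (⋃ m, A m) =ᵐ[P] univ := by
      rw [eventuallyEq_univ]
      filter_upwards [hX.continuous] with ω hω
      obtain ⟨C, hC⟩ := isCompact_Icc.exists_bound_of_continuousOn
        (s := Icc (0 : ℝ) 1) (f := fun x => X x ω - X 0 ω)
        (hω.sub continuous_const).continuousOn
      obtain ⟨m, hm⟩ := exists_nat_ge C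
      exact mem_iUnion.2 ⟨m, fun x hx => (hC x hx.1).trans hm⟩
    rw [measure_congr hae, measure_univ]
  obtain ⟨m, hm⟩ : ∃ m, 3 / 4 ≤ P (A m) := by
    have hlt : (3 / 4 : ENNReal) < ⨆ m, P (A m) := by
      rw [← hAmono.measure_iUnion, hAunion,
        ← ENNReal.toReal_lt_toReal (ENNReal.div_ne_top (by simp) (by simp)) (by simp)]
      norm_num [ENNReal.toReal_div]
    obtain ⟨m, hm⟩ := lt_iSup_iff.1 hlt
    exact ⟨m, hm.le⟩
  set a : ℝ := m + 1 with ha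
  have ha0 : 0 < a := by positivity
  refine ⟨κ / a ^ 2, by positivity, K, hK, fun s hs n t ht => ?_⟩
  let Y : Ω → s → ℝ := fun ω x => X (x : ℝ) ω - X 0 ω
  have hYG : HasGaussianLaw Y P := by
    have := (hX.gaussian.shift 0).hasGaussianLaw s
    simp only [zero_add] at this
    exact this
  have hYm := hYG.aemeasurable
  have := hYG.isGaussian_map
  have hcent : (P.map Y)[id] = 0 := by
    rw [integral_map hYm (by fun_prop)]
    ext x
    have hint (x : ℝ) : Integrable (X x) P := (hX.gaussian.hasGaussianLaw_eval x).integrable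
    simp only [id_eq]
    rw [eval_integral (f := Y) fun x => (hint _).sub (hint _)]
    simp only [Y]
    rw [integral_sub (hint _) (hint _), hX.centered,
      hX.centered]
    simp
  have hmass : 3 / 4 ≤ (P.map Y) {y | ‖y‖ ≤ a} := by
    rw [Measure.map_apply_of_aemeasurable hYm (measurableSet_le measurable_norm measurable_const)]
    refine hm.trans (measure_mono fun ω hω => ?_)
    refine (pi_norm_le_iff_of_nonneg ha0.le).2 fun x => ?_
    rw [Real.norm_eq_abs]
    exact (hω x (hs x x.2)).trans (by linarith)
  have h1 := htail s (P.map Y) hcent a ha0 hmass t ht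
  have hms : MeasurableSet {y : s → ℝ | t < ‖y‖} :=
    measurableSet_lt measurable_const measurable_norm
  rw [Measure.map_apply_of_aemeasurable hYm hms] at h1
  have h2 := (hX.stationary n s).measure_mem_eq hms
  have h3 : {ω | ∃ x ∈ s, t < |X (x + n) ω - X n ω|} ⊆
      (fun ω (x : s) => X ((x : ℝ) + n) ω - X n ω) ⁻¹' {y | t < ‖y‖} := by
    rintro ω ⟨x, hx, hlt⟩
    exact hlt.trans_le (norm_le_pi_norm (fun x : s => X ((x : ℝ) + n) ω - X n ω) ⟨x, hx⟩)
  refine (measure_mono h3).trans ?_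
  rw [h2]
  refine h1.trans (le_of_eq ?_)
  congr 4
  field_simp

/-- The tail bound for the supremum of the increments over the rationals of the unit interval. -/
theorem exists_tail [IsProbabilityMeasure P] (hX : IsNoisePrimitive P X) :
    ∃ κ > 0, ∃ K : ℝ, 0 ≤ K ∧ ∀ (n : ℝ), ∀ t ≥ 0,
      P {ω | ∃ x ∈ Icc (0 : ℝ) 1 ∩ range ((↑) : ℚ → ℝ), t < |X (x + n) ω - X n ω|} ≤
        ENNReal.ofReal (K * Real.exp (-(κ * t ^ 2))) := by
  obtain ⟨κ, hκ, K, hK, htail⟩ := hX.exists_tail_finset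
  refine ⟨κ, hκ, K, hK, fun n t ht => ?_⟩
  have hcount : (Icc (0 : ℝ) 1 ∩ range ((↑) : ℚ → ℝ)).Countable :=
    (countable_range _).mono inter_subset_right
  have hne : (Icc (0 : ℝ) 1 ∩ range ((↑) : ℚ → ℝ)).Nonempty :=
    ⟨0, ⟨le_rfl, zero_le_one⟩, 0, Rat.cast_zero⟩
  obtain ⟨D, hD⟩ := hcount.exists_eq_range hne
  let B : ℕ → Set Ω := fun m =>
    {ω | ∃ x ∈ (Finset.range m).image D, t < |X (x + n) ω - X n ω|}
  have hB : Monotone B := by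
    rintro m m' hm ω ⟨x, hx, hlt⟩
    exact ⟨x, Finset.image_subset_image (Finset.range_mono hm) hx, hlt⟩
  have hsub : {ω | ∃ x ∈ Icc (0 : ℝ) 1 ∩ range ((↑) : ℚ → ℝ), t < |X (x + n) ω - X n ω|} ⊆
      ⋃ m, B m := by
    rintro ω ⟨x, hx, hlt⟩
    rw [hD] at hx
    obtain ⟨i, rfl⟩ := hx
    exact mem_iUnion.2 ⟨i + 1, D i, Finset.mem_image_of_mem D (by simp), hlt⟩
  refine (measure_mono hsub).trans ?_
  rw [hB.measure_iUnion]
  refine iSup_le fun m => htail _ (fun x hx => ?_) n t ht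
  obtain ⟨i, -, rfl⟩ := Finset.mem_image.1 hx
  rw [hD]
  exact mem_range_self i

/-- Almost surely, the increments from an integer `n` over a unit distance are of order
`√(log (3 + |n|))`, for all but finitely many `n`. -/
theorem ae_exists_finite [IsProbabilityMeasure P] (hX : IsNoisePrimitive P X) :
    ∃ C : ℝ, 0 ≤ C ∧ ∀ᵐ ω ∂P, {n : ℤ | ∃ x ∈ Icc (0 : ℝ) 1 ∩ range ((↑) : ℚ → ℝ),
      C * √(Real.log (3 + |(n : ℝ)|)) < |X (x + n) ω - X n ω|}.Finite := by
  obtain ⟨κ, hκ, K, hK, htail⟩ := hX.exists_tail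
  -- This constant makes the tail probabilities of order `n⁻²`, for the Borel–Cantelli lemma.
  refine ⟨√(2 / κ), Real.sqrt_nonneg _, ?_⟩
  refine ae_finite_setOfPred_mem (ι := ℤ) (s := fun n : ℤ => {ω | ∃ x ∈ Icc (0 : ℝ) 1 ∩
    range ((↑) : ℚ → ℝ), √(2 / κ) * √(Real.log (3 + |(n : ℝ)|)) < |X (x + n) ω - X n ω|}) ?_
  have hbound (n : ℤ) : K * Real.exp (-(κ * (√(2 / κ) * √(Real.log (3 + |(n : ℝ)|))) ^ 2)) ≤
      K * (3 + |(n : ℝ)|) ^ (-2 : ℤ) := by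
    have hpos : 0 < 3 + |(n : ℝ)| := by positivity
    have hlog : 0 ≤ Real.log (3 + |(n : ℝ)|) :=
      Real.log_nonneg (by linarith [abs_nonneg (n : ℝ)])
    rw [mul_pow, Real.sq_sqrt (by positivity), Real.sq_sqrt hlog]
    have e : -(κ * (2 / κ * Real.log (3 + |(n : ℝ)|))) = Real.log ((3 + |(n : ℝ)|) ^ (-2 : ℤ)) := by
      rw [Real.log_zpow]
      push_cast
      field_simp
    rw [e, Real.exp_log (by positivity)]
  have hsum : Summable fun n : ℤ => K * (3 + |(n : ℝ)|) ^ (-2 : ℤ) := by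
    refine Summable.mul_left K ?_
    have hnat : Summable fun n : ℕ => (3 + |(n : ℝ)|) ^ (-2 : ℤ) := by
      have h1 : Summable fun n : ℕ => 1 / ((n : ℝ) + 1) ^ 2 := by
        have := (summable_nat_add_iff 1).2 (Real.summable_one_div_nat_pow.2 one_lt_two)
        simpa using this
      refine h1.of_nonneg_of_le (fun n => by positivity) fun n => ?_
      rw [Nat.abs_cast, zpow_neg, ← one_div]
      apply one_div_le_one_div_of_le (by positivity)
      rw [zpow_ofNat]
      gcongr ?_ ^ 2
      linarith
    refine Summable.of_nat_of_neg ?_ ?_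
    · simpa using hnat
    · simpa using hnat
  have hle := ENNReal.tsum_le_tsum fun n : ℤ =>
    (htail n (√(2 / κ) * √(Real.log (3 + |(n : ℝ)|))) (by positivity)).trans
      (ENNReal.ofReal_le_ofReal (hbound n))
  exact ne_top_of_le_ne_top hsum.tsum_ofReal_ne_top hle

end IsNoisePrimitive

/-- If the increments of a continuous path over a unit distance from all but finitely many integers
are of order `√log`, then all of its increments over distances at most one are. -/
theorem exists_oscillation_bound {w : ℝ → ℝ} (hw : Continuous w) {C : ℝ} (hC : 0 ≤ C)
    (hfin : {n : ℤ | ∃ x ∈ Icc (0 : ℝ) 1 ∩ range ((↑) : ℚ → ℝ),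
      C * √(Real.log (3 + |(n : ℝ)|)) < |w (x + n) - w n|}.Finite) :
    ∃ C' : ℝ, 0 ≤ C' ∧ ∀ x : ℝ, ∀ y ∈ Icc (0 : ℝ) 1,
      |w (x + y) - w x| ≤ C' * √(Real.log (3 + |x|)) := by
  have hlog1 (x : ℝ) : 1 ≤ √(Real.log (3 + |x|)) := by
    rw [Real.one_le_sqrt, Real.le_log_iff_exp_le (by positivity)]
    linarith [Real.exp_one_lt_d9, abs_nonneg x]
  -- The rationals may be replaced by all reals, by continuity.
  have hdense (n : ℤ) {B : ℝ} (hB : ∀ x ∈ Icc (0 : ℝ) 1 ∩ range ((↑) : ℚ → ℝ),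
      |w (x + n) - w n| ≤ B) : ∀ x ∈ Icc (0 : ℝ) 1, |w (x + n) - w n| ≤ B := by
    have hcl : IsClosed {x : ℝ | |w (x + n) - w n| ≤ B} :=
      isClosed_le (by fun_prop) continuous_const
    have hIoo : Ioo (0 : ℝ) 1 ⊆ closure (Ioo (0 : ℝ) 1 ∩ range ((↑) : ℚ → ℝ)) :=
      Rat.denseRange_cast.open_subset_closure_inter isOpen_Ioo
    intro x hx
    rw [← closure_Ioo (zero_ne_one' ℝ)] at hx
    have h1 : x ∈ closure (Ioo (0 : ℝ) 1 ∩ range ((↑) : ℚ → ℝ)) :=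
      closure_minimal hIoo isClosed_closure hx
    exact closure_minimal (fun y hy => hB y ⟨Ioo_subset_Icc_self hy.1, hy.2⟩) hcl h1
  have hcpt (n : ℤ) : ∃ B, ∀ x ∈ Icc (0 : ℝ) 1, |w (x + n) - w n| ≤ B :=
    isCompact_Icc.exists_bound_of_continuousOn (f := fun x => w (x + n) - w n) (by fun_prop)
  choose B hB using hcpt
  set F := hfin.toFinset with hF
  set M := C + ∑ n ∈ F, |B n| with hM
  have hM0 : 0 ≤ M := add_nonneg hC (Finset.sum_nonneg fun _ _ => abs_nonneg _)
  have hint (n : ℤ) : ∀ x ∈ Icc (0 : ℝ) 1,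
      |w (x + n) - w n| ≤ M * √(Real.log (3 + |(n : ℝ)|)) := by
    have h1 := hlog1 n
    by_cases hn : n ∈ F
    · intro x hx
      have h2 : |B n| ≤ ∑ n ∈ F, |B n| :=
        Finset.single_le_sum (f := fun n => |B n|) (fun _ _ => abs_nonneg _) hn
      have h3 := (hB n x hx).trans (le_abs_self _)
      nlinarith
    · apply hdense
      intro x hx
      have h2 : ¬ C * √(Real.log (3 + |(n : ℝ)|)) < |w (x + n) - w n| := fun hlt =>
        hn (hfin.mem_toFinset.2 ⟨x, hx, hlt⟩)
      refine (not_lt.1 h2).trans (mul_le_mul_of_nonneg_right ?_ (by positivity))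
      exact le_add_of_nonneg_right (Finset.sum_nonneg fun _ _ => abs_nonneg _)
  have hcomp (x : ℝ) (n : ℤ) (hn : |(n : ℝ)| ≤ |x| + 1) :
      √(Real.log (3 + |(n : ℝ)|)) ≤ 2 * √(Real.log (3 + |x|)) := by
    rw [← Real.sqrt_sq (zero_le_two (α := ℝ)), ← Real.sqrt_mul (by positivity)]
    apply Real.sqrt_le_sqrt
    have hx := abs_nonneg x
    have hl : 0 ≤ Real.log (3 + |x|) := Real.log_nonneg (by linarith)
    have h1 : Real.log (3 + |(n : ℝ)|) ≤ Real.log ((3 + |x|) ^ 2) := by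
      apply Real.log_le_log (by positivity)
      nlinarith
    rw [Real.log_pow] at h1
    push_cast at h1
    linarith
  refine ⟨6 * M, by positivity, fun x y hy => ?_⟩
  set n := ⌊x⌋ with hn
  have hn1 : (n : ℝ) ≤ x := Int.floor_le x
  have hn2 : x < n + 1 := Int.lt_floor_add_one x
  have habs : |(n : ℝ)| ≤ |x| + 1 := by
    rw [abs_le]
    constructor <;> linarith [neg_abs_le x, le_abs_self x]
  have habs' : |((n + 1 : ℤ) : ℝ)| ≤ |x| + 1 := by
    push_cast
    rw [abs_le]
    constructor <;> linarith [neg_abs_le x, le_abs_self x]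
  have b0 := mul_le_mul_of_nonneg_left (hcomp x n habs) hM0
  have b1 := mul_le_mul_of_nonneg_left (hcomp x (n + 1) habs') hM0
  have c0 := hint n (x - n) ⟨by linarith, by linarith⟩
  rw [sub_add_cancel] at c0
  have hs : 0 ≤ M * √(Real.log (3 + |x|)) := by positivity
  rcases le_or_gt (x + y) (n + 1) with h | h
  · have c1 := hint n (x + y - n) ⟨by linarith [hy.1], by linarith⟩
    rw [sub_add_cancel] at c1
    rw [abs_le] at c0 c1 ⊢
    constructor <;> linarith [c0.1, c0.2, c1.1, c1.2]
  · have c1 := hint (n + 1) (x + y - (n + 1 : ℤ)) ⟨by push_cast; linarith,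
      by push_cast; linarith [hy.2]⟩
    rw [sub_add_cancel] at c1
    have c2 := hint n 1 ⟨zero_le_one, le_rfl⟩
    have e : w ((n + 1 : ℤ) : ℝ) = w (1 + (n : ℝ)) := by
      push_cast
      rw [add_comm]
    rw [e] at c1
    rw [abs_le] at c0 c1 c2 ⊢
    constructor <;> linarith [c0.1, c0.2, c1.1, c1.2, c2.1, c2.2]

/-- Almost surely, the path is continuous, and its increments over distances at most one are of order
`√log`. No other property of the noise is used. -/
theorem IsNoisePrimitive.ae_path {Ω : Type*} [MeasurableSpace Ω] {P : Measure Ω}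
    [IsProbabilityMeasure P] {X : ℝ → Ω → ℝ} (hX : IsNoisePrimitive P X) :
    ∀ᵐ ω ∂P, Continuous (fun x => X x ω) ∧ ∃ C : ℝ, 0 ≤ C ∧ ∀ x : ℝ, ∀ y ∈ Icc (0 : ℝ) 1,
      |X (x + y) ω - X x ω| ≤ C * √(Real.log (3 + |x|)) := by
  obtain ⟨C, hC, hfin⟩ := hX.ae_exists_finite
  filter_upwards [hX.continuous, hfin] with ω h1 h2
  exact ⟨h1, exists_oscillation_bound h1 hC h2⟩

end RandomSchrodinger

/-! ### The noise form as a lower order form -/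

namespace RandomSchrodinger

/-- The average of `w` over the interval of length one to the right of a point. -/
noncomputable def unitAverage (w : ℝ → ℝ) (x : ℝ) : ℝ := (∫ t in 0..(x + 1), w t) - ∫ t in 0..x, w t

variable {w : ℝ → ℝ}

theorem hasDerivAt_unitAverage (hw : Continuous w) (x : ℝ) :
    HasDerivAt (unitAverage w) (w (x + 1) - w x) x := by
  have h (y : ℝ) : HasDerivAt (fun u => ∫ t in 0..u, w t) (w y) y :=
    intervalIntegral.integral_hasDerivAt_right (hw.intervalIntegrable _ _)
      (hw.stronglyMeasurableAtFilter _ _) hw.continuousAt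
  exact ((h (x + 1)).comp_add_const x 1).sub (h x)

theorem contDiff_unitAverage (hw : Continuous w) : ContDiff ℝ 1 (unitAverage w) := by
  rw [contDiff_one_iff_deriv]
  refine ⟨fun x => (hasDerivAt_unitAverage hw x).differentiableAt, ?_⟩
  rw [funext fun x => (hasDerivAt_unitAverage hw x).deriv]
  fun_prop

theorem abs_sub_unitAverage_le (hw : Continuous w) {x B : ℝ}
    (hB : ∀ y ∈ Icc (0 : ℝ) 1, |w (x + y) - w x| ≤ B) : |w x - unitAverage w x| ≤ B := by
  have e1 : unitAverage w x = ∫ y in (0 : ℝ)..1, w (x + y) := by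
    rw [intervalIntegral.integral_comp_add_left, add_zero, unitAverage,
      intervalIntegral.integral_interval_sub_left (hw.intervalIntegrable _ _)
        (hw.intervalIntegrable _ _)]
  have e2 : w x - unitAverage w x = ∫ y in (0 : ℝ)..1, (w x - w (x + y)) := by
    have hc : Continuous fun y => w (x + y) := by fun_prop
    rw [intervalIntegral.integral_sub (by simp) (hc.intervalIntegrable _ _), e1]
    simp
  rw [e2, ← Real.norm_eq_abs]
  refine (intervalIntegral.norm_integral_le_of_norm_le_const (C := B) fun y hy => ?_).trans
    (by simp)
  rw [uIoc_of_le zero_le_one] at hy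
  rw [Real.norm_eq_abs, abs_sub_comm]
  exact hB y ⟨hy.1.le, hy.2⟩

namespace Problem

variable {c : Problem} {V f g : ℝ → ℝ}

/-- On an unbounded interval, an element of the form core vanishes outside a compact interval, which
begins at the finite endpoint of the domain if there is one. -/
theorem exists_Icc_of_mem_formCore (hc : c.dom = univ ∨ c.dom = Ioi 0) (hf : f ∈ c.formCore V) :
    ∃ a b, a ≤ b ∧ a ∈ closure c.dom ∧ b ∈ closure c.dom ∧
      (∀ x ∈ closure c.dom, x ∉ Icc a b → f x = 0 ∧ deriv f x = 0) ∧ f b = 0 ∧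
      ((c.dom = univ ∧ f a = 0) ∨ (c.dom = Ioi 0 ∧ a = 0)) := by
  obtain ⟨-, R, hR⟩ := hf
  have hvan (x : ℝ) (hx : x ∈ c.dom) (hxR : R < |x|) : f x = 0 ∧ deriv f x = 0 := by
    refine ⟨hR x hx hxR, ?_⟩
    have : f =ᶠ[𝓝 x] fun _ => 0 := by
      filter_upwards [c.isOpen_dom.mem_nhds hx,
        (isOpen_lt continuous_const continuous_abs).mem_nhds hxR] with y h1 h2 using hR y h1 h2
    rw [this.deriv_eq, deriv_const]
  have hRR : R < |R| + 1 := by linarith [le_abs_self R]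
  have hR0 : 0 < |R| + 1 := by positivity
  rcases hc with hc | hc
  · refine ⟨-(|R| + 1), |R| + 1, by linarith, by simp [hc], by simp [hc], fun x _ hx => ?_, ?_,
      Or.inl ⟨hc, ?_⟩⟩
    · refine hvan x (by simp [hc]) (hRR.trans ?_)
      rw [mem_Icc, ← abs_le, not_le] at hx
      exact hx
    · exact hR _ (by simp [hc]) (by rwa [abs_of_pos hR0])
    · exact hR _ (by simp [hc]) (by rwa [abs_neg, abs_of_pos hR0])
  · refine ⟨0, |R| + 1, hR0.le, by simp [hc], by simp [hc, hR0.le], fun x hxc hx => ?_, ?_,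
      Or.inr ⟨hc, rfl⟩⟩
    · have hx0 : (0 : ℝ) ≤ x := by simpa [hc] using hxc
      have hx1 : |R| + 1 < x := by
        by_contra h
        exact hx ⟨hx0, not_lt.1 h⟩
      exact hvan x (by rw [hc]; exact hR0.trans hx1) (by rw [abs_of_nonneg hx0]; linarith)
    · exact hR _ (by rw [hc]; exact hR0) (by rwa [abs_of_pos hR0])

open Classical in
/-- Integration by parts replaces the path in the noise form by its deviation from a smooth
function. -/
theorem neg_integral_eq_of_contDiff (hc : c.dom = univ ∨ c.dom = Ioi 0) (hf : f ∈ c.formCore V)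
    (hg : g ∈ c.formDomain V) (hw : Continuous w) {W : ℝ → ℝ} (hW : ContDiff ℝ 1 W) :
    -(∫ x, (deriv f x * g x + f x * deriv g x) * w x ∂c.meas) =
      -(∫ x, (deriv f x * g x + f x * deriv g x) * (w x - W x) ∂c.meas)
        + (∫ x, f x * g x * deriv W x ∂c.meas)
        + (if c.dom = univ then 0 else W 0) * (f 0 * g 0) := by
  obtain ⟨a, b, hab, ha, hb, hz, hfb, hcase⟩ := exists_Icc_of_mem_formCore hc hf
  have hI : Icc a b ⊆ closure c.dom := uIcc_of_le hab ▸ uIcc_subset_closure ha hb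
  have hconv (φ : ℝ → ℝ) (hφ : ∀ x, f x = 0 → deriv f x = 0 → φ x = 0) :
      ∫ x, φ x ∂c.meas = ∫ x in a..b, φ x := by
    rw [meas_eq_restrict_closure]
    exact setIntegral_eq_intervalIntegral_of_eq_zero isClosed_closure.measurableSet hab hI
      fun x hx hx' => hφ x (hz x hx hx').1 (hz x hx hx').2
  have hu : IntervalIntegrable (fun x => deriv f x * g x + f x * deriv g x) volume a b := by
    rw [intervalIntegrable_iff]
    have h1 : Integrable (fun x => deriv f x * g x) c.meas :=
      hf.1.2.2.1.integrable_mul hg.2.1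
    have h2 : Integrable (fun x => f x * deriv g x) c.meas :=
      hf.1.2.1.integrable_mul hg.2.2.1
    exact (h1.add h2).mono_measure (restrict_uIoc_le_meas ha hb)
  have hparts := ((hf.1.1 a ha b hb).mul (hg.1 a ha b hb)).integral_deriv_mul_eq_sub
    (hW.contDiffOn.absolutelyContinuousOnInterval (a := a) (b := b))
  have hfg : ∫ x in a..b, deriv (f * g) x * W x + (f * g) x * deriv W x =
      ∫ x in a..b, (deriv f x * g x + f x * deriv g x) * W x + f x * g x * deriv W x := by
    apply intervalIntegral.integral_congr_ae_restrict
    filter_upwards [ae_mono (restrict_uIoc_le_meas ha hb) (hf.1.1.ae_deriv_mul hg.1)] with x hx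
    rw [hx, Pi.mul_apply]
  have hfgc : ContinuousOn (fun x => f x * g x) (uIcc a b) :=
    (hf.1.1.continuousOn.mul hg.1.continuousOn).mono (uIcc_subset_closure ha hb)
  have i1 := hu.mul_continuousOn hW.continuous.continuousOn
  have i2 : IntervalIntegrable (fun x => f x * g x * deriv W x) volume a b :=
    (hfgc.mul (hW.continuous_deriv le_rfl).continuousOn).intervalIntegrable
  rw [hfg, intervalIntegral.integral_add i1 i2, Pi.mul_apply, hfb] at hparts
  have hbdry : (f * g) a * W a = (if c.dom = univ then 0 else W 0) * (f 0 * g 0) := by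
    rcases hcase with ⟨h1, h2⟩ | ⟨h1, h2⟩
    · rw [if_pos h1, Pi.mul_apply, h2]
      ring
    · have h3 : c.dom ≠ univ := by
        rw [h1]
        exact fun h => absurd (h ▸ mem_univ (0 : ℝ) : (0 : ℝ) ∈ Ioi (0 : ℝ)) (by simp)
      rw [if_neg h3, h2, Pi.mul_apply]
      ring
  have hsub : ∫ x in a..b, (deriv f x * g x + f x * deriv g x) * (w x - W x) =
      (∫ x in a..b, (deriv f x * g x + f x * deriv g x) * w x) -
        ∫ x in a..b, (deriv f x * g x + f x * deriv g x) * W x := by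
    rw [← intervalIntegral.integral_sub (hu.mul_continuousOn hw.continuousOn) i1]
    congr 1 with x
    ring
  rw [hconv _ fun x h1 h2 => by rw [h1, h2]; ring, hconv _ fun x h1 h2 => by rw [h1, h2]; ring,
    hconv _ fun x h1 h2 => by rw [h1]; ring, hsub, ← hbdry]
  linarith

/-- On a bounded interval, bounds relative to the potential hold for continuous functions. -/
theorem exists_le_of_isBounded (hV : c.IsPotential V) {b : ℝ} (hc : closure c.dom = Icc 0 b)
    {φ : ℝ → ℝ} (hφ : Continuous φ) {ε : ℝ} (hε : 0 < ε) :
    ∃ C, ∀ x ∈ c.dom, φ x ≤ ε * V x + C := by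
  obtain ⟨C, hC⟩ := isCompact_Icc.exists_bound_of_continuousOn (s := Icc 0 b) hφ.continuousOn
  refine ⟨C, fun x hx => ?_⟩
  have h1 := (le_abs_self _).trans (hC x (hc ▸ subset_closure hx))
  have h2 := hV.nonneg x hx
  nlinarith [mul_nonneg hε.le h2]

/-- On a bounded interval the path itself is a bounded coefficient. -/
theorem isSmall_of_isBounded (hV : c.IsPotential V) {b : ℝ} (hb : 0 < b)
    (hc : closure c.dom = Icc 0 b) (hw : Continuous w) (t₀ t₁ : ℝ) :
    (LowerOrder.mk w 0 0 b t₀ t₁).IsSmall c V where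
  continuous_r := hw
  continuous_s := continuous_const
  mem₀ := hc ▸ left_mem_Icc.2 hb.le
  mem₁ := hc ▸ right_mem_Icc.2 hb.le
  r_le _ hε := exists_le_of_isBounded hV hc (hw.pow 2) hε
  s_le _ hε := exists_le_of_isBounded hV hc continuous_const.abs hε

/-- The deviation of the path from its unit average, and the derivative of that average, are of order
`√log`, so their squares are small relative to the potential. -/
theorem isSmall_of_oscillation (hV : c.IsPotential V) (hc : (0 : ℝ) ∈ closure c.dom)
    (hw : Continuous w) {C : ℝ}
    (hosc : ∀ x : ℝ, ∀ y ∈ Icc (0 : ℝ) 1, |w (x + y) - w x| ≤ C * √(Real.log (3 + |x|)))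
    (t₀ t₁ : ℝ) :
    (LowerOrder.mk (fun x => w x - unitAverage w x) (deriv (unitAverage w)) 0 0 t₀ t₁).IsSmall
      c V where
  continuous_r := hw.sub (contDiff_unitAverage hw).continuous
  continuous_s := (contDiff_unitAverage hw).continuous_deriv le_rfl
  mem₀ := hc
  mem₁ := hc
  r_le ε hε := by
    obtain ⟨K, hK⟩ := hV.exists_log_add_le (ε := ε / (C ^ 2 + 1)) (by positivity)
    refine ⟨C ^ 2 * K, fun x hx => ?_⟩
    have h1 := abs_sub_unitAverage_le hw (hosc x)
    have hlog : 0 ≤ Real.log (3 + |x|) := Real.log_nonneg (by linarith [abs_nonneg x])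
    have hVx := hV.nonneg x hx
    have h3 : C ^ 2 * (ε / (C ^ 2 + 1) * V x) ≤ ε * V x := by
      have h4 : C ^ 2 * (ε / (C ^ 2 + 1)) ≤ ε := by
        rw [mul_div_assoc', div_le_iff₀ (by positivity)]
        nlinarith
      nlinarith
    calc (w x - unitAverage w x) ^ 2 ≤ (C * √(Real.log (3 + |x|))) ^ 2 := by
          rw [← sq_abs]
          gcongr
      _ = C ^ 2 * Real.log (3 + |x|) := by rw [mul_pow, Real.sq_sqrt hlog]
      _ ≤ C ^ 2 * (ε / (C ^ 2 + 1) * V x + K) := by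
          gcongr
          exact hK x hx
      _ ≤ ε * V x + C ^ 2 * K := by linarith
  s_le ε hε := by
    obtain ⟨K, hK⟩ := hV.exists_log_add_le (ε := ε / (|C| + 1)) (by positivity)
    refine ⟨|C| * (1 + K), fun x hx => ?_⟩
    have h1 := hosc x 1 ⟨zero_le_one, le_rfl⟩
    have hlog : 0 ≤ Real.log (3 + |x|) := Real.log_nonneg (by linarith [abs_nonneg x])
    have hVx := hV.nonneg x hx
    have hsqrt : √(Real.log (3 + |x|)) ≤ 1 + Real.log (3 + |x|) := by
      nlinarith [Real.sq_sqrt hlog, sq_nonneg (√(Real.log (3 + |x|)) - 1)]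
    have h3 : |C| * (ε / (|C| + 1) * V x) ≤ ε * V x := by
      have h4 : |C| * (ε / (|C| + 1)) ≤ ε := by
        rw [mul_div_assoc', div_le_iff₀ (by positivity)]
        nlinarith [abs_nonneg C]
      nlinarith
    calc |deriv (unitAverage w) x| ≤ C * √(Real.log (3 + |x|)) := by
          rw [(hasDerivAt_unitAverage hw x).deriv]
          exact h1
      _ ≤ |C| * √(Real.log (3 + |x|)) := by
          gcongr
          exact le_abs_self C
      _ ≤ |C| * (1 + (ε / (|C| + 1) * V x + K)) := by
          gcongr
          exact hsqrt.trans (by linarith [hK x hx])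
      _ ≤ ε * V x + |C| * (1 + K) := by linarith

/-- The noise form is a lower order form `q` on the form core, and adding the deterministic boundary
terms changes the weights of the point evaluations only, which gives `q'`. These weights are zero
except at endpoints of the interval. -/
theorem exists_lowerOrder (hV : c.IsPotential V) (hw : Continuous w) {C : ℝ}
    (hosc : ∀ x : ℝ, ∀ y ∈ Icc (0 : ℝ) 1, |w (x + y) - w x| ≤ C * √(Real.log (3 + |x|))) :
    ∃ q q' : LowerOrder, q.IsSmall c V ∧ q'.IsSmall c V ∧
      (∀ f ∈ c.formCore V, ∀ g ∈ c.formCore V, c.noiseFormula w f g = c.lowerForm q f g) ∧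
      (∀ f g, c.energy V f g + c.lowerForm q f g = c.totalForm V q' f g) ∧
      (q'.pt₀ ∈ c.dom → q'.wt₀ = 0) ∧ (q'.pt₁ ∈ c.dom → q'.wt₁ = 0) := by
  cases c with
  | line =>
    have hc : line.dom = univ := rfl
    refine ⟨_, _, isSmall_of_oscillation hV (by simp [hc]) hw hosc 0 0,
      isSmall_of_oscillation hV (by simp [hc]) hw hosc 0 0, fun f hf g hg => ?_, fun f g => ?_,
      by simp, by simp⟩
    · rw [noiseFormula, neg_integral_eq_of_contDiff (Or.inl hc) hf hg.1 hw
        (contDiff_unitAverage hw), if_pos hc, lowerForm, noiseBoundaryTerm]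
      ring
    · rw [energy, totalForm, principalForm, boundaryTerm]
      ring
  | halfDirichlet =>
    have hc : halfDirichlet.dom = Ioi 0 := rfl
    have hc' : halfDirichlet.dom ≠ univ := fun h =>
      absurd (h ▸ mem_univ (0 : ℝ) : (0 : ℝ) ∈ halfDirichlet.dom) (by simp [hc])
    refine ⟨_, _, isSmall_of_oscillation hV (by simp [hc]) hw hosc (unitAverage w 0) 0,
      isSmall_of_oscillation hV (by simp [hc]) hw hosc (unitAverage w 0) 0,
      fun f hf g hg => ?_, fun f g => ?_, by simp [hc], by simp⟩
    · rw [noiseFormula, neg_integral_eq_of_contDiff (Or.inr hc) hf hg.1 hw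
        (contDiff_unitAverage hw), if_neg hc', lowerForm, noiseBoundaryTerm]
      ring
    · rw [energy, totalForm, principalForm, boundaryTerm]
      ring
  | halfRobin α =>
    have hc : (halfRobin α).dom = Ioi 0 := rfl
    have hc' : (halfRobin α).dom ≠ univ := fun h =>
      absurd (h ▸ mem_univ (0 : ℝ) : (0 : ℝ) ∈ (halfRobin α).dom) (by simp [hc])
    refine ⟨_, _, isSmall_of_oscillation hV (by simp [hc]) hw hosc (unitAverage w 0) 0,
      isSmall_of_oscillation hV (by simp [hc]) hw hosc (unitAverage w 0 - α / 2) 0,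
      fun f hf g hg => ?_, fun f g => ?_, by simp [hc], by simp⟩
    · rw [noiseFormula, neg_integral_eq_of_contDiff (Or.inr hc) hf hg.1 hw
        (contDiff_unitAverage hw), if_neg hc', lowerForm, noiseBoundaryTerm]
      ring
    · rw [energy, totalForm, principalForm, boundaryTerm, lowerForm, lowerForm]
      ring
  | intervalDirichlet b hb =>
    have hc : closure (intervalDirichlet b hb).dom = Icc 0 b := closure_Ioo hb.ne
    refine ⟨_, _, isSmall_of_isBounded hV hb hc hw 0 0, isSmall_of_isBounded hV hb hc hw 0 0,
      fun f hf g hg => ?_, fun f g => ?_, by simp, by simp⟩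
    · simp [noiseFormula, noiseBoundaryTerm, lowerForm]
    · rw [energy, totalForm, principalForm, boundaryTerm]
      ring
  | intervalRobin b hb α β =>
    have hc : closure (intervalRobin b hb α β).dom = Icc 0 b := closure_Ioo hb.ne
    refine ⟨_, _, isSmall_of_isBounded hV hb hc hw 0 (w b),
      isSmall_of_isBounded hV hb hc hw (-(α / 2)) (w b - β / 2),
      fun f hf g hg => ?_, fun f g => ?_, by simp [dom], by simp [dom]⟩
    · simp [noiseFormula, noiseBoundaryTerm, lowerForm, mul_comm]
    · rw [energy, totalForm, principalForm, boundaryTerm, lowerForm, lowerForm]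
      ring
  | intervalMixed b hb α =>
    have hc : closure (intervalMixed b hb α).dom = Icc 0 b := closure_Ioo hb.ne
    refine ⟨_, _, isSmall_of_isBounded hV hb hc hw 0 0,
      isSmall_of_isBounded hV hb hc hw (-(α / 2)) 0,
      fun f hf g hg => ?_, fun f g => ?_, by simp [dom], by simp⟩
    · simp [noiseFormula, noiseBoundaryTerm, lowerForm]
    · rw [energy, totalForm, principalForm, boundaryTerm, lowerForm, lowerForm]
      ring

end Problem

end RandomSchrodinger

/-! ### The operator of the perturbed form -/

namespace RandomSchrodinger

namespace Problem

variable {c : Problem} {V w f g : ℝ → ℝ} {a : c.formSpace V →L[ℝ] c.formSpace V →L[ℝ] ℝ} {m : ℝ}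
  {ev : ℕ → ℝ} {ψ : ℕ → c.L2} {e : ℕ → c.formSpace V}

theorem embed_toFormSpace_eq (hf : f ∈ c.formDomain V) {u : c.L2} (h : f =ᵐ[c.meas] u) :
    embed c V (toFormSpace f hf) = u :=
  Lp.ext ((embed_toFormSpace_ae hf).trans h)

theorem inner_embed_toFormSpace (hf : f ∈ c.formDomain V) (u : c.L2) :
    inner ℝ (embed c V (toFormSpace f hf)) u = ∫ x, f x * u x ∂c.meas := by
  rw [L2_inner_eq]
  apply integral_congr_ae
  filter_upwards [embed_toFormSpace_ae hf] with x hx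
  rw [hx]

theorem norm_sq_embed_toFormSpace (hf : f ∈ c.formDomain V) :
    ‖embed c V (toFormSpace f hf)‖ ^ 2 = ∫ x, f x ^ 2 ∂c.meas := by
  rw [L2_norm_sq_eq, integral_sq_congr (embed_toFormSpace_ae hf)]

variable [CompleteSpace (c.formSpace V)]

/-- The operator of the abstract form is an operator of the perturbed form. -/
theorem isFormOperator_operator (h : IsCoerciveForm (embed c V) a m)
    (ha : ∀ (f g : ℝ → ℝ) (hf : f ∈ c.formDomain V) (hg : g ∈ c.formDomain V),
      a (toFormSpace f hf) (toFormSpace g hg) = c.form V w f g) :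
    c.IsFormOperator V w h.operator where
  dense := h.dense_operator_domain
  selfAdjoint := h.isSelfAdjoint_operator
  domain_le u hu := by
    obtain ⟨p, hp⟩ := h.exists_of_mem_domain ⟨u, hu⟩
    refine ⟨rep p, rep_mem p, (embed_ae p).symm.trans ?_⟩
    rw [hp]
  form_eq f hf g hg u hgu := by
    rw [← ha f g hf hg, h.form_eq_inner_operator _ _ u (embed_toFormSpace_eq hg hgu),
      inner_embed_toFormSpace]

/-- The perturbed form has no other self-adjoint operator. -/
theorem eq_operator_of_isFormOperator (hV : c.IsPotential V) (h : IsCoerciveForm (embed c V) a m)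
    (ha : ∀ (f g : ℝ → ℝ) (hf : f ∈ c.formDomain V) (hg : g ∈ c.formDomain V),
      a (toFormSpace f hf) (toFormSpace g hg) = c.form V w f g)
    {A : c.L2 →ₗ.[ℝ] c.L2} (hA : c.IsFormOperator V w A) : A = h.operator := by
  refine h.eq_operator A hA.selfAdjoint (fun x => ?_) fun p u x hx => ?_
  · obtain ⟨f, hf, hfx⟩ := hA.domain_le x x.2
    exact ⟨toFormSpace f hf, embed_toFormSpace_eq hf hfx⟩
  · have hu : rep u =ᵐ[c.meas] (x : c.L2) := by
      rw [← hx]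
      exact (embed_ae u).symm
    rw [← toFormSpace_rep hV p, ← toFormSpace_rep hV u, ha _ _ (rep_mem p) (rep_mem u),
      hA.form_eq _ (rep_mem p) _ (rep_mem u) x hu, inner_embed_toFormSpace]

theorem isEigenEnumeration_of_weak (h : IsCoerciveForm (embed c V) a m)
    (he : IsWeakEigenEnumeration (embed c V) a ev e) :
    c.IsEigenEnumeration h.operator ev fun k => embed c V (e k) where
  mono := he.mono
  eigen k := h.operator_of_isWeakEigenvector (he.eigen k)
  norm_one := he.norm_one
  orthogonal := he.orthogonal
  exhaust μ u hu := by
    obtain ⟨p, hp⟩ := h.exists_of_mem_domain u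
    rw [← hp]
    exact he.exhaust μ p (h.isWeakEigenvector_of_operator hp hu)

theorem IsEigenEnumeration.exists_weak (h : IsCoerciveForm (embed c V) a m)
    (hψ : c.IsEigenEnumeration h.operator ev ψ) :
    ∃ e : ℕ → c.formSpace V, (fun k => embed c V (e k)) = ψ ∧
      IsWeakEigenEnumeration (embed c V) a ev e := by
  choose hdom heig using hψ.eigen
  choose e he using fun k => h.exists_of_mem_domain ⟨ψ k, hdom k⟩
  have hfun : (fun k => embed c V (e k)) = ψ := funext he
  refine ⟨e, hfun, hψ.mono, fun k => h.isWeakEigenvector_of_operator (he k) (heig k), fun k => ?_,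
    fun j k hjk hev => ?_, fun μ u hu => ?_⟩
  · rw [he k]
    exact hψ.norm_one k
  · rw [he j, he k]
    exact hψ.orthogonal j k hjk hev
  · obtain ⟨hx, hA⟩ := h.operator_of_isWeakEigenvector hu
    rw [hfun]
    exact hψ.exhaust μ ⟨_, hx⟩ hA

/-- The `k`-th eigenvalue is the least value of the Rayleigh quotient over the trial functions, and is
attained at the `k`-th eigenfunction, up to sign at no other function of norm one. -/
theorem rayleigh_characterization (hV : c.IsPotential V) (h : IsCoerciveForm (embed c V) a m)
    (ha : ∀ (f g : ℝ → ℝ) (hf : f ∈ c.formDomain V) (hg : g ∈ c.formDomain V),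
      a (toFormSpace f hf) (toFormSpace g hg) = c.form V w f g)
    (hs : HasSimpleEigenvalues (embed c V) a)
    (he : IsWeakEigenEnumeration (embed c V) a ev e) (hψ : ∀ k, embed c V (e k) = ψ k) (k : ℕ) :
    IsGLB (c.rayleigh V w '' c.trialFunctions V ψ k) (ev k) ∧
      (∃ f ∈ c.trialFunctions V ψ k, f =ᵐ[c.meas] ψ k) ∧
      ∀ f ∈ c.trialFunctions V ψ k, (∫ x, f x ^ 2 ∂c.meas) = 1 →
        (c.rayleigh V w f = ev k ↔ f =ᵐ[c.meas] ψ k ∨ f =ᵐ[c.meas] -ψ k) := by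
  have hray (f : ℝ → ℝ) (hf : f ∈ c.formDomain V) : c.rayleigh V w f =
      a (toFormSpace f hf) (toFormSpace f hf) / ‖embed c V (toFormSpace f hf)‖ ^ 2 := by
    rw [rayleigh, ha, norm_sq_embed_toFormSpace]
  have hself : a (e k) (e k) = ev k := by
    rw [he.eigen k, real_inner_self_eq_norm_sq, he.norm_one]
    ring
  have horth (f : ℝ → ℝ) (hf : f ∈ c.trialFunctions V ψ k) (j : ℕ) (hj : j < k) :
      inner ℝ (embed c V (e j)) (embed c V (toFormSpace f hf.1)) = 0 := by
    rw [real_inner_comm, inner_embed_toFormSpace, hψ]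
    exact hf.2.2 j hj
  have hae : rep (e k) =ᵐ[c.meas] ψ k := by
    rw [← hψ k]
    exact (embed_ae (e k)).symm
  have hrn : ∫ x, rep (e k) x ^ 2 ∂c.meas = 1 := by
    rw [← norm_sq_embed_toFormSpace (rep_mem (e k)), toFormSpace_rep hV, he.norm_one, one_pow]
  have htrial : rep (e k) ∈ c.trialFunctions V ψ k := by
    refine ⟨rep_mem _, by rw [hrn]; exact one_ne_zero, fun j hj => ?_⟩
    rw [← inner_embed_toFormSpace (rep_mem (e k)), toFormSpace_rep hV, ← hψ j]
    exact (h.orthonormal he).2 hj.ne'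
  refine ⟨IsLeast.isGLB ⟨⟨_, htrial, ?_⟩, ?_⟩, ⟨_, htrial, hae⟩, fun f hf hf1 => ?_⟩
  · rw [hray _ (rep_mem _), toFormSpace_rep hV, he.norm_one, hself, one_pow, div_one]
  · rintro _ ⟨f, hf, rfl⟩
    have hpos : 0 < ‖embed c V (toFormSpace f hf.1)‖ ^ 2 := by
      rw [norm_sq_embed_toFormSpace]
      exact lt_of_le_of_ne (c.integral_sq_nonneg f) (Ne.symm hf.2.1)
    rw [hray f hf.1, le_div_iff₀ hpos]
    exact h.eigenvalue_mul_norm_sq_le he (horth f hf)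
  · have hn1 : ‖embed c V (toFormSpace f hf.1)‖ ^ 2 = 1 := by
      rw [norm_sq_embed_toFormSpace, hf1]
    have hneg : ((-ψ k : c.L2) : ℝ → ℝ) =ᵐ[c.meas] -(ψ k : ℝ → ℝ) := Lp.coeFn_neg _
    rw [hray f hf.1, hn1, div_one]
    constructor
    · intro heq
      obtain ⟨t, ht⟩ := h.eq_smul_of_form_le he hs (horth f hf) (by rw [hn1, heq, mul_one])
      have hfe : f =ᵐ[c.meas] (t • ψ k : c.L2) := by
        rw [← hψ k, ← map_smul, ← ht]
        exact (embed_toFormSpace_ae hf.1).symm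
      have ht1 : t ^ 2 = 1 := by
        rw [ht, map_smul, norm_smul, he.norm_one, mul_one, Real.norm_eq_abs, sq_abs] at hn1
        exact hn1
      rcases sq_eq_sq_iff_eq_or_eq_neg.1 (ht1.trans (one_pow 2).symm) with rfl | rfl
      · left
        rwa [one_smul] at hfe
      · right
        rw [neg_one_smul] at hfe
        exact hfe.trans hneg
    · rintro (hfe | hfe)
      · have : toFormSpace f hf.1 = e k :=
          embed_injective hV ((embed_toFormSpace_eq hf.1 hfe).trans (hψ k).symm)
        rw [this, hself]
      · have : toFormSpace f hf.1 = -e k := by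
          apply embed_injective hV
          rw [map_neg, hψ k]
          exact embed_toFormSpace_eq hf.1 (hfe.trans hneg.symm)
        rw [this]
        simp [hself]

end Problem

end RandomSchrodinger

theorem corollary2p1 {Ω : Type*} [MeasurableSpace Ω] (P : Measure Ω) [IsProbabilityMeasure P]
    (c : RandomSchrodinger.Problem) (V : ℝ → ℝ) (hV : c.IsPotential V)
    (Ξ : ℝ → Ω → ℝ) (hΞ : RandomSchrodinger.IsNoisePrimitive P Ξ) :
    ∀ᵐ ω ∂P,
      c.NoiseFormWellDefined V (fun x => Ξ x ω) ∧
      ∃ H : c.L2 →ₗ.[ℝ] c.L2,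
        c.IsFormOperator V (fun x => Ξ x ω) H ∧
        (∀ H', c.IsFormOperator V (fun x => Ξ x ω) H' → H' = H) ∧
        c.HasCompactResolvent H ∧
        (∃ (ev : ℕ → ℝ) (ψ : ℕ → c.L2), c.IsEigenEnumeration H ev ψ) ∧
        ∀ (ev : ℕ → ℝ) (ψ : ℕ → c.L2), c.IsEigenEnumeration H ev ψ →
          Tendsto ev atTop atTop ∧
          (Orthonormal ℝ ψ ∧ (Submodule.span ℝ (range ψ)).topologicalClosure = ⊤) ∧
          ∀ k : ℕ,
            IsGLB (c.rayleigh V (fun x => Ξ x ω) '' c.trialFunctions V ψ k) (ev k) ∧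
            (∃ f ∈ c.trialFunctions V ψ k, f =ᵐ[c.meas] ψ k) ∧
            ∀ f ∈ c.trialFunctions V ψ k, (∫ x, f x ^ 2 ∂c.meas) = 1 →
              (c.rayleigh V (fun x => Ξ x ω) f = ev k ↔
                f =ᵐ[c.meas] ψ k ∨ f =ᵐ[c.meas] -ψ k) := by
  filter_upwards [hΞ.ae_path] with ω hω
  obtain ⟨hw, C, -, hosc⟩ := hω
  obtain ⟨q, q', hq, hq', hcore, henergy, h₀, h₁⟩ :=
    RandomSchrodinger.Problem.exists_lowerOrder hV hw hosc
  have hB := hq.isFormBilin hV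
  have := RandomSchrodinger.Problem.completeSpace_formSpace hV
  obtain ⟨a, m, h, ha'⟩ := hq'.exists_isCoerciveForm hV
  have ha (f g : ℝ → ℝ) (hf : f ∈ c.formDomain V) (hg : g ∈ c.formDomain V) :
      a (RandomSchrodinger.Problem.toFormSpace f hf)
        (RandomSchrodinger.Problem.toFormSpace g hg) = c.form V (fun x => Ξ x ω) f g := by
    rw [ha', ← henergy, RandomSchrodinger.Problem.form,
      RandomSchrodinger.Problem.noise_eq hV hB hcore hf hg]
  have hs := RandomSchrodinger.Problem.hasSimpleEigenvalues hV hq' h₀ h₁ h.symm ha'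
  refine ⟨RandomSchrodinger.Problem.noiseFormWellDefined hV hB hcore, h.operator,
    RandomSchrodinger.Problem.isFormOperator_operator h ha,
    fun H' hH' => RandomSchrodinger.Problem.eq_operator_of_isFormOperator hV h ha hH',
    h.exists_isCompactOperator_inverse, ?_, fun ev ψ hψ => ?_⟩
  · obtain ⟨ev, e, he⟩ :=
      h.exists_enumeration hs (RandomSchrodinger.Problem.not_finiteDimensional_L2 c)
    exact ⟨ev, _, RandomSchrodinger.Problem.isEigenEnumeration_of_weak h he⟩
  · obtain ⟨e, rfl, he⟩ := RandomSchrodinger.Problem.IsEigenEnumeration.exists_weak h hψ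
    exact ⟨h.tendsto_eigenvalues he, ⟨h.orthonormal he, h.topologicalClosure_span he⟩, fun k =>
      RandomSchrodinger.Problem.rayleigh_characterization hV h ha hs he (fun _ => rfl) k⟩
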